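/- Let $\Lambda$ be the infinite-dimensional complex Grassmann algebra, $V_{\mathbb C}$ a finite-dimensional $\mathbb Z/2$-graded complex vector space with a non-degenerate even supersymmetric bilinear form, $V=V_{\mathbb C}\otimes_{\mathbb C}\Lambda$ with the $\Lambda$-bilinearly extended form $(-,-)$. Let ${\rm End}_\Lambda(V)$ be the $\mathbb Z/2$-graded algebra of right $\Lambda$-linear endomorphisms of $V$, ${\rm GL}(V)$ the group of invertible elements of ${\rm End}_\Lambda(V)_{\bar 0}$, and $G={\rm OSp}(V)\subseteq {\rm GL}(V)$ the subgroup preserving the form. Define $A\mapsto A^\dagger$ by $(Av,w)=(-1)^{[A][v]}(v,A^\dagger w)$ and let ${\rm End}_\Lambda(V)^{\pm}=\{A: A^\dagger=\pm A\}$. Let $T^r$ denote tensor powers over $\Lambda$, and $M^*={\rm Hom}_\Lambda(M,\Lambda)$. Let $g\in{\rm GL}(V)$ act on $T^{2d}(V)$ diagonally, and on ${\rm End}_\Lambda(V)$ by $A\mapsto (g^\dagger)^{-1}Ag^{-1}$. Let $d\ge 0$. For every $L\in (T^{2d}(V)^*)^{G}$ there is a unique $F_L$ in $\mathcal P^d[{\rm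 End}_\Lambda(V)^+_{\bar 0}]\otimes T^{2d}(V)^*$ (the $T^{2d}(V)^*$-valued homogeneous polynomial functions of degree $d$ of $A\in{\rm End}_\Lambda(V)^+_{\bar 0}$) such that $F_L(X^\dagger X\otimes \underline v)=L(Xv_1\otimes\dots\otimes Xv_{2d})$ for all $X\in {\rm End}_\Lambda(V)_{\bar 0}$ and $\underline v=v_1\otimes\dots\otimes v_{2d}$. Moreover there is a unique $$H_L\in (T^d({\rm End}_\Lambda(V))\otimes_\Lambda T^{2d}(V))^*$$ that satisfies (3) and (4) below and is invariant under the supersymmetric permutations of the $d$ factors ${\rm End}_\Lambda(V)$ (that is: satisfies (3) and factors through the symmetrisation of each factor under $\dagger$ followed by the symmetrisation of the $d$ factors), and $H_L$ is ${\rm GL}(V)$-invariant. The following hold. 1. The map $h:L\mapsto H_L$, $(T^{2d}(V)^*)^G\to \left((T^d({\rm End}_\Lambda(V))\otimes_\Lambda T^{2d}(V))^*\right)^{{\rm GL}(V)}$, is $\Lambda$-linear and injective. 2. $H_L({\rm id}_V\otimes\dots\otimes{\rm id}_V\otimes\underline v)=L(\underline v)$ for all $\underline v$. 3. $H_L(A\otimes\dots\otimes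 A\otimes\underline v)=F_L(A\otimes\underline v)$ for all $A\in{\rm End}_\Lambda(V)_{\bar 0}^+$, and if $A=X^\dagger X$ with $X\in{\rm End}_\Lambda(V)_{\bar 0}$, this equals $L(Xv_1\otimes\dots\otimes Xv_{2d})$. 4. $H_L(A_1\otimes\dots\otimes A_d\otimes\underline v)=0$ whenever $A_i^\dagger=-A_i$ for some $i$. -/

import Mathlib

open scoped TensorProduct MulOpposite

noncomputable section

namespace OrthoSymp

/-- The infinite dimensional complex Grassmann algebra `Λ`, i.e. the exterior algebra of a complex
vector space of countable dimension (the direct limit of the exterior algebras of `ℂ^N`). -/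
abbrev Grass : Type := ExteriorAlgebra ℂ (ℕ →₀ ℂ)

/-- The homogeneous part of `Λ` of parity `i`. -/
def grassParity (i : ZMod 2) : Submodule ℂ Grass :=
  CliffordAlgebra.evenOdd (0 : QuadraticForm ℂ (ℕ →₀ ℂ)) i

/-- The parity automorphism of `Λ`: `λ ↦ (-1)^[λ] λ` on homogeneous elements. -/
def grassInv : Grass →ₐ[ℂ] Grass := CliffordAlgebra.involute

/-- The sign `(-1)^(ij)` for parities `i, j`. -/
def superSign (i j : ZMod 2) : ℂ := (-1) ^ (i.val * j.val)

variable {E : Type*} [AddCommGroup E] [Module ℂ E]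

/-- `V = V_ℂ ⊗_ℂ Λ`, where `V_ℂ` is the vector space `E` with the `ℤ/2`-grading `𝒱`. The grading is
recorded in the type because the left action of `Λ` depends on it. -/
def SuperMod (_𝒱 : ZMod 2 → Submodule ℂ E) : Type _ := E ⊗[ℂ] Grass

section SuperModule

variable (𝒱 : ZMod 2 → Submodule ℂ E)

instance : AddCommGroup (SuperMod 𝒱) := inferInstanceAs (AddCommGroup (E ⊗[ℂ] Grass))
instance : Module ℂ (SuperMod 𝒱) := inferInstanceAs (Module ℂ (E ⊗[ℂ] Grass))

/-- The identification of `V` with the tensor product `V_ℂ ⊗_ℂ Λ`. -/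
def ofTensor : (E ⊗[ℂ] Grass) ≃ₗ[ℂ] SuperMod 𝒱 := LinearEquiv.refl ℂ (E ⊗[ℂ] Grass)

/-- The element `e ⊗ a` of `V = V_ℂ ⊗ Λ`. -/
def pureTensor (e : E) (a : Grass) : SuperMod 𝒱 := ofTensor 𝒱 (e ⊗ₜ[ℂ] a)

/-- The homogeneous part of `V` of parity `i`, spanned by the `e ⊗ a` with `[e] + [a] = i`. -/
def modParity (i : ZMod 2) : Submodule ℂ (SuperMod 𝒱) :=
  Submodule.span ℂ
    {x | ∃ j k : ZMod 2, j + k = i ∧ ∃ e ∈ 𝒱 j, ∃ a ∈ grassParity k, x = pureTensor 𝒱 e a}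

/-- Right multiplication by `a`: `e ⊗ b ↦ e ⊗ b a`. -/
def rightMul (a : Grass) : SuperMod 𝒱 →ₗ[ℂ] SuperMod 𝒱 :=
  (ofTensor 𝒱).conj ((LinearMap.mulRight ℂ a).lTensor E)

lemma rightMul_pure (a b : Grass) (e : E) :
    rightMul 𝒱 a (pureTensor 𝒱 e b) = pureTensor 𝒱 e (b * a) := by
  simp [rightMul, pureTensor, LinearEquiv.conj_apply]

lemma pure_add_left (e e' : E) (b : Grass) :
    pureTensor 𝒱 (e + e') b = pureTensor 𝒱 e b + pureTensor 𝒱 e' b := by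
  simp [pureTensor, TensorProduct.add_tmul]

lemma pure_add_right (e : E) (b c : Grass) :
    pureTensor 𝒱 e (b + c) = pureTensor 𝒱 e b + pureTensor 𝒱 e c := by
  simp [pureTensor, TensorProduct.tmul_add]

lemma pure_zero_left (b : Grass) : pureTensor 𝒱 (0 : E) b = 0 := by simp [pureTensor]

lemma pure_zero_right (e : E) : pureTensor 𝒱 e (0 : Grass) = 0 := by simp [pureTensor]

lemma superMod_hom_ext {N : Type*} [AddCommGroup N] [Module ℂ N]
    {f g : SuperMod 𝒱 →ₗ[ℂ] N}
    (h : ∀ e b, f (pureTensor 𝒱 e b) = g (pureTensor 𝒱 e b)) : f = g := by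
  have h' : f ∘ₗ (ofTensor 𝒱).toLinearMap = g ∘ₗ (ofTensor 𝒱).toLinearMap :=
    TensorProduct.ext' h
  ext x
  obtain ⟨y, rfl⟩ := (ofTensor 𝒱).surjective x
  exact LinearMap.congr_fun h' y

/-- `V` is a right `Λ`-module. -/
instance : Module Grassᵐᵒᵖ (SuperMod 𝒱) where
  smul a x := rightMul 𝒱 a.unop x
  one_smul x := by
    change rightMul 𝒱 1 x = x
    exact LinearMap.congr_fun (superMod_hom_ext 𝒱 (f := rightMul 𝒱 1) (g := LinearMap.id)
      fun e b => by simp [rightMul_pure]) x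
  mul_smul a c x := by
    change rightMul 𝒱 (c.unop * a.unop) x = rightMul 𝒱 a.unop (rightMul 𝒱 c.unop x)
    exact LinearMap.congr_fun (superMod_hom_ext 𝒱 (f := rightMul 𝒱 (c.unop * a.unop))
      (g := rightMul 𝒱 a.unop ∘ₗ rightMul 𝒱 c.unop)
      fun e b => by simp [rightMul_pure, mul_assoc]) x
  smul_zero a := map_zero _
  smul_add a := map_add _
  add_smul a c x := by
    change rightMul 𝒱 (a.unop + c.unop) x = rightMul 𝒱 a.unop x + rightMul 𝒱 c.unop x
    exact LinearMap.congr_fun (superMod_hom_ext 𝒱 (f := rightMul 𝒱 (a.unop + c.unop))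
      (g := rightMul 𝒱 a.unop + rightMul 𝒱 c.unop)
      fun e b => by simp [rightMul_pure, mul_add, pure_add_right]) x
  zero_smul x := by
    change rightMul 𝒱 0 x = 0
    exact LinearMap.congr_fun (superMod_hom_ext 𝒱 (f := rightMul 𝒱 0) (g := 0)
      fun e b => by simp [rightMul_pure, pure_zero_right]) x

lemma op_smul_eq (a : Grass) (x : SuperMod 𝒱) : MulOpposite.op a • x = rightMul 𝒱 a x := rfl

instance : SMulCommClass Grassᵐᵒᵖ ℂ (SuperMod 𝒱) where
  smul_comm a c x := map_smul (rightMul 𝒱 a.unop) c x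

/-- The map `w ⊗ b ↦ (e, w)_ℂ b` from `V` to `Λ`. -/
def contract (B : LinearMap.BilinForm ℂ E) (e : E) : SuperMod 𝒱 →ₗ[ℂ] Grass :=
  (TensorProduct.lid ℂ Grass).toLinearMap ∘ₗ (B e).rTensor Grass ∘ₗ
    (ofTensor 𝒱).symm.toLinearMap

lemma contract_pure (B : LinearMap.BilinForm ℂ E) (e w : E) (b : Grass) :
    contract 𝒱 B e (pureTensor 𝒱 w b) = B e w • b := by
  simp [contract, pureTensor]

variable [DirectSum.Decomposition 𝒱]

/-- The projection of `V_ℂ` onto its homogeneous part of parity `i`. -/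
def gradeProj (i : ZMod 2) : E →ₗ[ℂ] E :=
  (𝒱 i).subtype ∘ₗ DirectSum.component ℂ (ZMod 2) (fun i => 𝒱 i) i ∘ₗ
    (DirectSum.decomposeLinearEquiv 𝒱).toLinearMap

lemma gradeProj_apply (i : ZMod 2) (e : E) :
    gradeProj 𝒱 i e = (DirectSum.decompose 𝒱 e i : E) := rfl

/-- Left multiplication by `a`: `e ⊗ b ↦ (-1)^([a][e]) e ⊗ a b` for homogeneous `a, e`. -/
def leftMul (a : Grass) : SuperMod 𝒱 →ₗ[ℂ] SuperMod 𝒱 :=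
  (ofTensor 𝒱).conj (TensorProduct.map (gradeProj 𝒱 0) (LinearMap.mulLeft ℂ a) +
    TensorProduct.map (gradeProj 𝒱 1) (LinearMap.mulLeft ℂ (grassInv a)))

lemma leftMul_pure (a b : Grass) (e : E) :
    leftMul 𝒱 a (pureTensor 𝒱 e b) =
      pureTensor 𝒱 (gradeProj 𝒱 0 e) (a * b) +
        pureTensor 𝒱 (gradeProj 𝒱 1 e) (grassInv a * b) := by
  simp [leftMul, pureTensor, LinearEquiv.conj_apply]

lemma gradeProj_add (e : E) : gradeProj 𝒱 0 e + gradeProj 𝒱 1 e = e := by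
  classical
  have h := DirectSum.sum_support_decompose 𝒱 e
  rw [Finset.sum_subset (Finset.subset_univ _)
    (fun i _ hi => by simpa using hi)] at h
  exact (Fin.sum_univ_two (fun i : ZMod 2 => (DirectSum.decompose 𝒱 e i : E))).symm.trans h

lemma gradeProj_same (i : ZMod 2) (e : E) :
    gradeProj 𝒱 i (gradeProj 𝒱 i e) = gradeProj 𝒱 i e := by
  simp [gradeProj_apply]

lemma gradeProj_ne {i j : ZMod 2} (h : i ≠ j) (e : E) :
    gradeProj 𝒱 j (gradeProj 𝒱 i e) = 0 := by
  rw [gradeProj_apply, gradeProj_apply]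
  exact DirectSum.decompose_of_mem_ne 𝒱 (SetLike.coe_mem _) h

/-- `V` is a left `Λ`-module. -/
instance : Module Grass (SuperMod 𝒱) where
  smul a x := leftMul 𝒱 a x
  one_smul x := by
    change leftMul 𝒱 1 x = x
    refine LinearMap.congr_fun (superMod_hom_ext 𝒱 (f := leftMul 𝒱 1) (g := LinearMap.id)
      fun e b => ?_) x
    rw [leftMul_pure, map_one, one_mul, ← pure_add_left, gradeProj_add, LinearMap.id_apply]
  mul_smul a c x := by
    change leftMul 𝒱 (a * c) x = leftMul 𝒱 a (leftMul 𝒱 c x)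
    refine LinearMap.congr_fun (superMod_hom_ext 𝒱 (f := leftMul 𝒱 (a * c))
      (g := leftMul 𝒱 a ∘ₗ leftMul 𝒱 c) fun e b => ?_) x
    simp [leftMul_pure, gradeProj_same, gradeProj_ne 𝒱 (zero_ne_one (α := ZMod 2)),
      gradeProj_ne 𝒱 (one_ne_zero (α := ZMod 2)), pure_zero_left, mul_assoc]
  smul_zero a := map_zero _
  smul_add a := map_add _
  add_smul a c x := by
    change leftMul 𝒱 (a + c) x = leftMul 𝒱 a x + leftMul 𝒱 c x
    refine LinearMap.congr_fun (superMod_hom_ext 𝒱 (f := leftMul 𝒱 (a + c))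
      (g := leftMul 𝒱 a + leftMul 𝒱 c) fun e b => ?_) x
    simp only [leftMul_pure, map_add, add_mul, pure_add_right, LinearMap.add_apply]
    abel
  zero_smul x := by
    change leftMul 𝒱 0 x = 0
    refine LinearMap.congr_fun (superMod_hom_ext 𝒱 (f := leftMul 𝒱 0) (g := 0)
      fun e b => ?_) x
    simp [leftMul_pure, pure_zero_right]

lemma smul_eq_leftMul (a : Grass) (x : SuperMod 𝒱) : a • x = leftMul 𝒱 a x := rfl

instance : SMulCommClass Grassᵐᵒᵖ Grass (SuperMod 𝒱) where
  smul_comm a c x := by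
    change rightMul 𝒱 a.unop (leftMul 𝒱 c x) = leftMul 𝒱 c (rightMul 𝒱 a.unop x)
    refine LinearMap.congr_fun (superMod_hom_ext 𝒱 (f := rightMul 𝒱 a.unop ∘ₗ leftMul 𝒱 c)
      (g := leftMul 𝒱 c ∘ₗ rightMul 𝒱 a.unop) fun e b => ?_) x
    simp [leftMul_pure, rightMul_pure, mul_assoc]

/-- `End_Λ(V)`: the endomorphisms of `V` commuting with the right action of `Λ`. -/
abbrev EndL : Type _ := Module.End Grassᵐᵒᵖ (SuperMod 𝒱)

/-- The right action of `Λ` on `End_Λ(V)`: `(A a)(v) = A (a v)`. -/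
def endRightMul (a : Grass) (A : EndL 𝒱) : EndL 𝒱 :=
  A ∘ₗ
    { toFun := fun v => a • v
      map_add' := smul_add a
      map_smul' := fun c v => (smul_comm c a v).symm }

/-- `A` is homogeneous of parity `i`. -/
def HasParity (i : ZMod 2) (A : EndL 𝒱) : Prop :=
  ∀ j : ZMod 2, ∀ v ∈ modParity 𝒱 j, A v ∈ modParity 𝒱 (i + j)

/-- The even endomorphisms `End_Λ(V)_0`. -/
def evenEnd : Subring (EndL 𝒱) where
  carrier := {A | HasParity 𝒱 0 A}
  zero_mem' := fun _ _ _ => Submodule.zero_mem _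
  one_mem' := fun j v hv => by simpa using hv
  add_mem' := fun hA hB j v hv => Submodule.add_mem _ (hA j v hv) (hB j v hv)
  neg_mem' := fun hA j v hv => Submodule.neg_mem _ (hA j v hv)
  mul_mem' := fun {A B} hA hB j v hv => by
    have h := hA _ _ (hB j v hv)
    rwa [zero_add] at h

/-- `GL(V)`: the group of invertible elements of `End_Λ(V)_0`. -/
abbrev GLSuper : Type _ := (evenEnd 𝒱)ˣ

/-- The endomorphism of `V` underlying `g ∈ GL(V)`. -/
def GLSuper.toEnd {𝒱 : ZMod 2 → Submodule ℂ E} [DirectSum.Decomposition 𝒱] (g : GLSuper 𝒱) :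
    EndL 𝒱 := ((g : evenEnd 𝒱) : EndL 𝒱)

/-- `T^r(V)^* = Hom_Λ(V ⊗_Λ ⋯ ⊗_Λ V, Λ)`. By the universal property of the tensor product over
`Λ`, its elements are the multilinear maps `f` on `V^r` that are `Λ`-balanced,
`f(…, v_i a, v_{i+1}, …) = f(…, v_i, a v_{i+1}, …)`, and right `Λ`-linear,
`f(v_1, …, v_r a) = f(v_1, …, v_r) a`; here `f(v_1, …, v_r)` is the value at `v_1 ⊗ ⋯ ⊗ v_r`.
It is a `Λ`-module by `(a f)(v) = a f(v)`. -/
def tensorDual (r : ℕ) :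
    Submodule Grass (MultilinearMap ℂ (fun _ : Fin r => SuperMod 𝒱) Grass) where
  carrier := {f |
    (∀ (v : Fin r → SuperMod 𝒱) (i : Fin r) (hi : i.1 + 1 < r) (a : Grass),
      f (Function.update v i (MulOpposite.op a • v i)) =
        f (Function.update v ⟨i.1 + 1, hi⟩ (a • v ⟨i.1 + 1, hi⟩))) ∧
    (∀ (v : Fin r → SuperMod 𝒱) (i : Fin r), i.1 + 1 = r → ∀ a : Grass,
      f (Function.update v i (MulOpposite.op a • v i)) = f v * a)}
  add_mem' := fun {f g} hf hg =>
    ⟨fun v i hi a => by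
      simp only [add_apply]
      rw [hf.1 v i hi a, hg.1 v i hi a],
    fun v i hi a => by
      simp only [add_apply]
      rw [hf.2 v i hi a, hg.2 v i hi a, add_mul]⟩
  zero_mem' := ⟨fun _ _ _ _ => rfl, fun _ _ _ _ => by simp⟩
  smul_mem' := fun c f hf =>
    ⟨fun v i hi a => by
      simp only [smul_apply]
      rw [hf.1 v i hi a],
    fun v i hi a => by
      simp only [smul_apply]
      rw [hf.2 v i hi a, smul_eq_mul, smul_eq_mul, mul_assoc]⟩

instance (r : ℕ) : SMulCommClass ℂ Grass
    (MultilinearMap ℂ (fun _ : Fin r => SuperMod 𝒱) Grass) where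
  smul_comm c a f := by
    ext v
    exact smul_comm c a (f v)

/-- Maps on `d` endomorphisms and `2d` vectors, multilinear over `ℂ`. -/
abbrev MixedMultilinear (d : ℕ) : Type _ :=
  MultilinearMap ℂ (fun _ : Fin d => EndL 𝒱)
    (MultilinearMap ℂ (fun _ : Fin (2 * d) => SuperMod 𝒱) Grass)

/-- `(T^d(End_Λ(V)) ⊗_Λ T^{2d}(V))^*`, the right `Λ`-linear maps to `Λ`. As for `tensorDual`, its
elements are the multilinear maps that are `Λ`-balanced between any two consecutive arguments of
`A_1, …, A_d, v_1, …, v_{2d}`, and right `Λ`-linear in the last one; `H A v` is the value of `H` at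
`A_1 ⊗ ⋯ ⊗ A_d ⊗ v_1 ⊗ ⋯ ⊗ v_{2d}`. -/
def mixedDual (d : ℕ) : Submodule Grass (MixedMultilinear 𝒱 d) where
  carrier := {H |
    (∀ A, H A ∈ tensorDual 𝒱 (2 * d)) ∧
    (∀ (A : Fin d → EndL 𝒱) (i : Fin d) (hi : i.1 + 1 < d) (a : Grass),
      H (Function.update A i (endRightMul 𝒱 a (A i))) =
        H (Function.update A ⟨i.1 + 1, hi⟩ (a • A ⟨i.1 + 1, hi⟩))) ∧
    (∀ (A : Fin d → EndL 𝒱) (i : Fin d), i.1 + 1 = d →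
      ∀ (h0 : 0 < 2 * d) (a : Grass) (v : Fin (2 * d) → SuperMod 𝒱),
      H (Function.update A i (endRightMul 𝒱 a (A i))) v =
        H A (Function.update v ⟨0, h0⟩ (a • v ⟨0, h0⟩)))}
  add_mem' := fun {H K} hH hK =>
    ⟨fun A => Submodule.add_mem _ (hH.1 A) (hK.1 A),
    fun A i hi a => by
      simp only [add_apply]
      rw [hH.2.1 A i hi a, hK.2.1 A i hi a],
    fun A i hi h0 a v => by
      simp only [add_apply]
      rw [hH.2.2 A i hi h0 a v, hK.2.2 A i hi h0 a v]⟩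
  zero_mem' := ⟨fun _ => Submodule.zero_mem _, fun _ _ _ _ => rfl, fun _ _ _ _ _ _ => rfl⟩
  smul_mem' := fun c H hH =>
    ⟨fun A => Submodule.smul_mem _ c (hH.1 A),
    fun A i hi a => by
      simp only [smul_apply]
      rw [hH.2.1 A i hi a],
    fun A i hi h0 a v => by
      simp only [smul_apply]
      rw [hH.2.2 A i hi h0 a v]⟩

/-- `(-, -)_ℂ` is a non-degenerate even supersymmetric bilinear form on `V_ℂ`. -/
structure IsOrthosymplectic (𝒱 : ZMod 2 → Submodule ℂ E) (B : LinearMap.BilinForm ℂ E) :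
    Prop where
  even : ∀ i j, i ≠ j → ∀ v ∈ 𝒱 i, ∀ w ∈ 𝒱 j, B v w = 0
  supersymmetric : ∀ i j, ∀ v ∈ 𝒱 i, ∀ w ∈ 𝒱 j, B v w = superSign i j * B w v
  nondegenerate : B.Nondegenerate

variable (B : LinearMap.BilinForm ℂ E)

/-- The `Λ`-bilinear extension of the form to `V`:
`(e ⊗ a, y) = (e, a y)`, where `(e, w ⊗ b) = (e, w)_ℂ b`. -/
def superForm : SuperMod 𝒱 →ₗ[ℂ] SuperMod 𝒱 →ₗ[ℂ] Grass :=
  (TensorProduct.lift (LinearMap.mk₂ ℂ (fun e a => contract 𝒱 B e ∘ₗ leftMul 𝒱 a)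
    (fun e e' a => superMod_hom_ext 𝒱 fun w b => by
      simp [leftMul_pure, contract_pure, add_smul]; abel)
    (fun c e a => superMod_hom_ext 𝒱 fun w b => by
      simp [leftMul_pure, contract_pure, mul_smul])
    (fun e a a' => superMod_hom_ext 𝒱 fun w b => by
      simp [leftMul_pure, contract_pure, add_mul]; abel)
    (fun c e a => superMod_hom_ext 𝒱 fun w b => by
      simp [leftMul_pure, contract_pure, smul_comm c]))) ∘ₗ (ofTensor 𝒱).symm.toLinearMap

lemma superForm_pure (e w : E) (a b : Grass) :
    superForm 𝒱 B (pureTensor 𝒱 e a) (pureTensor 𝒱 w b) =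
      B e (gradeProj 𝒱 0 w) • (a * b) + B e (gradeProj 𝒱 1 w) • (grassInv a * b) := by
  rw [← contract_pure, ← contract_pure, ← map_add, ← leftMul_pure]
  simp [superForm, pureTensor]

/-- `OSp(V)`: the elements of `GL(V)` that preserve the form. -/
def OSp : Subgroup (GLSuper 𝒱) where
  carrier := {g | ∀ v w, superForm 𝒱 B (g.toEnd v) (g.toEnd w) = superForm 𝒱 B v w}
  one_mem' := fun _ _ => rfl
  mul_mem' := fun {g g'} hg hg' v w => (hg _ _).trans (hg' v w)
  inv_mem' := fun {g} hg v w => by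
    have h : ∀ x, g.toEnd ((g⁻¹ : GLSuper 𝒱).toEnd x) = x := fun x =>
      LinearMap.congr_fun (congrArg (fun A : evenEnd 𝒱 => (A : EndL 𝒱)) g.mul_inv) x
    rw [← hg, h, h]

/-- For homogeneous `A` of parity `i`: `A'` is the adjoint `A^†`, i.e.
`(A v, w) = (-1)^([A][v]) (v, A^† w)`. -/
def IsHomAdjoint (i : ZMod 2) (A A' : EndL 𝒱) : Prop :=
  HasParity 𝒱 i A ∧ HasParity 𝒱 i A' ∧
    ∀ j : ZMod 2, ∀ v ∈ modParity 𝒱 j, ∀ w,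
      superForm 𝒱 B (A v) w = superSign i j • superForm 𝒱 B v (A' w)

/-- `A' = A^†` for arbitrary `A`, by additivity from the homogeneous components. (By
non-degeneracy every `A` has exactly one such `A'`.) -/
def IsSuperadjoint (A A' : EndL 𝒱) : Prop :=
  ∃ A₀ A₁ A₀' A₁' : EndL 𝒱, A = A₀ + A₁ ∧ A' = A₀' + A₁' ∧
    IsHomAdjoint 𝒱 B 0 A₀ A₀' ∧ IsHomAdjoint 𝒱 B 1 A₁ A₁'

/-- `(T^r(V)^*)^{OSp(V)}`. -/
def ospInvariants (r : ℕ) :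
    Submodule Grass (MultilinearMap ℂ (fun _ : Fin r => SuperMod 𝒱) Grass) where
  carrier := {L | L ∈ tensorDual 𝒱 r ∧
    ∀ g ∈ OSp 𝒱 B, ∀ v, L (fun j => g.toEnd (v j)) = L v}
  add_mem' := fun {L M} hL hM => ⟨Submodule.add_mem _ hL.1 hM.1, fun g hg v => by
    simp only [add_apply]
    rw [hL.2 g hg v, hM.2 g hg v]⟩
  zero_mem' := ⟨Submodule.zero_mem _, fun _ _ _ => rfl⟩
  smul_mem' := fun c L hL => ⟨Submodule.smul_mem _ c hL.1, fun g hg v => by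
    simp only [smul_apply]
    rw [hL.2 g hg v]⟩

/-- `((T^d(End_Λ(V)) ⊗ T^{2d}(V))^*)^{GL(V)}`, where `g ∈ GL(V)` acts on `V` naturally and on
`End_Λ(V)` by `A ↦ ĝ A g⁻¹` with `ĝ = (g^†)⁻¹`. -/
def glInvariants (d : ℕ) : Submodule Grass (MixedMultilinear 𝒱 d) where
  carrier := {H | H ∈ mixedDual 𝒱 d ∧
    ∀ g ghat : GLSuper 𝒱, IsSuperadjoint 𝒱 B g.toEnd (ghat⁻¹ : GLSuper 𝒱).toEnd →
      ∀ A v, H (fun i => ghat.toEnd * A i * (g⁻¹ : GLSuper 𝒱).toEnd)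
        (fun j => g.toEnd (v j)) = H A v}
  add_mem' := fun {H K} hH hK => ⟨Submodule.add_mem _ hH.1 hK.1, fun g k hg A v => by
    simp only [add_apply]
    rw [hH.2 g k hg A v, hK.2 g k hg A v]⟩
  zero_mem' := ⟨Submodule.zero_mem _, fun _ _ _ _ _ => rfl⟩
  smul_mem' := fun c H hH => ⟨Submodule.smul_mem _ c hH.1, fun g k hg A v => by
    simp only [smul_apply]
    rw [hH.2 g k hg A v]⟩

/-- `End_Λ(V)_0^+`: the even `A` with `A^† = A`. -/
def EvenSym : Type _ := {A : EndL 𝒱 // HasParity 𝒱 0 A ∧ IsSuperadjoint 𝒱 B A A}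

/-- `A = ω(X) = X^† X` with `X ∈ End_Λ(V)_0`. -/
def IsOmega (A X : EndL 𝒱) : Prop :=
  HasParity 𝒱 0 X ∧ ∃ X', IsSuperadjoint 𝒱 B X X' ∧ A = X' * X

/-- `F` belongs to `𝒫^d[End_Λ(V)_0^+] ⊗ T^{2d}(V)^*`: it is a homogeneous polynomial function of
degree `d` of `A ∈ End_Λ(V)_0^+` with values in `T^{2d}(V)^*`, i.e. the restriction to the diagonal
`A ⊗ ⋯ ⊗ A` of a `Λ`-linear form on `T^d(End_Λ(V)) ⊗ T^{2d}(V)`. -/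
def IsPolyForm (d : ℕ) (F : EvenSym 𝒱 B → (Fin (2 * d) → SuperMod 𝒱) → Grass) : Prop :=
  ∃ K ∈ mixedDual 𝒱 d, ∀ A v, F A v = K (fun _ => A.1) v

/-- `F = F_L`: a polynomial form of degree `d` with `F(X^† X ⊗ v) = L(X v_1 ⊗ ⋯ ⊗ X v_{2d})` for all
`X ∈ End_Λ(V)_0`. -/
def IsPolyLift (d : ℕ) (L : MultilinearMap ℂ (fun _ : Fin (2 * d) => SuperMod 𝒱) Grass)
    (F : EvenSym 𝒱 B → (Fin (2 * d) → SuperMod 𝒱) → Grass) : Prop :=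
  IsPolyForm 𝒱 B d F ∧
    ∀ (A : EvenSym 𝒱 B) (X : EndL 𝒱), IsOmega 𝒱 B A.1 X →
      ∀ v, F A v = L (fun j => X (v j))

/-- `H` is invariant under the supersymmetric interchange of adjacent `End_Λ(V)`-factors. -/
def IsSupersymmetric {d : ℕ} (H : MixedMultilinear 𝒱 d) : Prop :=
  ∀ (i : Fin d) (hi : i.1 + 1 < d) (p q : ZMod 2) (A : Fin d → EndL 𝒱),
    HasParity 𝒱 p (A i) → HasParity 𝒱 q (A ⟨i.1 + 1, hi⟩) →
      H (A ∘ Equiv.swap i ⟨i.1 + 1, hi⟩) = superSign p q • H A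

/-- `H` vanishes as soon as one of the `End_Λ(V)`-factors satisfies `A^† = -A`. -/
def KillsAntisymmetric {d : ℕ} (H : MixedMultilinear 𝒱 d) : Prop :=
  ∀ (A : Fin d → EndL 𝒱) (i : Fin d), IsSuperadjoint 𝒱 B (A i) (-(A i)) → H A = 0

/-- `H` factors through the canonical surjection
`T^d(End_Λ(V)) ⊗ T^{2d}(V) ≅ T^{2d}(V^*) ⊗ T^{2d}(V) → S^d(S²(V^*)) ⊗ T^{2d}(V)`, which symmetrises
each `End_Λ(V)`-factor under `†` and then symmetrises the `d` factors among themselves. -/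
def FactorsThroughSym {d : ℕ} (H : MixedMultilinear 𝒱 d) : Prop :=
  KillsAntisymmetric 𝒱 B H ∧ IsSupersymmetric 𝒱 H

end SuperModule

end OrthoSymp

end

open scoped TensorProduct MulOpposite

noncomputable section

namespace OrthoSymp

/-! ### Signs of parities in `ZMod 2`. -/

section Signs

/-! Write ω(X) = X†X. Two facts carry the proof. First, a form that factors through the
symmetrisations is determined by its diagonal values at the elements ω(X) (`eq_of_omega`). Second,
for every OSp-invariant L there is such a form whose diagonal value at ω(X) is L(Xv_1, …, Xv_{2d})
(`exists_lift`). The first makes the choice in the second unique, hence linear in L. It also gives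
GL(V)-invariance, because the action turns ω(X) into ω(Xg⁻¹). Injectivity is the case X = 1.

Existence. Morally L(Xv) = L(√A v) for A = X†X, by polar decomposition and invariance, but √A is not
polynomial in A. Instead let K(A, …, A) be the coefficient of t^d in L((1+tA)^{1/2}v_1, …,
(1+tA)^{1/2}v_{2d}), which is a form of degree d in A (`exists_sqrtForm`). V splits into orthogonal
blocks, lines spanned by even vectors and planes spanned by two odd ones, and every even
self-adjoint endomorphism compresses to a scalar on each block (`exists_blockDecomposition`).
Suppose X acts by the scalar x_k on block k. Invariance of L under the reflection in a block kills
every component of v that meets some block an odd number of times. For the others the product of the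
(1+t x²)^{1/2} over the arguments is a polynomial in t of degree at most d, whose t^d coefficient is
the product of the x (`sum_sqrtCoeff_mul`). So K(X², …, X²) = L(Xv, …) for such X (`lift_diagonal`).

General X is reached by nilpotent perturbation in place of density. Because Λ has infinitely many
generators, for each a and n there is an even s with s^{n+1} = 0 such that a s^n = 0 only if a = 0
(`exists_even_nilpotent_regular`). Let σ be a nonzero complex number. If C is self-adjoint and D is
a distinct constant on each block, then σD + sC is diagonalised by OSp(V) in finitely many steps
(`induction_on_conj`); for arbitrary even Y, σ + sY has a polar decomposition (`exists_polar`).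
Hence the identity holds at these elements. Both sides are polynomial in σ, so it holds at σ = 0,
where homogeneity turns it into s^{2d} times the wanted identity (`polynomial_degeneration`).

Uniqueness uses the same device. The element σ² + sC is ω of a self-adjoint element, so a form
vanishing at all ω(X) vanishes on the diagonal of the even self-adjoint endomorphisms
(`eq_zero_selfadjoint_diag`). Polarisation, multiplication of odd slots by a fresh odd scalar, and
the vanishing on antisymmetric slots then give zero everywhere (`eq_zero_of_omega`). -/

lemma zmod_two_cases (i : ZMod 2) : i = 0 ∨ i = 1 := by
  revert i; decide

/-- The sign `(-1)^i`. -/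
def paritySign (i : ZMod 2) : ℂ := (-1) ^ i.val

@[simp] lemma paritySign_zero : paritySign 0 = 1 := by simp [paritySign]

@[simp] lemma paritySign_one : paritySign 1 = -1 := by simp [paritySign, ZMod.val_one]

lemma paritySign_add (i j : ZMod 2) : paritySign (i + j) = paritySign i * paritySign j := by
  rcases zmod_two_cases i with rfl | rfl <;> rcases zmod_two_cases j with rfl | rfl <;>
    simp [show (1 + 1 : ZMod 2) = 0 from rfl]

@[simp] lemma paritySign_mul_self (i : ZMod 2) : paritySign i * paritySign i = 1 := by
  rcases zmod_two_cases i with rfl | rfl <;> simp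

lemma superSign_eq (i j : ZMod 2) : superSign i j = paritySign (i * j) := by
  rcases zmod_two_cases i with rfl | rfl <;> rcases zmod_two_cases j with rfl | rfl <;>
    simp [superSign, ZMod.val_one]

@[simp] lemma superSign_zero_left (j : ZMod 2) : superSign 0 j = 1 := by simp [superSign]

@[simp] lemma superSign_zero_right (j : ZMod 2) : superSign j 0 = 1 := by simp [superSign]

@[simp] lemma superSign_one_left (j : ZMod 2) : superSign 1 j = paritySign j := by
  simp [superSign_eq]

@[simp] lemma superSign_one_right (j : ZMod 2) : superSign j 1 = paritySign j := by
  simp [superSign_eq]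

lemma superSign_comm (i j : ZMod 2) : superSign i j = superSign j i := by
  simp [superSign_eq, mul_comm]

lemma superSign_add_left (i j k : ZMod 2) :
    superSign (i + j) k = superSign i k * superSign j k := by
  simp [superSign_eq, add_mul, paritySign_add]

lemma superSign_add_right (i j k : ZMod 2) :
    superSign i (j + k) = superSign i j * superSign i k := by
  simp [superSign_eq, mul_add, paritySign_add]

@[simp] lemma superSign_mul_self (i j : ZMod 2) : superSign i j * superSign i j = 1 := by
  simp [superSign_eq]

end Signs

/-! ### The Grassmann algebra: supercommutativity and regular elements. -/

section Grassmann

lemma grassInv_ι (m : ℕ →₀ ℂ) : grassInv (ExteriorAlgebra.ι ℂ m) = -ExteriorAlgebra.ι ℂ m :=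
  CliffordAlgebra.involute_ι m

@[simp] lemma grassInv_grassInv (a : Grass) : grassInv (grassInv a) = a :=
  CliffordAlgebra.involute_involute a

lemma grassInv_of_mem {i : ZMod 2} {a : Grass} (ha : a ∈ grassParity i) :
    grassInv a = paritySign i • a := by
  rcases zmod_two_cases i with rfl | rfl
  · rw [paritySign_zero, one_smul]
    exact CliffordAlgebra.involute_eq_of_mem_even ha
  · rw [paritySign_one, neg_one_smul]
    exact CliffordAlgebra.involute_eq_of_mem_odd ha

lemma exists_even_add_odd (a : Grass) :
    ∃ b ∈ grassParity 0, ∃ c ∈ grassParity 1, b + c = a :=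
  Submodule.mem_sup.1
    ((CliffordAlgebra.evenOdd_isCompl (Q := (0 : QuadraticForm ℂ (ℕ →₀ ℂ)))).sup_eq_top ▸
      Submodule.mem_top)

/-- The two homogeneous parts are the eigenspaces of `grassInv` for 1 and -1, and 2 is invertible.
-/
lemma mem_grassParity_iff {i : ZMod 2} {a : Grass} :
    a ∈ grassParity i ↔ grassInv a = paritySign i • a := by
  refine ⟨grassInv_of_mem, fun h => ?_⟩
  obtain ⟨b, hb, c, hc, rfl⟩ := exists_even_add_odd a
  rw [map_add, grassInv_of_mem hb, grassInv_of_mem hc] at h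
  rcases zmod_two_cases i with rfl | rfl
  · simp only [paritySign_zero, one_smul, paritySign_one, neg_one_smul, add_right_inj] at h
    have : c = 0 := by
      have h2 : (2 : ℂ) • c = 0 := by rw [two_smul]; nth_rewrite 1 [← h]; simp
      simpa using h2
    simpa [this] using hb
  · simp only [paritySign_zero, one_smul, paritySign_one, neg_one_smul, neg_add_rev] at h
    have : b = 0 := by
      have h2 : (2 : ℂ) • b = 0 := by
        have h3 : b = -b := calc
          b = b + -c + c := by abel
          _ = -b := by rw [h]; abel
        rw [two_smul]; nth_rewrite 1 [h3]; simp
      simpa using h2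
    simpa [this] using hc

lemma grassParity_mul {i j : ZMod 2} {a b : Grass} (ha : a ∈ grassParity i)
    (hb : b ∈ grassParity j) : a * b ∈ grassParity (i + j) :=
  CliffordAlgebra.evenOdd_mul_le _ i j (Submodule.mul_mem_mul ha hb)

lemma one_mem_grassParity : (1 : Grass) ∈ grassParity 0 := by
  simp [mem_grassParity_iff]

lemma ι_mem_grassParity (m : ℕ →₀ ℂ) : ExteriorAlgebra.ι ℂ m ∈ grassParity 1 := by
  simp [mem_grassParity_iff, grassInv_ι]

/-- Generators anticommute. With `grassInv` carrying the sign, the rule is multiplicative in `a` and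
needs no homogeneity. -/
lemma ι_mul_eq (m : ℕ →₀ ℂ) (a : Grass) :
    ExteriorAlgebra.ι ℂ m * a = grassInv a * ExteriorAlgebra.ι ℂ m := by
  induction a using ExteriorAlgebra.induction with
  | algebraMap r => simp [Algebra.commutes]
  | ι x =>
    rw [grassInv_ι, neg_mul]
    exact eq_neg_of_add_eq_zero_left (ExteriorAlgebra.ι_add_mul_swap m x)
  | mul a b ha hb => rw [← mul_assoc, ha, mul_assoc, hb, map_mul, mul_assoc]
  | add a b ha hb => rw [mul_add, ha, hb, map_add, add_mul]

lemma even_mul_comm {a : Grass} (ha : a ∈ grassParity 0) (b : Grass) : a * b = b * a := by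
  have h : grassInv a = a := by simpa using grassInv_of_mem ha
  induction b using ExteriorAlgebra.induction with
  | algebraMap r => exact (Algebra.commutes r a).symm
  | ι x => rw [ι_mul_eq, h]
  | mul b c hb hc => rw [← mul_assoc, hb, mul_assoc, hc, mul_assoc]
  | add b c hb hc => rw [mul_add, hb, hc, add_mul]

lemma odd_mul_comm {a : Grass} (ha : a ∈ grassParity 1) (b : Grass) :
    a * b = grassInv b * a := by
  have h : grassInv a = -a := by simpa using grassInv_of_mem ha
  induction b using ExteriorAlgebra.induction with
  | algebraMap r => simp [Algebra.commutes]
  | ι x => rw [grassInv_ι, neg_mul, ι_mul_eq, h, neg_mul, neg_neg]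
  | mul b c hb hc => rw [← mul_assoc, hb, mul_assoc, hc, map_mul, mul_assoc]
  | add b c hb hc => rw [mul_add, hb, hc, map_add, add_mul]

lemma mul_comm_of_mem {i j : ZMod 2} {a b : Grass} (ha : a ∈ grassParity i)
    (hb : b ∈ grassParity j) : a * b = superSign i j • (b * a) := by
  rcases zmod_two_cases i with rfl | rfl
  · simp [even_mul_comm ha b]
  · simp [odd_mul_comm ha b, grassInv_of_mem hb]

lemma odd_mul_self {a : Grass} (ha : a ∈ grassParity 1) : a * a = 0 := by
  have h := mul_comm_of_mem ha ha
  simp only [superSign_one_left, paritySign_one, neg_one_smul] at h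
  have h2 : (2 : ℂ) • (a * a) = 0 := by rw [two_smul]; nth_rewrite 1 [h]; simp
  simpa using h2

/-- The automorphism `λ ↦ (-1)^(i[λ]) λ` of `Λ`. -/
def invPow (i : ZMod 2) : Grass →ₐ[ℂ] Grass := if i = 0 then AlgHom.id ℂ Grass else grassInv

@[simp] lemma invPow_zero (a : Grass) : invPow 0 a = a := by simp [invPow]

@[simp] lemma invPow_one (a : Grass) : invPow 1 a = grassInv a := by simp [invPow]

lemma invPow_add (i j : ZMod 2) (a : Grass) : invPow (i + j) a = invPow i (invPow j a) := by
  rcases zmod_two_cases i with rfl | rfl <;> rcases zmod_two_cases j with rfl | rfl <;>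
    simp [show (1 + 1 : ZMod 2) = 0 from rfl]

lemma invPow_of_mem (i : ZMod 2) {j : ZMod 2} {a : Grass} (ha : a ∈ grassParity j) :
    invPow i a = superSign i j • a := by
  rcases zmod_two_cases i with rfl | rfl
  · simp
  · simp [grassInv_of_mem ha]

/-- Only finitely many generators occur in `a`, so contraction with a later coordinate functional
kills it. Infinite-dimensionality of the generating space enters the proof from here. -/
lemma eventually_contractRight_eq_zero (a : Grass) :
    ∃ n : ℕ, ∀ m, n ≤ m → CliffordAlgebra.contractRight a (Finsupp.lapply m) = 0 := by
  induction a using CliffordAlgebra.right_induction with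
  | algebraMap r => exact ⟨0, fun m _ => CliffordAlgebra.contractRight_algebraMap _ _ _⟩
  | add x y hx hy =>
    obtain ⟨n, hn⟩ := hx
    obtain ⟨k, hk⟩ := hy
    exact ⟨max n k, fun m hm => by
      simp [hn m (le_trans (le_max_left _ _) hm), hk m (le_trans (le_max_right _ _) hm)]⟩
  | mul_ι v x hx =>
    obtain ⟨n, hn⟩ := hx
    refine ⟨max n (v.support.sup id + 1), fun m hm => ?_⟩
    rw [CliffordAlgebra.contractRight_mul_ι, hn m (le_trans (le_max_left _ _) hm)]
    have : v m = 0 := by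
      by_contra h
      have := Finset.le_sup (f := id) (Finsupp.mem_support_iff.2 h)
      simp only [id] at this
      have := le_trans (le_max_right _ _) hm
      omega
    simp [this]

/-- Take for `ξ` a generator that does not occur in `a`: contracting `a * ξ` with its coordinate
functional returns `a`. -/
lemma exists_odd_regular (a : Grass) : ∃ ξ ∈ grassParity 1, a * ξ = 0 → a = 0 := by
  obtain ⟨n, hn⟩ := eventually_contractRight_eq_zero a
  refine ⟨ExteriorAlgebra.ι ℂ (Finsupp.single n 1), ι_mem_grassParity _, fun h => ?_⟩
  have h1 := CliffordAlgebra.contractRight_mul_ι (Q := (0 : QuadraticForm ℂ (ℕ →₀ ℂ)))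
    (Finsupp.lapply n) (Finsupp.single n 1) a
  rw [hn n le_rfl] at h1
  change CliffordAlgebra.contractRight (a * ExteriorAlgebra.ι ℂ (Finsupp.single n 1)) _ = _ at h1
  rw [h] at h1
  simpa using h1.symm

/-- The element `s` is a sum of `n` products of two fresh odd elements; each product squares to
zero, and `s ^ n` is `n!` times the product of all of them. Thus `s` is a nilpotent parameter whose
`n`-th power can still be cancelled against the given `a`. -/
lemma exists_even_nilpotent_regular (n : ℕ) (a : Grass) :
    ∃ s ∈ grassParity 0, s ^ (n + 1) = 0 ∧ (a * s ^ n = 0 → a = 0) := by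
  induction n with
  | zero => exact ⟨0, Submodule.zero_mem _, by simp, by simp⟩
  | succ n ih =>
    obtain ⟨s, hs, hs0, hsa⟩ := ih
    obtain ⟨ξ, hξ, hξa⟩ := exists_odd_regular (a * s ^ n)
    obtain ⟨η, hη, hηa⟩ := exists_odd_regular (a * s ^ n * ξ)
    have hθ : ξ * η ∈ grassParity 0 := by
      simpa [show (1 + 1 : ZMod 2) = 0 from rfl] using grassParity_mul hξ hη
    have hθ2 : (ξ * η) ^ 2 = 0 := by
      have : ξ * η * (ξ * η) = ξ * (ξ * η) * η := by
        rw [mul_assoc ξ η, ← even_mul_comm hθ η]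
        simp only [mul_assoc]
      rw [sq, this, ← mul_assoc, odd_mul_self hξ]
      simp
    set θ := ξ * η
    have hc : Commute s θ := even_mul_comm hs θ
    -- Binomial formula for commuting `s`, `θ` with `θ ^ 2 = 0`: only the terms of degree at most
    -- one in `θ` survive.
    have key : ∀ k, (s + θ) ^ (k + 1) = s ^ (k + 1) + ((k + 1 : ℕ) : ℂ) • (s ^ k * θ) := by
      intro k
      induction k with
      | zero => simp
      | succ k ih =>
        have e1 : s ^ k * θ * s = s ^ (k + 1) * θ := by
          rw [mul_assoc, ← hc.eq, ← mul_assoc, pow_succ]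
        have e2 : s ^ k * θ * θ = 0 := by rw [mul_assoc, ← sq, hθ2, mul_zero]
        rw [pow_succ (s + θ), ih, mul_add, add_mul, add_mul, smul_mul_assoc, smul_mul_assoc,
          e1, e2, ← pow_succ]
        push_cast
        module
    refine ⟨s + θ, Submodule.add_mem _ hs hθ, ?_, fun h => hsa (hξa (hηa ?_))⟩
    · rw [key, hs0, zero_mul, smul_zero, add_zero, pow_succ, hs0, zero_mul]
    · rw [key, hs0, zero_add, mul_smul_comm, smul_eq_zero] at h
      rcases h with h | h
      · exact absurd h (by exact_mod_cast Nat.succ_ne_zero n)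
      · simpa only [θ, mul_assoc] using h

end Grassmann

end OrthoSymp

end

open scoped TensorProduct MulOpposite

noncomputable section

set_option linter.unusedSectionVars false
set_option linter.unusedVariables false

namespace OrthoSymp

/-! ### The bimodule V and the parity of endomorphisms. -/

section SuperModules

variable {E : Type*} [AddCommGroup E] [Module ℂ E] (𝒱 : ZMod 2 → Submodule ℂ E)

lemma pure_smul_left (c : ℂ) (e : E) (b : Grass) :
    pureTensor 𝒱 (c • e) b = c • pureTensor 𝒱 e b := by
  rw [pureTensor, pureTensor, ← TensorProduct.smul_tmul', map_smul]

lemma pure_smul_right (c : ℂ) (e : E) (b : Grass) :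
    pureTensor 𝒱 e (c • b) = c • pureTensor 𝒱 e b := by
  simp only [pureTensor, TensorProduct.tmul_smul, map_smul]

lemma op_smul_pure (a b : Grass) (e : E) :
    MulOpposite.op a • pureTensor 𝒱 e b = pureTensor 𝒱 e (b * a) :=
  rightMul_pure 𝒱 a b e

instance : IsScalarTower ℂ Grassᵐᵒᵖ (SuperMod 𝒱) where
  smul_assoc c a v := by
    rw [← MulOpposite.op_unop a, ← MulOpposite.op_smul, op_smul_eq, op_smul_eq]
    refine LinearMap.congr_fun (superMod_hom_ext 𝒱 (f := rightMul 𝒱 (c • a.unop))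
      (g := c • rightMul 𝒱 a.unop) fun e b => ?_) v
    simp [rightMul_pure, pure_smul_right]

variable [DirectSum.Decomposition 𝒱]

lemma gradeProj_of_mem {i : ZMod 2} {e : E} (he : e ∈ 𝒱 i) : gradeProj 𝒱 i e = e := by
  rw [gradeProj_apply, DirectSum.decompose_of_mem_same 𝒱 he]

lemma gradeProj_of_mem_ne {i j : ZMod 2} {e : E} (he : e ∈ 𝒱 i) (h : i ≠ j) :
    gradeProj 𝒱 j e = 0 := by
  rw [gradeProj_apply, DirectSum.decompose_of_mem_ne 𝒱 he h]

lemma gradeProj_mem (i : ZMod 2) (e : E) : gradeProj 𝒱 i e ∈ 𝒱 i := SetLike.coe_mem _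

lemma smul_pure_of_mem {i : ZMod 2} {e : E} (he : e ∈ 𝒱 i) (a b : Grass) :
    a • pureTensor 𝒱 e b = pureTensor 𝒱 e (invPow i a * b) := by
  rw [smul_eq_leftMul, leftMul_pure]
  rcases zmod_two_cases i with rfl | rfl
  · simp [gradeProj_of_mem 𝒱 he, gradeProj_of_mem_ne 𝒱 he zero_ne_one, pure_zero_left]
  · simp [gradeProj_of_mem 𝒱 he, gradeProj_of_mem_ne 𝒱 he one_ne_zero, pure_zero_left]

/-- Every additive property of elements of `V` can be checked on homogeneous pure tensors. -/
lemma superMod_induction {p : SuperMod 𝒱 → Prop} (v : SuperMod 𝒱)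
    (hpure : ∀ i, ∀ e ∈ 𝒱 i, ∀ k, ∀ a ∈ grassParity k, p (pureTensor 𝒱 e a))
    (hadd : ∀ v w, p v → p w → p (v + w)) : p v := by
  have h0 : p 0 := by
    rw [← pure_zero_left 𝒱 (0 : Grass)]
    exact hpure 0 _ (Submodule.zero_mem _) 0 _ (Submodule.zero_mem _)
  have h1 : ∀ (e : E) (a : Grass), p (pureTensor 𝒱 e a) := by
    intro e a
    obtain ⟨b, hb, c, hc, rfl⟩ := exists_even_add_odd a
    rw [← gradeProj_add 𝒱 e, pure_add_left, pure_add_right, pure_add_right]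
    refine hadd _ _ (hadd _ _ ?_ ?_) (hadd _ _ ?_ ?_)
    · exact hpure _ _ (gradeProj_mem 𝒱 0 e) _ _ hb
    · exact hpure _ _ (gradeProj_mem 𝒱 0 e) _ _ hc
    · exact hpure _ _ (gradeProj_mem 𝒱 1 e) _ _ hb
    · exact hpure _ _ (gradeProj_mem 𝒱 1 e) _ _ hc
  obtain ⟨t, rfl⟩ := (ofTensor 𝒱).surjective v
  induction t using TensorProduct.induction_on with
  | zero => simpa using h0
  | tmul e a => exact h1 e a
  | add x y hx hy => rw [map_add]; exact hadd _ _ hx hy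

instance : IsScalarTower ℂ Grass (SuperMod 𝒱) where
  smul_assoc c a v := by
    induction v using superMod_induction with
    | hpure i e he k b hb =>
      simp [smul_pure_of_mem 𝒱 he, pure_smul_right]
    | hadd v w hv hw => simp only [smul_add, hv, hw]

instance : SMulCommClass Grass ℂ (SuperMod 𝒱) where
  smul_comm a c v := map_smul (leftMul 𝒱 a) c v

instance : SMulCommClass Grass Grassᵐᵒᵖ (SuperMod 𝒱) := SMulCommClass.symm _ _ _

/-- The parity involution of `V_ℂ`. -/
def gradeInv : E →ₗ[ℂ] E := gradeProj 𝒱 0 - gradeProj 𝒱 1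

lemma gradeInv_of_mem {i : ZMod 2} {e : E} (he : e ∈ 𝒱 i) :
    gradeInv 𝒱 e = paritySign i • e := by
  rcases zmod_two_cases i with rfl | rfl
  · simp [gradeInv, gradeProj_of_mem 𝒱 he, gradeProj_of_mem_ne 𝒱 he zero_ne_one]
  · simp [gradeInv, gradeProj_of_mem 𝒱 he, gradeProj_of_mem_ne 𝒱 he one_ne_zero]

/-- The parity involution `v ↦ (-1)^[v] v` of `V`. -/
def parityInv : SuperMod 𝒱 →ₗ[ℂ] SuperMod 𝒱 :=
  (ofTensor 𝒱).conj (TensorProduct.map (gradeInv 𝒱) grassInv.toLinearMap)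

lemma parityInv_pure (e : E) (a : Grass) :
    parityInv 𝒱 (pureTensor 𝒱 e a) = pureTensor 𝒱 (gradeInv 𝒱 e) (grassInv a) := by
  simp [parityInv, pureTensor, LinearEquiv.conj_apply]

lemma parityInv_pure_of_mem {i : ZMod 2} {e : E} (he : e ∈ 𝒱 i) (a : Grass) :
    parityInv 𝒱 (pureTensor 𝒱 e a) = paritySign i • pureTensor 𝒱 e (grassInv a) := by
  rw [parityInv_pure, gradeInv_of_mem 𝒱 he, pure_smul_left]

@[simp] lemma parityInv_parityInv (v : SuperMod 𝒱) : parityInv 𝒱 (parityInv 𝒱 v) = v := by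
  induction v using superMod_induction with
  | hpure i e he k b hb => simp [parityInv_pure_of_mem 𝒱 he, smul_smul]
  | hadd v w hv hw => simp only [map_add, hv, hw]

lemma parityInv_op_smul (a : Grass) (v : SuperMod 𝒱) :
    parityInv 𝒱 (MulOpposite.op a • v) = MulOpposite.op (grassInv a) • parityInv 𝒱 v := by
  induction v using superMod_induction with
  | hpure i e he k b hb =>
    rw [op_smul_pure, parityInv_pure_of_mem 𝒱 he, parityInv_pure_of_mem 𝒱 he, smul_comm,
      op_smul_pure, map_mul]
  | hadd v w hv hw => simp only [map_add, smul_add, hv, hw]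

lemma parityInv_smul (a : Grass) (v : SuperMod 𝒱) :
    parityInv 𝒱 (a • v) = grassInv a • parityInv 𝒱 v := by
  induction v using superMod_induction with
  | hpure i e he k b hb =>
    rw [smul_pure_of_mem 𝒱 he, parityInv_pure_of_mem 𝒱 he, parityInv_pure_of_mem 𝒱 he,
      smul_comm, smul_pure_of_mem 𝒱 he, map_mul]
    rcases zmod_two_cases i with rfl | rfl <;> simp
  | hadd v w hv hw => simp only [map_add, smul_add, hv, hw]

lemma even_smul {a : Grass} (ha : a ∈ grassParity 0) (v : SuperMod 𝒱) :
    a • v = MulOpposite.op a • v := by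
  induction v using superMod_induction with
  | hpure i e he k b hb =>
    rw [smul_pure_of_mem 𝒱 he, op_smul_pure, invPow_of_mem _ ha, superSign_zero_right, one_smul,
      even_mul_comm ha]
  | hadd v w hv hw => simp only [smul_add, hv, hw]

lemma odd_smul {a : Grass} (ha : a ∈ grassParity 1) (v : SuperMod 𝒱) :
    a • v = MulOpposite.op a • parityInv 𝒱 v := by
  induction v using superMod_induction with
  | hpure i e he k b hb =>
    rw [smul_pure_of_mem 𝒱 he, parityInv_pure_of_mem 𝒱 he, smul_comm, op_smul_pure,
      invPow_of_mem _ ha, superSign_one_right, smul_mul_assoc, pure_smul_right, odd_mul_comm ha]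
  | hadd v w hv hw => simp only [map_add, smul_add, hv, hw]

lemma pureTensor_mem {i k : ZMod 2} {e : E} (he : e ∈ 𝒱 i) {a : Grass}
    (ha : a ∈ grassParity k) : pureTensor 𝒱 e a ∈ modParity 𝒱 (i + k) :=
  Submodule.subset_span ⟨i, k, rfl, e, he, a, ha, rfl⟩

lemma parityInv_of_mem {i : ZMod 2} {v : SuperMod 𝒱} (hv : v ∈ modParity 𝒱 i) :
    parityInv 𝒱 v = paritySign i • v := by
  induction hv using Submodule.span_induction with
  | mem x hx =>
    obtain ⟨j, k, rfl, e, he, a, ha, rfl⟩ := hx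
    rw [parityInv_pure_of_mem 𝒱 he, grassInv_of_mem ha, pure_smul_right, smul_smul, paritySign_add]
  | zero => simp
  | add x y _ _ hx hy => rw [map_add, hx, hy, smul_add]
  | smul c x _ hx => rw [map_smul, hx, smul_comm]

lemma exists_mem_add_mem (v : SuperMod 𝒱) :
    ∃ x ∈ modParity 𝒱 0, ∃ y ∈ modParity 𝒱 1, x + y = v := by
  induction v using superMod_induction with
  | hpure i e he k b hb =>
    rcases zmod_two_cases (i + k) with h | h
    · exact ⟨_, h ▸ pureTensor_mem 𝒱 he hb, 0, Submodule.zero_mem _, add_zero _⟩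
    · exact ⟨0, Submodule.zero_mem _, _, h ▸ pureTensor_mem 𝒱 he hb, zero_add _⟩
  | hadd v w hv hw =>
    obtain ⟨x, hx, y, hy, rfl⟩ := hv
    obtain ⟨x', hx', y', hy', rfl⟩ := hw
    exact ⟨x + x', Submodule.add_mem _ hx hx', y + y', Submodule.add_mem _ hy hy', by abel⟩

lemma mem_modParity_iff {i : ZMod 2} {v : SuperMod 𝒱} :
    v ∈ modParity 𝒱 i ↔ parityInv 𝒱 v = paritySign i • v := by
  refine ⟨parityInv_of_mem 𝒱, fun h => ?_⟩
  obtain ⟨x, hx, y, hy, rfl⟩ := exists_mem_add_mem 𝒱 v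
  have h1 := parityInv_of_mem 𝒱 hx
  have h2 := parityInv_of_mem 𝒱 hy
  rw [map_add, h1, h2] at h
  rcases zmod_two_cases i with rfl | rfl
  · have : (2 : ℂ) • y = 0 := by
      simp only [paritySign_zero, one_smul, paritySign_one] at h
      linear_combination (norm := module) -h
    rw [show y = 0 by simpa using this]
    simpa using hx
  · have : (2 : ℂ) • x = 0 := by
      simp only [paritySign_zero, one_smul, paritySign_one] at h
      linear_combination (norm := module) h
    rw [show x = 0 by simpa using this]
    simpa using hy

/-- Homogeneity becomes commutation with the parity involution up to a sign, an identity that can be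
tested on all of V at once. -/
lemma hasParity_iff {i : ZMod 2} {A : EndL 𝒱} :
    HasParity 𝒱 i A ↔ ∀ v, parityInv 𝒱 (A v) = paritySign i • A (parityInv 𝒱 v) := by
  constructor
  · intro h v
    obtain ⟨x, hx, y, hy, rfl⟩ := exists_mem_add_mem 𝒱 v
    have key : ∀ j, ∀ v ∈ modParity 𝒱 j,
        parityInv 𝒱 (A v) = paritySign i • A (parityInv 𝒱 v) := fun j v hv => by
      rw [parityInv_of_mem 𝒱 hv, parityInv_of_mem 𝒱 (h j v hv), paritySign_add, mul_smul,
        LinearMap.map_smul_of_tower]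
    simp only [map_add, smul_add, key 0 x hx, key 1 y hy]
  · intro h j v hv
    rw [mem_modParity_iff, h, parityInv_of_mem 𝒱 hv, LinearMap.map_smul_of_tower, smul_smul,
      paritySign_add]

/-- Right linearity becomes left linearity up to sign: an odd left scalar is a right scalar composed
with the parity involution, and `A` passes that involution with the sign of its parity. -/
lemma HasParity.map_smul {i : ZMod 2} {A : EndL 𝒱} (hA : HasParity 𝒱 i A) (a : Grass)
    (v : SuperMod 𝒱) : A (a • v) = invPow i a • A v := by
  obtain ⟨b, hb, c, hc, rfl⟩ := exists_even_add_odd a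
  rw [add_smul, map_add, even_smul 𝒱 hb, odd_smul 𝒱 hc, LinearMap.map_smul, LinearMap.map_smul,
    map_add, add_smul, invPow_of_mem _ hb, invPow_of_mem _ hc, smul_assoc, smul_assoc,
    even_smul 𝒱 hb, odd_smul 𝒱 hc, (hasParity_iff 𝒱).1 hA, smul_comm (MulOpposite.op c), smul_smul]
  simp

/-- Left multiplication by an element of `Λ`, as an endomorphism of `V`. -/
def leftEnd : Grass →+* EndL 𝒱 where
  toFun a := a • (1 : EndL 𝒱)
  map_one' := one_smul _ _
  map_mul' a b := by
    ext v
    simp [mul_smul]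
  map_zero' := zero_smul _ _
  map_add' a b := add_smul _ _ _

@[simp] lemma leftEnd_apply (a : Grass) (v : SuperMod 𝒱) : leftEnd 𝒱 a v = a • v := rfl

lemma leftEnd_smul (c : ℂ) (a : Grass) : leftEnd 𝒱 (c • a) = c • leftEnd 𝒱 a := by
  ext v; simp

lemma smul_eq_leftEnd_mul (a : Grass) (A : EndL 𝒱) : a • A = leftEnd 𝒱 a * A := rfl

lemma endRightMul_eq (a : Grass) (A : EndL 𝒱) : endRightMul 𝒱 a A = A * leftEnd 𝒱 a := rfl

lemma HasParity.leftEnd {k : ZMod 2} {a : Grass} (ha : a ∈ grassParity k) :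
    HasParity 𝒱 k (leftEnd 𝒱 a) := by
  rw [hasParity_iff]
  intro v
  rw [leftEnd_apply, parityInv_smul, grassInv_of_mem ha, leftEnd_apply, smul_assoc]

lemma HasParity.mul {i j : ZMod 2} {A C : EndL 𝒱} (hA : HasParity 𝒱 i A)
    (hC : HasParity 𝒱 j C) : HasParity 𝒱 (i + j) (A * C) := fun k v hv => by
  rw [add_assoc]
  exact hA _ _ (hC _ _ hv)

lemma HasParity.zero (i : ZMod 2) : HasParity 𝒱 i 0 := fun _ _ _ => Submodule.zero_mem _

lemma HasParity.one : HasParity 𝒱 0 (1 : EndL 𝒱) := (evenEnd 𝒱).one_mem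

lemma HasParity.add {i : ZMod 2} {A C : EndL 𝒱} (hA : HasParity 𝒱 i A)
    (hC : HasParity 𝒱 i C) : HasParity 𝒱 i (A + C) := fun k v hv =>
  Submodule.add_mem _ (hA _ _ hv) (hC _ _ hv)

lemma HasParity.neg {i : ZMod 2} {A : EndL 𝒱} (hA : HasParity 𝒱 i A) :
    HasParity 𝒱 i (-A) := fun k v hv => Submodule.neg_mem _ (hA _ _ hv)

lemma HasParity.sub {i : ZMod 2} {A C : EndL 𝒱} (hA : HasParity 𝒱 i A)
    (hC : HasParity 𝒱 i C) : HasParity 𝒱 i (A - C) := by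
  rw [sub_eq_add_neg]; exact hA.add 𝒱 (hC.neg 𝒱)

lemma HasParity.smul {i : ZMod 2} {A : EndL 𝒱} (hA : HasParity 𝒱 i A) (c : ℂ) :
    HasParity 𝒱 i (c • A) := fun k v hv => Submodule.smul_mem _ c (hA _ _ hv)

lemma HasParity.sum {i : ZMod 2} {κ : Type*} (s : Finset κ) {A : κ → EndL 𝒱}
    (hA : ∀ k ∈ s, HasParity 𝒱 i (A k)) : HasParity 𝒱 i (∑ k ∈ s, A k) := fun k v hv => by
  rw [LinearMap.sum_apply]
  exact Submodule.sum_mem _ fun l hl => hA l hl _ _ hv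

lemma HasParity.mul_leftEnd {i : ZMod 2} {A : EndL 𝒱} (hA : HasParity 𝒱 i A) (a : Grass) :
    A * OrthoSymp.leftEnd 𝒱 a = OrthoSymp.leftEnd 𝒱 (invPow i a) * A := by
  ext v
  exact hA.map_smul 𝒱 a v

lemma leftEnd_mul_comm {a : Grass} (ha : a ∈ grassParity 0) (A : EndL 𝒱) :
    leftEnd 𝒱 a * A = A * leftEnd 𝒱 a := by
  ext v
  simp [even_smul 𝒱 ha]

lemma eq_zero_of_hasParity {A : EndL 𝒱} (h0 : HasParity 𝒱 0 A) (h1 : HasParity 𝒱 1 A) :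
    A = 0 := by
  ext v
  obtain ⟨w, rfl⟩ : ∃ w, parityInv 𝒱 w = v := ⟨_, parityInv_parityInv 𝒱 v⟩
  have e0 := (hasParity_iff 𝒱).1 h0 w
  have e1 := (hasParity_iff 𝒱).1 h1 w
  rw [e0] at e1
  have : (2 : ℂ) • A (parityInv 𝒱 w) = 0 := by
    simp only [paritySign_zero, paritySign_one] at e1
    linear_combination (norm := module) e1
  simpa using this

/-- The conjugate `J A J` of `A` by the parity involution. -/
def conjParity : EndL 𝒱 →ₗ[ℂ] EndL 𝒱 where
  toFun A :=
    { toFun := fun v => parityInv 𝒱 (A (parityInv 𝒱 v))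
      map_add' := fun v w => by simp
      map_smul' := fun a v => by
        rw [← MulOpposite.op_unop a, parityInv_op_smul, LinearMap.map_smul, parityInv_op_smul,
          grassInv_grassInv]
        rfl }
  map_add' A C := by ext v; simp
  map_smul' c A := by ext v; simp

@[simp] lemma conjParity_apply (A : EndL 𝒱) (v : SuperMod 𝒱) :
    conjParity 𝒱 A v = parityInv 𝒱 (A (parityInv 𝒱 v)) := rfl

lemma hasParity_iff_conj {i : ZMod 2} {A : EndL 𝒱} :
    HasParity 𝒱 i A ↔ conjParity 𝒱 A = paritySign i • A := by
  rw [hasParity_iff]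
  constructor
  · intro h
    ext v
    simp [h]
  · intro h v
    simpa using LinearMap.congr_fun h (parityInv 𝒱 v)

/-- The homogeneous component of parity `i` of an endomorphism. -/
def parityPart (i : ZMod 2) : EndL 𝒱 →ₗ[ℂ] EndL 𝒱 :=
  (2⁻¹ : ℂ) • (LinearMap.id + paritySign i • conjParity 𝒱)

lemma conjParity_conjParity (A : EndL 𝒱) : conjParity 𝒱 (conjParity 𝒱 A) = A := by
  ext v; simp

lemma parityPart_hasParity (i : ZMod 2) (A : EndL 𝒱) : HasParity 𝒱 i (parityPart 𝒱 i A) := by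
  rw [hasParity_iff_conj]
  simp only [parityPart, LinearMap.smul_apply, LinearMap.add_apply, LinearMap.id_apply, map_smul,
    map_add, conjParity_conjParity]
  rcases zmod_two_cases i with rfl | rfl
  · simp only [paritySign_zero]; module
  · simp only [paritySign_one]; module

lemma parityPart_add (A : EndL 𝒱) : parityPart 𝒱 0 A + parityPart 𝒱 1 A = A := by
  simp only [parityPart, LinearMap.smul_apply, LinearMap.add_apply, LinearMap.id_apply,
    paritySign_zero, paritySign_one]
  module

lemma parityPart_of_hasParity {i : ZMod 2} {A : EndL 𝒱} (hA : HasParity 𝒱 i A) (j : ZMod 2) :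
    parityPart 𝒱 j A = if i = j then A else 0 := by
  simp only [parityPart, LinearMap.smul_apply, LinearMap.add_apply, LinearMap.id_apply,
    (hasParity_iff_conj 𝒱).1 hA]
  rcases zmod_two_cases i with rfl | rfl <;> rcases zmod_two_cases j with rfl | rfl <;>
    simp <;> module

end SuperModules

end OrthoSymp

end

open scoped TensorProduct MulOpposite

noncomputable section

set_option linter.unusedSectionVars false
set_option linter.unusedVariables false

namespace OrthoSymp

/-! ### Coordinates on V and on its endomorphisms. -/

/-- A basis of `V_ℂ` consisting of homogeneous elements. -/
structure HomBasis {E : Type*} [AddCommGroup E] [Module ℂ E] (𝒱 : ZMod 2 → Submodule ℂ E)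
    (ι : Type*) where
  /-- The underlying basis. -/
  basis : Module.Basis ι ℂ E
  /-- The parities of the basis elements. -/
  par : ι → ZMod 2
  mem : ∀ i, basis i ∈ 𝒱 (par i)

section Coordinates

variable {E : Type*} [AddCommGroup E] [Module ℂ E] {𝒱 : ZMod 2 → Submodule ℂ E}
  [DirectSum.Decomposition 𝒱] {ι : Type*} [Fintype ι] [DecidableEq ι] (b : HomBasis 𝒱 ι)

/-- The extension of an endomorphism of `V_ℂ` to `V`. -/
def baseEnd (𝒱 : ZMod 2 → Submodule ℂ E) (T : E →ₗ[ℂ] E) : EndL 𝒱 where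
  toFun := (ofTensor 𝒱).conj (T.rTensor Grass)
  map_add' := map_add _
  map_smul' a v := by
    refine LinearMap.congr_fun (superMod_hom_ext 𝒱
      (f := (ofTensor 𝒱).conj (T.rTensor Grass) ∘ₗ rightMul 𝒱 a.unop)
      (g := rightMul 𝒱 a.unop ∘ₗ (ofTensor 𝒱).conj (T.rTensor Grass)) fun e c => ?_) v
    simp only [LinearMap.comp_apply, rightMul_pure]
    simp [pureTensor, LinearEquiv.conj_apply, rightMul]

lemma baseEnd_pure (T : E →ₗ[ℂ] E) (e : E) (a : Grass) :
    baseEnd 𝒱 T (pureTensor 𝒱 e a) = pureTensor 𝒱 (T e) a := by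
  change (ofTensor 𝒱).conj (T.rTensor Grass) _ = _
  simp [pureTensor, LinearEquiv.conj_apply]

lemma baseEnd_hasParity {q : ZMod 2} {T : E →ₗ[ℂ] E} (hT : ∀ j, ∀ e ∈ 𝒱 j, T e ∈ 𝒱 (q + j)) :
    HasParity 𝒱 q (baseEnd 𝒱 T) := by
  intro j v hv
  induction hv using Submodule.span_induction with
  | mem x hx =>
    obtain ⟨j, k, rfl, e, he, a, ha, rfl⟩ := hx
    rw [baseEnd_pure, ← add_assoc]
    exact pureTensor_mem 𝒱 (hT _ _ he) ha
  | zero => simp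
  | add x y _ _ hx hy => rw [map_add]; exact Submodule.add_mem _ hx hy
  | smul c x _ hx => rw [LinearMap.map_smul_of_tower]; exact Submodule.smul_mem _ _ hx

/-- The coordinates of an element of `V` with respect to a basis of `V_ℂ`. -/
def HomBasis.vcoord (i : ι) : SuperMod 𝒱 →ₗ[ℂ] Grass :=
  (TensorProduct.lid ℂ Grass).toLinearMap ∘ₗ (b.basis.coord i).rTensor Grass ∘ₗ
    (ofTensor 𝒱).symm.toLinearMap

lemma HomBasis.vcoord_pure (i : ι) (e : E) (a : Grass) :
    b.vcoord i (pureTensor 𝒱 e a) = b.basis.repr e i • a := by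
  simp [vcoord, pureTensor]

lemma HomBasis.repr_eq_zero {j : ZMod 2} {e : E} (he : e ∈ 𝒱 j) {i : ι} (hi : b.par i ≠ j) :
    b.basis.repr e i = 0 := by
  have h1 : gradeProj 𝒱 (b.par i) e = 0 := gradeProj_of_mem_ne 𝒱 he (Ne.symm hi)
  have h2 : ∑ l, b.basis.repr e l • gradeProj 𝒱 (b.par i) (b.basis l) = 0 := by
    rw [← h1]
    conv_rhs => rw [← b.basis.sum_repr e, map_sum]
    simp only [map_smul]
  have h3 : ∑ l, (if b.par l = b.par i then b.basis.repr e l else 0) • b.basis l = 0 := by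
    rw [← h2]
    refine Finset.sum_congr rfl fun l _ => ?_
    split_ifs with h
    · rw [← h, gradeProj_of_mem 𝒱 (b.mem l)]
    · rw [gradeProj_of_mem_ne 𝒱 (b.mem l) h, zero_smul, smul_zero]
  simpa using Fintype.linearIndependent_iff.1 b.basis.linearIndependent _ h3 i

lemma HomBasis.sum_vcoord (v : SuperMod 𝒱) :
    ∑ i, pureTensor 𝒱 (b.basis i) (b.vcoord i v) = v := by
  induction v using superMod_induction with
  | hpure j e he k a ha =>
    simp only [vcoord_pure, pure_smul_right, ← pure_smul_left]
    conv_rhs => rw [← b.basis.sum_repr e]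
    simp only [pureTensor, TensorProduct.sum_tmul, map_sum]
  | hadd v w hv hw =>
    simp only [map_add, pure_add_right, Finset.sum_add_distrib, hv, hw]

lemma HomBasis.vcoord_op_smul (i : ι) (a : Grass) (v : SuperMod 𝒱) :
    b.vcoord i (MulOpposite.op a • v) = b.vcoord i v * a := by
  induction v using superMod_induction with
  | hpure j e he k c hc => simp [op_smul_pure, vcoord_pure]
  | hadd v w hv hw => simp only [map_add, smul_add, hv, hw, add_mul]

lemma HomBasis.vcoord_smul (i : ι) (a : Grass) (v : SuperMod 𝒱) :
    b.vcoord i (a • v) = invPow (b.par i) a * b.vcoord i v := by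
  induction v using superMod_induction with
  | hpure j e he k c hc =>
    rw [smul_pure_of_mem 𝒱 he, vcoord_pure, vcoord_pure]
    by_cases h : b.par i = j
    · rw [h, mul_smul_comm]
    · simp [b.repr_eq_zero he h]
  | hadd v w hv hw => simp only [map_add, smul_add, hv, hw, mul_add]

lemma HomBasis.vcoord_mem (i : ι) {j : ZMod 2} {v : SuperMod 𝒱} (hv : v ∈ modParity 𝒱 j) :
    b.vcoord i v ∈ grassParity (b.par i + j) := by
  induction hv using Submodule.span_induction with
  | mem x hx =>
    obtain ⟨j, k, rfl, e, he, a, ha, rfl⟩ := hx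
    rw [vcoord_pure]
    by_cases h : b.par i = j
    · subst h
      rw [← add_assoc, CharTwo.add_self_eq_zero, zero_add]
      exact Submodule.smul_mem _ _ ha
    · simp [b.repr_eq_zero he h]
  | zero => simp
  | add x y _ _ hx hy => rw [map_add]; exact Submodule.add_mem _ hx hy
  | smul c x _ hx => rw [map_smul]; exact Submodule.smul_mem _ _ hx

/-- The element `b_i ⊗ 1` of `V`. -/
def HomBasis.vec (i : ι) : SuperMod 𝒱 := pureTensor 𝒱 (b.basis i) 1

lemma HomBasis.vec_mem (i : ι) : b.vec i ∈ modParity 𝒱 (b.par i) := by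
  simpa [vec] using pureTensor_mem 𝒱 (b.mem i) one_mem_grassParity

lemma HomBasis.vcoord_vec (i j : ι) : b.vcoord i (b.vec j) = if i = j then 1 else 0 := by
  rw [vec, vcoord_pure, Module.Basis.repr_self, Finsupp.single_apply]
  simp [eq_comm]

lemma HomBasis.smul_vec (a : Grass) (i : ι) :
    a • b.vec i = MulOpposite.op (invPow (b.par i) a) • b.vec i := by
  rw [vec, smul_pure_of_mem 𝒱 (b.mem i), op_smul_pure, mul_one, one_mul]

lemma HomBasis.sum_vec (v : SuperMod 𝒱) :
    ∑ i, MulOpposite.op (b.vcoord i v) • b.vec i = v := by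
  conv_rhs => rw [← b.sum_vcoord v]
  simp [vec, op_smul_pure]

lemma HomBasis.end_ext {A C : EndL 𝒱} (h : ∀ i, A (b.vec i) = C (b.vec i)) : A = C := by
  ext v
  rw [← b.sum_vec v]
  simp [h]

/-- The elementary endomorphisms `b_j ↦ b_i`. -/
def HomBasis.elem (x : ι × ι) : EndL 𝒱 :=
  baseEnd 𝒱 ((b.basis.coord x.2).smulRight (b.basis x.1))

/-- The parity of an elementary endomorphism. -/
def HomBasis.epar (x : ι × ι) : ZMod 2 := b.par x.1 + b.par x.2

lemma HomBasis.elem_vec (x : ι × ι) (l : ι) :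
    b.elem x (b.vec l) = if x.2 = l then b.vec x.1 else 0 := by
  rw [elem, vec, baseEnd_pure]
  by_cases h : l = x.2
  · simp [h, vec]
  · simp [Ne.symm h, pure_zero_left]

lemma HomBasis.elem_base_mem (x : ι × ι) (j : ZMod 2) (e : E) (he : e ∈ 𝒱 j) :
    (b.basis.coord x.2).smulRight (b.basis x.1) e ∈ 𝒱 (b.epar x + j) := by
  rw [LinearMap.smulRight_apply, Module.Basis.coord_apply]
  by_cases h : b.par x.2 = j
  · rw [epar, h, add_assoc, CharTwo.add_self_eq_zero, add_zero]
    exact Submodule.smul_mem _ _ (b.mem _)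
  · simp [b.repr_eq_zero he h]

lemma HomBasis.elem_hasParity (x : ι × ι) : HasParity 𝒱 (b.epar x) (b.elem x) :=
  baseEnd_hasParity (b.elem_base_mem x)

/-- The coordinates of an endomorphism with respect to the elementary endomorphisms. -/
def HomBasis.ecoord (x : ι × ι) : EndL 𝒱 →ₗ[ℂ] Grass where
  toFun A := invPow (b.par x.2) (b.vcoord x.1 (A (b.vec x.2)))
  map_add' A C := by simp
  map_smul' c A := by simp

lemma HomBasis.ecoord_apply (x : ι × ι) (A : EndL 𝒱) :
    b.ecoord x A = invPow (b.par x.2) (b.vcoord x.1 (A (b.vec x.2))) := rfl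

lemma invPow_invPow (i : ZMod 2) (a : Grass) : invPow i (invPow i a) = a := by
  rw [← invPow_add, CharTwo.add_self_eq_zero, invPow_zero]

/-- The twist in `ecoord` is what makes this work: in `b.elem x * leftEnd 𝒱 a` the scalar first acts
on `b_j` from the left, and turning it into a right scalar applies the power of `grassInv` given by
the parity of `b_j`. -/
lemma HomBasis.sum_elem (A : EndL 𝒱) : ∑ x, b.elem x * leftEnd 𝒱 (b.ecoord x A) = A := by
  refine b.end_ext fun k => ?_
  rw [LinearMap.sum_apply, Fintype.sum_prod_type]
  conv_rhs => rw [← b.sum_vec (A (b.vec k))]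
  refine Finset.sum_congr rfl fun i _ => ?_
  rw [Finset.sum_eq_single k]
  · rw [Module.End.mul_apply, leftEnd_apply, smul_vec, LinearMap.map_smul, elem_vec, if_pos rfl,
      ecoord_apply, invPow_invPow]
  · intro j _ hj
    rw [Module.End.mul_apply, leftEnd_apply, smul_vec, LinearMap.map_smul, elem_vec, if_neg hj,
      smul_zero]
  · simp

lemma HomBasis.ecoord_mul_leftEnd (x : ι × ι) (A : EndL 𝒱) (a : Grass) :
    b.ecoord x (A * leftEnd 𝒱 a) = b.ecoord x A * a := by
  rw [ecoord_apply, Module.End.mul_apply, leftEnd_apply, smul_vec, LinearMap.map_smul,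
    vcoord_op_smul, map_mul, invPow_invPow, ecoord_apply]

lemma HomBasis.ecoord_leftEnd_mul (x : ι × ι) (A : EndL 𝒱) (a : Grass) :
    b.ecoord x (leftEnd 𝒱 a * A) = invPow (b.epar x) a * b.ecoord x A := by
  rw [ecoord_apply, Module.End.mul_apply, leftEnd_apply, vcoord_smul, map_mul, ← invPow_add,
    ecoord_apply, epar, add_comm (b.par x.1)]

lemma HomBasis.ecoord_elem (x y : ι × ι) : b.ecoord x (b.elem y) = if x = y then 1 else 0 := by
  rw [ecoord_apply, elem_vec]
  by_cases h : y.2 = x.2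
  · rw [if_pos h, vcoord_vec]
    by_cases h' : x.1 = y.1
    · simp [h', Prod.ext_iff, h]
    · simp [h', Prod.ext_iff]
  · simp [h, Prod.ext_iff, Ne.symm h]

lemma HomBasis.ecoord_mem (x : ι × ι) {q : ZMod 2} {A : EndL 𝒱} (hA : HasParity 𝒱 q A) :
    b.ecoord x A ∈ grassParity (b.epar x + q) := by
  have h := b.vcoord_mem x.1 (hA _ _ (b.vec_mem x.2))
  rw [ecoord_apply, invPow_of_mem _ h]
  have e : b.par x.1 + (q + b.par x.2) = b.epar x + q := by rw [epar]; ring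
  rw [← e]
  exact Submodule.smul_mem _ _ h

end Coordinates

/-! ### The bilinear form on V. -/

section Form

variable {E : Type*} [AddCommGroup E] [Module ℂ E] {𝒱 : ZMod 2 → Submodule ℂ E}
  [DirectSum.Decomposition 𝒱] {B : LinearMap.BilinForm ℂ E}

lemma form_pure (B : LinearMap.BilinForm ℂ E) {j : ZMod 2} {f : E} (hf : f ∈ 𝒱 j) (e : E)
    (a c : Grass) :
    superForm 𝒱 B (pureTensor 𝒱 e a) (pureTensor 𝒱 f c) = B e f • (invPow j a * c) := by
  rw [superForm_pure]
  rcases zmod_two_cases j with rfl | rfl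
  · simp [gradeProj_of_mem 𝒱 hf, gradeProj_of_mem_ne 𝒱 hf zero_ne_one]
  · simp [gradeProj_of_mem 𝒱 hf, gradeProj_of_mem_ne 𝒱 hf one_ne_zero]

lemma form_op_smul_left (a : Grass) (v w : SuperMod 𝒱) :
    superForm 𝒱 B (MulOpposite.op a • v) w = superForm 𝒱 B v (a • w) := by
  induction v using superMod_induction with
  | hadd v v' hv hv' => simp only [smul_add, map_add, LinearMap.add_apply, hv, hv']
  | hpure i e he k c hc =>
    induction w using superMod_induction with
    | hadd w w' hw hw' => simp only [smul_add, map_add, hw, hw']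
    | hpure j f hf l d hd =>
      rw [op_smul_pure, smul_pure_of_mem 𝒱 hf, form_pure B hf, form_pure B hf, map_mul, mul_assoc]

lemma form_op_smul_right (a : Grass) (v w : SuperMod 𝒱) :
    superForm 𝒱 B v (MulOpposite.op a • w) = superForm 𝒱 B v w * a := by
  induction v using superMod_induction with
  | hadd v v' hv hv' => simp only [map_add, LinearMap.add_apply, hv, hv', add_mul]
  | hpure i e he k c hc =>
    induction w using superMod_induction with
    | hadd w w' hw hw' => simp only [smul_add, map_add, hw, hw', add_mul]
    | hpure j f hf l d hd =>
      rw [op_smul_pure, form_pure B hf, form_pure B hf, smul_mul_assoc, mul_assoc]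

lemma form_smul_left {k j : ZMod 2} {a : Grass} (ha : a ∈ grassParity k) {v : SuperMod 𝒱}
    (hv : v ∈ modParity 𝒱 j) (w : SuperMod 𝒱) :
    superForm 𝒱 B (a • v) w = superSign k j • superForm 𝒱 B v (a • w) := by
  rcases zmod_two_cases k with rfl | rfl
  · rw [even_smul 𝒱 ha, form_op_smul_left, superSign_zero_left, one_smul]
  · rw [odd_smul 𝒱 ha, parityInv_of_mem 𝒱 hv, smul_comm, map_smul, LinearMap.smul_apply,
      form_op_smul_left, superSign_one_left]

lemma exists_homBasis (𝒱 : ZMod 2 → Submodule ℂ E) [DirectSum.Decomposition 𝒱]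
    [FiniteDimensional ℂ E] : ∃ n : ℕ, Nonempty (HomBasis 𝒱 (Fin n)) := by
  classical
  let v : ∀ i : ZMod 2, Module.Basis (Fin (Module.finrank ℂ (𝒱 i))) ℂ (𝒱 i) :=
    fun i => Module.finBasis ℂ (𝒱 i)
  let b := (DirectSum.Decomposition.isInternal 𝒱).collectedBasis v
  let e := Fintype.equivFin (Σ i : ZMod 2, Fin (Module.finrank ℂ (𝒱 i)))
  exact ⟨_, ⟨b.reindex e, fun i => (e.symm i).1, fun i => by
    rw [Module.Basis.reindex_apply]
    exact (DirectSum.Decomposition.isInternal 𝒱).collectedBasis_mem v _⟩⟩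

variable (hB : IsOrthosymplectic 𝒱 B)
include hB

lemma form_symm {i j : ZMod 2} {v w : SuperMod 𝒱} (hv : v ∈ modParity 𝒱 i)
    (hw : w ∈ modParity 𝒱 j) : superForm 𝒱 B v w = superSign i j • superForm 𝒱 B w v := by
  induction hv using Submodule.span_induction with
  | zero => simp
  | add x y _ _ hx hy => rw [map_add, map_add, LinearMap.add_apply, hx, hy, smul_add]
  | smul c x _ hx =>
    rw [map_smul, LinearMap.smul_apply, hx, map_smul, smul_comm]
  | mem x hx =>
    obtain ⟨i, k, rfl, e, he, a, ha, rfl⟩ := hx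
    induction hw using Submodule.span_induction with
    | zero => simp
    | add x y _ _ hx hy => rw [map_add, map_add, LinearMap.add_apply, hx, hy, smul_add]
    | smul c x _ hx => rw [map_smul, hx, map_smul, LinearMap.smul_apply, smul_comm]
    | mem x hx =>
      obtain ⟨j, l, rfl, f, hf, c, hc, rfl⟩ := hx
      rw [form_pure B hf, form_pure B he, invPow_of_mem _ ha, invPow_of_mem _ hc,
        smul_mul_assoc, smul_mul_assoc, mul_comm_of_mem ha hc, smul_smul, smul_smul, smul_smul,
        smul_smul]
      by_cases h : i = j
      · subst h
        rw [hB.supersymmetric i i e he f hf]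
        congr 1
        rcases zmod_two_cases i with rfl | rfl <;> rcases zmod_two_cases k with rfl | rfl <;>
          rcases zmod_two_cases l with rfl | rfl <;> simp [CharTwo.add_self_eq_zero]
      · rw [hB.even i j h e he f hf, hB.even j i (Ne.symm h) f hf e he]
        simp

variable [FiniteDimensional ℂ E]

lemma form_nondegenerate {w : SuperMod 𝒱} (h : ∀ v, superForm 𝒱 B v w = 0) : w = 0 := by
  obtain ⟨n, ⟨b⟩⟩ := exists_homBasis 𝒱
  rw [← b.sum_vcoord w]
  refine Finset.sum_eq_zero fun i _ => ?_
  -- Pairing with the dual basis vector reads off the `i`-th coordinate of `w`.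
  have h1 := h (pureTensor 𝒱 (B.dualBasis hB.nondegenerate b.basis i) 1)
  rw [← b.sum_vcoord w, map_sum, Finset.sum_eq_single i] at h1
  · rw [form_pure B (b.mem i), LinearMap.BilinForm.apply_dualBasis_left, if_pos rfl, one_smul,
      map_one, one_mul] at h1
    rw [h1, pure_zero_right]
  · intro j _ hj
    rw [form_pure B (b.mem j), LinearMap.BilinForm.apply_dualBasis_left, if_neg hj, zero_smul]
  · simp

end Form

end OrthoSymp

end

open scoped TensorProduct MulOpposite

noncomputable section

set_option linter.unusedSectionVars false
set_option linter.unusedVariables false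

namespace OrthoSymp

/-! ### The superadjoint. -/

section Adjoint

variable {E : Type*} [AddCommGroup E] [Module ℂ E] {𝒱 : ZMod 2 → Submodule ℂ E}
  [DirectSum.Decomposition 𝒱] {B : LinearMap.BilinForm ℂ E}

lemma IsHomAdjoint.add {i : ZMod 2} {A A' C C' : EndL 𝒱} (hA : IsHomAdjoint 𝒱 B i A A')
    (hC : IsHomAdjoint 𝒱 B i C C') : IsHomAdjoint 𝒱 B i (A + C) (A' + C') :=
  ⟨hA.1.add 𝒱 hC.1, hA.2.1.add 𝒱 hC.2.1, fun j v hv w => by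
    simp only [LinearMap.add_apply, map_add, hA.2.2 j v hv, hC.2.2 j v hv, smul_add]⟩

lemma IsHomAdjoint.smul {i : ZMod 2} {A A' : EndL 𝒱} (hA : IsHomAdjoint 𝒱 B i A A') (c : ℂ) :
    IsHomAdjoint 𝒱 B i (c • A) (c • A') :=
  ⟨hA.1.smul 𝒱 c, hA.2.1.smul 𝒱 c, fun j v hv w => by
    simp only [LinearMap.smul_apply, map_smul, hA.2.2 j v hv, smul_comm c]⟩

lemma IsHomAdjoint.neg {i : ZMod 2} {A A' : EndL 𝒱} (hA : IsHomAdjoint 𝒱 B i A A') :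
    IsHomAdjoint 𝒱 B i (-A) (-A') := by
  simpa using hA.smul (-1)

lemma IsHomAdjoint.sub {i : ZMod 2} {A A' C C' : EndL 𝒱} (hA : IsHomAdjoint 𝒱 B i A A')
    (hC : IsHomAdjoint 𝒱 B i C C') : IsHomAdjoint 𝒱 B i (A - C) (A' - C') := by
  simpa only [sub_eq_add_neg] using hA.add hC.neg

lemma IsHomAdjoint.zero (i : ZMod 2) : IsHomAdjoint 𝒱 B i (0 : EndL 𝒱) 0 :=
  ⟨HasParity.zero 𝒱 i, HasParity.zero 𝒱 i, fun j v hv w => by simp⟩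

lemma IsHomAdjoint.one : IsHomAdjoint 𝒱 B 0 (1 : EndL 𝒱) 1 :=
  ⟨HasParity.one 𝒱, HasParity.one 𝒱, fun j v hv w => by simp⟩

lemma IsHomAdjoint.mul {i k : ZMod 2} {A A' C C' : EndL 𝒱} (hA : IsHomAdjoint 𝒱 B i A A')
    (hC : IsHomAdjoint 𝒱 B k C C') :
    IsHomAdjoint 𝒱 B (i + k) (A * C) (superSign i k • (C' * A')) := by
  refine ⟨hA.1.mul 𝒱 hC.1, ?_, fun j v hv w => ?_⟩
  · rw [add_comm]
    exact (hC.2.1.mul 𝒱 hA.2.1).smul 𝒱 _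
  · rw [Module.End.mul_apply, hA.2.2 _ _ (hC.1 j v hv), hC.2.2 j v hv, LinearMap.smul_apply,
      map_smul, Module.End.mul_apply, smul_smul, smul_smul, superSign_add_right,
      superSign_add_left]
    congr 1
    ring

lemma IsHomAdjoint.mul_even {A A' C C' : EndL 𝒱} (hA : IsHomAdjoint 𝒱 B 0 A A')
    (hC : IsHomAdjoint 𝒱 B 0 C C') : IsHomAdjoint 𝒱 B 0 (A * C) (C' * A') := by
  simpa using hA.mul hC

lemma IsHomAdjoint.leftEnd {k : ZMod 2} {a : Grass} (ha : a ∈ grassParity k) :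
    IsHomAdjoint 𝒱 B k (leftEnd 𝒱 a) (leftEnd 𝒱 a) :=
  ⟨HasParity.leftEnd 𝒱 ha, HasParity.leftEnd 𝒱 ha, fun j v hv w => form_smul_left ha hv w⟩

lemma HasParity.mul_leftEnd_of_mem {i k : ZMod 2} {A : EndL 𝒱} (hA : HasParity 𝒱 i A)
    {a : Grass} (ha : a ∈ grassParity k) :
    A * OrthoSymp.leftEnd 𝒱 a = superSign i k • (OrthoSymp.leftEnd 𝒱 a * A) := by
  rw [hA.mul_leftEnd 𝒱, invPow_of_mem _ ha, leftEnd_smul, smul_mul_assoc]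

/-- The sign in the antimultiplicativity of the adjoint is exactly the sign for moving `a` past
`A'`, so the adjoint is right linear without any sign. -/
lemma IsHomAdjoint.mul_leftEnd {i k : ZMod 2} {A A' : EndL 𝒱} (hA : IsHomAdjoint 𝒱 B i A A')
    {a : Grass} (ha : a ∈ grassParity k) :
    IsHomAdjoint 𝒱 B (i + k) (A * OrthoSymp.leftEnd 𝒱 a) (A' * OrthoSymp.leftEnd 𝒱 a) := by
  rw [hA.2.1.mul_leftEnd_of_mem ha]
  exact hA.mul (IsHomAdjoint.leftEnd ha)

lemma IsSuperadjoint.of_hom {i : ZMod 2} {A A' : EndL 𝒱} (hA : IsHomAdjoint 𝒱 B i A A') :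
    IsSuperadjoint 𝒱 B A A' := by
  rcases zmod_two_cases i with rfl | rfl
  · exact ⟨A, 0, A', 0, by simp, by simp, hA, IsHomAdjoint.zero 1⟩
  · exact ⟨0, A, 0, A', by simp, by simp, IsHomAdjoint.zero 0, hA⟩

lemma IsSuperadjoint.add {A A' C C' : EndL 𝒱} (hA : IsSuperadjoint 𝒱 B A A')
    (hC : IsSuperadjoint 𝒱 B C C') : IsSuperadjoint 𝒱 B (A + C) (A' + C') := by
  obtain ⟨A0, A1, A0', A1', rfl, rfl, h0, h1⟩ := hA
  obtain ⟨C0, C1, C0', C1', rfl, rfl, k0, k1⟩ := hC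
  exact ⟨A0 + C0, A1 + C1, A0' + C0', A1' + C1', by abel, by abel, h0.add k0, h1.add k1⟩

lemma IsSuperadjoint.sum {κ : Type*} (s : Finset κ) {A A' : κ → EndL 𝒱}
    (h : ∀ k ∈ s, IsSuperadjoint 𝒱 B (A k) (A' k)) :
    IsSuperadjoint 𝒱 B (∑ k ∈ s, A k) (∑ k ∈ s, A' k) := by
  classical
  induction s using Finset.induction_on with
  | empty => simpa using IsSuperadjoint.of_hom (IsHomAdjoint.zero 0)
  | insert k s hk ih =>
    rw [Finset.sum_insert hk, Finset.sum_insert hk]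
    exact (h k (Finset.mem_insert_self _ _)).add
      (ih fun l hl => h l (Finset.mem_insert_of_mem hl))

lemma IsHomAdjoint.even_form {A A' : EndL 𝒱} (hA : IsHomAdjoint 𝒱 B 0 A A')
    (v w : SuperMod 𝒱) : superForm 𝒱 B (A v) w = superForm 𝒱 B v (A' w) := by
  obtain ⟨x, hx, y, hy, rfl⟩ := exists_mem_add_mem 𝒱 v
  simp only [map_add, LinearMap.add_apply]
  rw [hA.2.2 _ _ hx, hA.2.2 _ _ hy, superSign_zero_left, superSign_zero_left, one_smul, one_smul]

lemma isHomAdjoint_even_iff {A A' : EndL 𝒱} (hA : HasParity 𝒱 0 A) (hA' : HasParity 𝒱 0 A') :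
    IsHomAdjoint 𝒱 B 0 A A' ↔ ∀ v w, superForm 𝒱 B (A v) w = superForm 𝒱 B v (A' w) :=
  ⟨fun h => h.even_form, fun h => ⟨hA, hA', fun j v _ w => by simp [h]⟩⟩

variable (hB : IsOrthosymplectic 𝒱 B)
include hB

lemma IsHomAdjoint.symm {i : ZMod 2} {A A' : EndL 𝒱} (hA : IsHomAdjoint 𝒱 B i A A') :
    IsHomAdjoint 𝒱 B i A' A := by
  refine ⟨hA.2.1, hA.1, fun j v hv w => ?_⟩
  have key : ∀ k, ∀ w ∈ modParity 𝒱 k,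
      superForm 𝒱 B (A' v) w = superSign i j • superForm 𝒱 B v (A w) := fun k w hw => by
    rw [form_symm hB (hA.2.1 j v hv) hw, form_symm hB hv (hA.1 k w hw), hA.2.2 k w hw, smul_smul,
      smul_smul]
    congr 1
    rcases zmod_two_cases i with rfl | rfl <;> rcases zmod_two_cases j with rfl | rfl <;>
      rcases zmod_two_cases k with rfl | rfl <;> simp [CharTwo.add_self_eq_zero]
  obtain ⟨x, hx, y, hy, rfl⟩ := exists_mem_add_mem 𝒱 w
  simp only [map_add, key _ x hx, key _ y hy, smul_add]

variable [FiniteDimensional ℂ E]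

lemma IsHomAdjoint.unique {i : ZMod 2} {A A' A'' : EndL 𝒱} (h : IsHomAdjoint 𝒱 B i A A')
    (h' : IsHomAdjoint 𝒱 B i A A'') : A' = A'' := by
  ext w
  rw [← sub_eq_zero]
  refine form_nondegenerate hB fun v => ?_
  have key : ∀ j, ∀ v ∈ modParity 𝒱 j, superForm 𝒱 B v (A' w - A'' w) = 0 := fun j v hv => by
    have e := (h.2.2 j v hv w).symm.trans (h'.2.2 j v hv w)
    have e2 := congrArg (superSign i j • ·) e
    simp only [smul_smul, superSign_mul_self, one_smul] at e2
    rw [map_sub, e2, sub_self]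
  obtain ⟨x, hx, y, hy, rfl⟩ := exists_mem_add_mem 𝒱 v
  rw [map_add, LinearMap.add_apply, key _ x hx, key _ y hy, add_zero]

lemma IsSuperadjoint.unique {A A' A'' : EndL 𝒱} (h : IsSuperadjoint 𝒱 B A A')
    (h' : IsSuperadjoint 𝒱 B A A'') : A' = A'' := by
  obtain ⟨A0, A1, A0', A1', rfl, rfl, h0, h1⟩ := h
  obtain ⟨C0, C1, C0', C1', hAC, rfl, k0, k1⟩ := h'
  have e0 : A0 = C0 := by
    have := congrArg (parityPart 𝒱 0) hAC
    simpa [parityPart_of_hasParity 𝒱 h0.1, parityPart_of_hasParity 𝒱 h1.1,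
      parityPart_of_hasParity 𝒱 k0.1, parityPart_of_hasParity 𝒱 k1.1] using this
  subst e0
  obtain rfl : A1 = C1 := by simpa using hAC
  rw [h0.unique hB k0, h1.unique hB k1]

/-- The ordinary adjoint `S` has the parity of `T` because the form pairs only vectors of equal
parity. For odd `T` the required sign depends on the parity of `e`, and composing `S` with the
parity involution supplies it. -/
lemma exists_base_adjoint {q : ZMod 2} {T : E →ₗ[ℂ] E}
    (hT : ∀ j, ∀ e ∈ 𝒱 j, T e ∈ 𝒱 (q + j)) :
    ∃ T' : E →ₗ[ℂ] E, (∀ j, ∀ e ∈ 𝒱 j, T' e ∈ 𝒱 (q + j)) ∧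
      ∀ j, ∀ e ∈ 𝒱 j, ∀ f, B (T e) f = superSign q j * B e (T' f) := by
  have hflip : B.flip.Nondegenerate := ⟨hB.nondegenerate.2, hB.nondegenerate.1⟩
  -- The left adjoint for the flipped form is the adjoint on the right for `B`.
  obtain ⟨S, hS⟩ : ∃ S : E →ₗ[ℂ] E, ∀ e f, B (T e) f = B e (S f) :=
    ⟨LinearMap.BilinForm.leftAdjointOfNondegenerate B.flip hflip T, fun e f =>
      (LinearMap.BilinForm.isAdjointPairLeftAdjointOfNondegenerate B.flip hflip T f e).symm⟩
  have hsplit : ∀ l, ∀ e ∈ 𝒱 l, ∀ x, B e x = B e (gradeProj 𝒱 l x) := by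
    intro l e he x
    conv_lhs => rw [← gradeProj_add 𝒱 x, map_add]
    rcases zmod_two_cases l with rfl | rfl
    · rw [hB.even 0 1 zero_ne_one e he _ (gradeProj_mem 𝒱 1 x), add_zero]
    · rw [hB.even 1 0 one_ne_zero e he _ (gradeProj_mem 𝒱 0 x), zero_add]
  have hSpar : ∀ j, ∀ e ∈ 𝒱 j, S e ∈ 𝒱 (q + j) := by
    intro j f hf
    have h0 : ∀ l, l ≠ q + j → gradeProj 𝒱 l (S f) = 0 := by
      intro l hl
      refine hB.nondegenerate.2 _ fun e => ?_
      have key : ∀ k, ∀ e ∈ 𝒱 k, B e (gradeProj 𝒱 l (S f)) = 0 := by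
        intro k e he
        by_cases hk : k = l
        · subst hk
          rw [← hsplit _ e he, ← hS]
          refine hB.even _ _ (fun h => hl ?_) _ (hT _ _ he) _ hf
          rw [← h, ← add_assoc, CharTwo.add_self_eq_zero, zero_add]
        · exact hB.even _ _ hk _ he _ (gradeProj_mem 𝒱 l _)
      rw [← gradeProj_add 𝒱 e, map_add, LinearMap.add_apply, key _ _ (gradeProj_mem 𝒱 0 e),
        key _ _ (gradeProj_mem 𝒱 1 e), add_zero]
    have h1 : S f = gradeProj 𝒱 (q + j) (S f) := by
      conv_lhs => rw [← gradeProj_add 𝒱 (S f)]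
      rcases zmod_two_cases (q + j) with h | h
      · rw [h, h0 1 (by rw [h]; exact one_ne_zero), add_zero]
      · rw [h, h0 0 (by rw [h]; exact zero_ne_one), zero_add]
    rw [h1]
    exact gradeProj_mem 𝒱 _ _
  rcases zmod_two_cases q with rfl | rfl
  · exact ⟨S, hSpar, fun j e he f => by rw [hS]; simp⟩
  · refine ⟨gradeInv 𝒱 ∘ₗ S, fun j e he => ?_, fun j e he f => ?_⟩
    · rw [LinearMap.comp_apply, gradeInv_of_mem 𝒱 (hSpar j e he)]
      exact Submodule.smul_mem _ _ (hSpar j e he)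
    · rw [hS, LinearMap.comp_apply, hsplit j e he, hsplit j e he (gradeInv 𝒱 _), superSign_one_left]
      have : gradeProj 𝒱 j (gradeInv 𝒱 (S f)) = paritySign j • gradeProj 𝒱 j (S f) := by
        rcases zmod_two_cases j with rfl | rfl
        · simp [gradeInv, gradeProj_same, gradeProj_ne 𝒱 (one_ne_zero (α := ZMod 2))]
        · simp [gradeInv, gradeProj_same, gradeProj_ne 𝒱 (zero_ne_one (α := ZMod 2))]
      rw [this, map_smul, smul_eq_mul, ← mul_assoc, paritySign_mul_self, one_mul]

lemma exists_homAdjoint_baseEnd {q : ZMod 2} {T : E →ₗ[ℂ] E}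
    (hT : ∀ j, ∀ e ∈ 𝒱 j, T e ∈ 𝒱 (q + j)) :
    ∃ A', IsHomAdjoint 𝒱 B q (baseEnd 𝒱 T) A' := by
  obtain ⟨T', hT', h⟩ := exists_base_adjoint hB hT
  refine ⟨baseEnd 𝒱 T', baseEnd_hasParity hT, baseEnd_hasParity hT', fun j v hv w => ?_⟩
  induction hv using Submodule.span_induction with
  | zero => simp
  | add x y _ _ hx hy => simp only [map_add, LinearMap.add_apply, hx, hy, smul_add]
  | smul c x _ hx =>
    rw [LinearMap.map_smul_of_tower, map_smul, LinearMap.smul_apply, hx, map_smul,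
      LinearMap.smul_apply, smul_comm]
  | mem x hx =>
    obtain ⟨i, k, rfl, e, he, a, ha, rfl⟩ := hx
    induction w using superMod_induction with
    | hadd w w' hw hw' => simp only [map_add, hw, hw', smul_add]
    | hpure l f hf m c hc =>
      rw [baseEnd_pure, baseEnd_pure, form_pure B hf, form_pure B (hT' _ _ hf), h i e he,
        invPow_of_mem _ ha, invPow_of_mem _ ha, smul_mul_assoc, smul_mul_assoc, smul_smul,
        smul_smul, smul_smul, superSign_add_left, superSign_add_right]
      congr 1
      linear_combination (-superSign q i * B e (T' f) * superSign l k) * superSign_mul_self q k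

/-- Elementary endomorphisms come from V_ℂ and have adjoints there; extend right linearly along the
coordinates `ecoord`. Left linearity follows because each `e' x` has the parity of `b.elem x`. -/
lemma exists_dagger : ∃ D : EndL 𝒱 →ₗ[ℂ] EndL 𝒱, (∀ A, IsSuperadjoint 𝒱 B A (D A)) ∧
    (∀ A a, D (A * leftEnd 𝒱 a) = D A * leftEnd 𝒱 a) ∧
    (∀ A a, D (leftEnd 𝒱 a * A) = leftEnd 𝒱 a * D A) := by
  obtain ⟨n, ⟨b⟩⟩ := exists_homBasis 𝒱
  choose e' he' using fun x => exists_homAdjoint_baseEnd hB (b.elem_base_mem x)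
  refine ⟨∑ x, (LinearMap.mulLeft ℂ (e' x)) ∘ₗ
    ({ toFun := leftEnd 𝒱, map_add' := map_add _, map_smul' := leftEnd_smul 𝒱 } :
      Grass →ₗ[ℂ] EndL 𝒱) ∘ₗ b.ecoord x, fun A => ?_, fun A a => ?_, fun A a => ?_⟩
  · rw [LinearMap.sum_apply]
    conv => lhs; rw [← b.sum_elem A]
    refine IsSuperadjoint.sum _ fun x _ => ?_
    change IsSuperadjoint 𝒱 B _ (e' x * leftEnd 𝒱 (b.ecoord x A))
    obtain ⟨c, hc, d, hd, h⟩ := exists_even_add_odd (b.ecoord x A)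
    rw [← h, map_add, mul_add, mul_add]
    exact (IsSuperadjoint.of_hom ((he' x).mul_leftEnd hc)).add
      (IsSuperadjoint.of_hom ((he' x).mul_leftEnd hd))
  · simp only [LinearMap.sum_apply, Finset.sum_mul]
    refine Finset.sum_congr rfl fun x _ => ?_
    change e' x * leftEnd 𝒱 (b.ecoord x _) = e' x * leftEnd 𝒱 (b.ecoord x A) * leftEnd 𝒱 a
    rw [b.ecoord_mul_leftEnd, map_mul, mul_assoc]
  · simp only [LinearMap.sum_apply, Finset.mul_sum]
    refine Finset.sum_congr rfl fun x _ => ?_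
    change e' x * leftEnd 𝒱 (b.ecoord x _) = leftEnd 𝒱 a * (e' x * leftEnd 𝒱 (b.ecoord x A))
    rw [b.ecoord_leftEnd_mul, map_mul, ← mul_assoc, ← mul_assoc, (he' x).2.1.mul_leftEnd 𝒱,
      HomBasis.epar, invPow_invPow]

/-- The adjoint map `A ↦ A^†` on `End_Λ(V)`. -/
def dagger : EndL 𝒱 →ₗ[ℂ] EndL 𝒱 := (exists_dagger hB).choose

lemma dagger_isSuperadjoint (A : EndL 𝒱) : IsSuperadjoint 𝒱 B A (dagger hB A) :=
  (exists_dagger hB).choose_spec.1 A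

lemma dagger_mul_leftEnd (A : EndL 𝒱) (a : Grass) :
    dagger hB (A * leftEnd 𝒱 a) = dagger hB A * leftEnd 𝒱 a :=
  (exists_dagger hB).choose_spec.2.1 A a

lemma dagger_leftEnd_mul (A : EndL 𝒱) (a : Grass) :
    dagger hB (leftEnd 𝒱 a * A) = leftEnd 𝒱 a * dagger hB A :=
  (exists_dagger hB).choose_spec.2.2 A a

lemma IsSuperadjoint.eq_dagger {A A' : EndL 𝒱} (h : IsSuperadjoint 𝒱 B A A') :
    A' = dagger hB A := h.unique hB (dagger_isSuperadjoint hB A)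

lemma IsHomAdjoint.eq_dagger {i : ZMod 2} {A A' : EndL 𝒱} (h : IsHomAdjoint 𝒱 B i A A') :
    A' = dagger hB A := (IsSuperadjoint.of_hom h).eq_dagger hB

lemma IsSuperadjoint.symm {A A' : EndL 𝒱} (h : IsSuperadjoint 𝒱 B A A') :
    IsSuperadjoint 𝒱 B A' A := by
  obtain ⟨A0, A1, A0', A1', rfl, rfl, h0, h1⟩ := h
  exact ⟨A0', A1', A0, A1, rfl, rfl, h0.symm hB, h1.symm hB⟩

lemma IsSuperadjoint.hom {i : ZMod 2} {A A' : EndL 𝒱} (h : IsSuperadjoint 𝒱 B A A')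
    (hA : HasParity 𝒱 i A) : IsHomAdjoint 𝒱 B i A A' := by
  obtain ⟨A0, A1, A0', A1', rfl, rfl, h0, h1⟩ := h
  rcases zmod_two_cases i with rfl | rfl
  · have e1 : A1 = 0 := by
      refine eq_zero_of_hasParity 𝒱 ?_ h1.1
      simpa using hA.sub 𝒱 h0.1
    subst e1
    have : A1' = 0 := h1.unique hB (IsHomAdjoint.zero 1)
    simpa [this] using h0
  · have e0 : A0 = 0 := by
      refine eq_zero_of_hasParity 𝒱 h0.1 ?_
      simpa using hA.sub 𝒱 h1.1
    subst e0
    have : A0' = 0 := h0.unique hB (IsHomAdjoint.zero 0)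
    simpa [this] using h1

lemma dagger_hom {i : ZMod 2} {A : EndL 𝒱} (hA : HasParity 𝒱 i A) :
    IsHomAdjoint 𝒱 B i A (dagger hB A) := (dagger_isSuperadjoint hB A).hom hB hA

lemma dagger_dagger (A : EndL 𝒱) : dagger hB (dagger hB A) = A :=
  (((dagger_isSuperadjoint hB A).symm hB).eq_dagger hB).symm

lemma dagger_isHomAdjoint_self_iff {A : EndL 𝒱} (hA : HasParity 𝒱 0 A) :
    IsHomAdjoint 𝒱 B 0 A A ↔ dagger hB A = A :=
  ⟨fun h => (h.eq_dagger hB).symm, fun h => by simpa [h] using dagger_hom hB hA⟩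

end Adjoint

end OrthoSymp

end

open scoped TensorProduct MulOpposite

noncomputable section

set_option linter.unusedSectionVars false
set_option linter.unusedVariables false

namespace OrthoSymp

/-! ### Orthosymplectic bases. -/

/-- A family of homogeneous vectors of `V_ℂ` in which each vector is paired nontrivially with
exactly one other vector, and with itself if it is even. -/
structure OSFamily {E : Type*} [AddCommGroup E] [Module ℂ E] (𝒱 : ZMod 2 → Submodule ℂ E)
    (B : LinearMap.BilinForm ℂ E) (ι : Type) where
  /-- The vectors. -/
  x : ι → E
  /-- Their parities. -/
  par : ι → ZMod 2
  mem : ∀ i, x i ∈ 𝒱 (par i)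
  /-- The pairing of the indices. -/
  τ : ι → ι
  pairing : ∀ i j, B (x i) (x j) ≠ 0 ↔ j = τ i
  τ_even : ∀ i, par i = 0 → τ i = i

section Bases

variable {E : Type*} [AddCommGroup E] [Module ℂ E] {𝒱 : ZMod 2 → Submodule ℂ E}
  {B : LinearMap.BilinForm ℂ E} (hB : IsOrthosymplectic 𝒱 B)
include hB

lemma form_eq_zero_symm {i j : ZMod 2} {v w : E} (hv : v ∈ 𝒱 i) (hw : w ∈ 𝒱 j)
    (h : B v w = 0) : B w v = 0 := by
  rw [hB.supersymmetric j i w hw v hv, h, mul_zero]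

variable {ι : Type} (F : OSFamily 𝒱 B ι)

lemma OSFamily.form_τ_left (i : ι) : B (F.x (F.τ i)) (F.x i) ≠ 0 := fun h =>
  (F.pairing i (F.τ i)).2 rfl (form_eq_zero_symm hB (F.mem _) (F.mem _) h)

lemma OSFamily.τ_τ (i : ι) : F.τ (F.τ i) = i :=
  ((F.pairing (F.τ i) i).1 (F.form_τ_left hB i)).symm

lemma OSFamily.par_τ (i : ι) : F.par (F.τ i) = F.par i := by
  by_contra h
  exact F.form_τ_left hB i (hB.even _ _ h _ (F.mem _) _ (F.mem _))

lemma OSFamily.linearIndependent [Fintype ι] : LinearIndependent ℂ F.x := by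
  refine Fintype.linearIndependent_iff.2 fun g hg i => ?_
  have h := congrArg (B (F.x (F.τ i))) hg
  rw [map_sum, map_zero, Finset.sum_eq_single i] at h
  · simpa [F.form_τ_left hB i] using h
  · intro j _ hj
    rw [map_smul, not_not.1 (mt (F.pairing (F.τ i) j).1 (by rwa [F.τ_τ hB])), smul_zero]
  · simp

/-- Gram–Schmidt: the coefficient along `x j` is read off by pairing with its partner `x (τ j)`.
Partners share their parity, so the correction stays in `𝒱 q`. -/
lemma OSFamily.exists_orthogonal [Fintype ι] {q : ZMod 2} {w : E} (hw : w ∈ 𝒱 q) :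
    ∃ a ∈ 𝒱 q, (∀ i, B (F.x i) a = 0) ∧ w - a ∈ Submodule.span ℂ (Set.range F.x) := by
  refine ⟨w - ∑ j, (B (F.x (F.τ j)) w / B (F.x (F.τ j)) (F.x j)) • F.x j, ?_, fun i => ?_, ?_⟩
  · refine Submodule.sub_mem _ hw (Submodule.sum_mem _ fun j _ => ?_)
    by_cases h : F.par j = q
    · subst h; exact Submodule.smul_mem _ _ (F.mem j)
    · rw [hB.even _ _ (by rwa [F.par_τ hB]) _ (F.mem (F.τ j)) w hw, zero_div, zero_smul]
      exact Submodule.zero_mem _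
  · rw [map_sub, map_sum, Finset.sum_eq_single (F.τ i)]
    · rw [F.τ_τ hB, map_smul, smul_eq_mul, div_mul_cancel₀ _ ((F.pairing _ _).2 rfl), sub_self]
    · intro j _ hj
      rw [map_smul, not_not.1 (mt (F.pairing i j).1 hj), smul_zero]
    · simp
  · rw [sub_sub_cancel]
    exact Submodule.sum_mem _ fun j _ =>
      Submodule.smul_mem _ _ (Submodule.subset_span ⟨j, rfl⟩)

/-- The union of two mutually orthogonal families. -/
def OSFamily.union {κ : Type} (F : OSFamily 𝒱 B ι) (G : OSFamily 𝒱 B κ)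
    (h : ∀ i k, B (F.x i) (G.x k) = 0) : OSFamily 𝒱 B (ι ⊕ κ) where
  x := Sum.elim F.x G.x
  par := Sum.elim F.par G.par
  mem := by rintro (i | k) <;> simp [F.mem, G.mem]
  τ := Sum.map F.τ G.τ
  pairing := by
    rintro (i | i) (j | j)
    · simpa using F.pairing i j
    · simp [h]
    · simp [form_eq_zero_symm hB (F.mem _) (G.mem _) (h j i)]
    · simpa using G.pairing i j
  τ_even := by
    rintro (i | i) hi
    · simpa using F.τ_even i hi
    · simpa using G.τ_even i hi

/-- The family consisting of one even vector. -/
def OSFamily.single {a : E} (ha : a ∈ 𝒱 0) (h : B a a ≠ 0) : OSFamily 𝒱 B Unit where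
  x _ := a
  par _ := 0
  mem _ := ha
  τ := id
  pairing := by simp [h]
  τ_even := by simp

lemma form_self_odd {a : E} (ha : a ∈ 𝒱 1) : B a a = 0 := by
  have h := hB.supersymmetric 1 1 a ha a ha
  simp only [superSign_one_left, paritySign_one] at h
  linear_combination h / 2

/-- The family consisting of two odd vectors. -/
def OSFamily.pair {a c : E} (ha : a ∈ 𝒱 1) (hc : c ∈ 𝒱 1) (h : B a c ≠ 0) :
    OSFamily 𝒱 B Bool where
  x i := cond i a c
  par _ := 1
  mem i := by cases i <;> assumption
  τ := not
  pairing := by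
    have h' : B c a ≠ 0 := fun h0 => h (form_eq_zero_symm hB hc ha h0)
    rintro (_ | _) (_ | _) <;> simp [h, h', form_self_odd hB ha, form_self_odd hB hc]
  τ_even := by simp

variable [DirectSum.Decomposition 𝒱]

lemma exists_homogeneous_form_ne_zero {q : ZMod 2} {a : E} (ha : a ∈ 𝒱 q) (h : a ≠ 0) :
    ∃ c ∈ 𝒱 q, B a c ≠ 0 := by
  by_contra! hc
  refine h (hB.nondegenerate.1 a fun y => ?_)
  have key : ∀ l, B a (gradeProj 𝒱 l y) = 0 := fun l => by
    by_cases hl : q = l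
    · subst hl; exact hc _ (gradeProj_mem 𝒱 q y)
    · exact hB.even _ _ hl _ ha _ (gradeProj_mem 𝒱 l y)
  rw [← gradeProj_add 𝒱 y, map_add, key, key, add_zero]

/-- A homogeneous vector outside the span, made orthogonal to the family, pairs nontrivially with
some vector `c` of its parity that is also orthogonal. In the even case polarisation yields a vector
of nonzero norm; in the odd case the two vectors form a symplectic pair. -/
lemma OSFamily.exists_block [Fintype ι] (hF : Submodule.span ℂ (Set.range F.x) ≠ ⊤) :
    ∃ (κ : Type) (_ : Fintype κ) (_ : Nonempty κ) (G : OSFamily 𝒱 B κ),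
      ∀ i k, B (F.x i) (G.x k) = 0 := by
  obtain ⟨w, hw⟩ : ∃ w, w ∉ Submodule.span ℂ (Set.range F.x) := by
    by_contra! h; exact hF (Submodule.eq_top_iff'.2 h)
  obtain ⟨q, hq⟩ : ∃ q, gradeProj 𝒱 q w ∉ Submodule.span ℂ (Set.range F.x) := by
    by_contra! h
    exact hw (gradeProj_add 𝒱 w ▸ Submodule.add_mem _ (h 0) (h 1))
  obtain ⟨a, ha, hFa, hwa⟩ := F.exists_orthogonal hB (gradeProj_mem 𝒱 q w)
  have ha0 : a ≠ 0 := by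
    rintro rfl
    exact hq (by simpa using hwa)
  obtain ⟨c', hc', hac'⟩ := exists_homogeneous_form_ne_zero hB ha ha0
  obtain ⟨c, hc, hFc, hcc⟩ := F.exists_orthogonal hB hc'
  -- The correction `c' - c` lies in the span of the family, to which `a` is orthogonal.
  have hac : B a c ≠ 0 := by
    have h0 : B a (c' - c) = 0 := by
      refine Submodule.span_induction (p := fun y _ => B a y = 0) ?_ (map_zero _) ?_ ?_ hcc
      · rintro _ ⟨i, rfl⟩
        exact form_eq_zero_symm hB (F.mem i) ha (hFa i)
      · intro x y _ _ hx hy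
        rw [map_add, hx, hy, add_zero]
      · intro r x _ hx
        rw [map_smul, hx, smul_zero]
    rw [map_sub, sub_eq_zero] at h0
    rwa [← h0]
  rcases zmod_two_cases q with rfl | rfl
  · obtain ⟨e, he, hFe, hee⟩ : ∃ e ∈ 𝒱 0, (∀ i, B (F.x i) e = 0) ∧ B e e ≠ 0 := by
      by_cases h1 : B a a = 0
      · by_cases h2 : B c c = 0
        -- Both vectors are isotropic here, so `a + c` has norm `2 * B a c`.
        · refine ⟨a + c, Submodule.add_mem _ ha hc, fun i => by rw [map_add, hFa, hFc, add_zero], ?_⟩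
          have h3 := hB.supersymmetric 0 0 c hc a ha
          simp only [superSign_zero_left, one_mul] at h3
          simp only [map_add, LinearMap.add_apply, h1, h2, h3, zero_add, add_zero]
          exact fun h => hac (by linear_combination h / 2)
        · exact ⟨c, hc, hFc, h2⟩
      · exact ⟨a, ha, hFa, h1⟩
    exact ⟨Unit, inferInstance, inferInstance, OSFamily.single he hee, fun i _ => hFe i⟩
  · refine ⟨Bool, inferInstance, inferInstance, OSFamily.pair hB ha hc hac, fun i k => ?_⟩
    cases k
    · exact hFc i
    · exact hFa i

variable [FiniteDimensional ℂ E]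

lemma exists_spanning_osFamily : ∃ (ι : Type) (_ : Fintype ι) (F : OSFamily 𝒱 B ι),
    Submodule.span ℂ (Set.range F.x) = ⊤ := by
  -- Induction on a bound `k` for the number of missing vectors; each new block lowers it.
  have key : ∀ (k : ℕ) (ι : Type) (_ : Fintype ι) (F : OSFamily 𝒱 B ι),
      Module.finrank ℂ E - Fintype.card ι ≤ k →
      ∃ (ι : Type) (_ : Fintype ι) (F : OSFamily 𝒱 B ι),
        Submodule.span ℂ (Set.range F.x) = ⊤ := by
    intro k
    induction k with
    | zero =>
      intro ι _ F hk
      have h1 := (F.linearIndependent hB).fintype_card_le_finrank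
      exact ⟨ι, inferInstance, F, (F.linearIndependent hB).span_eq_top_of_card_eq_finrank' (by omega)⟩
    | succ k ih =>
      intro ι _ F hk
      by_cases hF : Submodule.span ℂ (Set.range F.x) = ⊤
      · exact ⟨ι, inferInstance, F, hF⟩
      · obtain ⟨κ, _, _, G, hG⟩ := F.exists_block hB hF
        refine ih (ι ⊕ κ) inferInstance (F.union hB G hG) ?_
        have : 0 < Fintype.card κ := Fintype.card_pos
        rw [Fintype.card_sum]
        omega
  exact key _ Empty inferInstance
    ⟨Empty.elim, Empty.elim, fun i => i.elim, Empty.elim, fun i => i.elim, fun i => i.elim⟩ le_rfl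

end Bases

/-! ### Orthogonal blocks with scalar compressions. -/

section Blocks

variable {E : Type*} [AddCommGroup E] [Module ℂ E] {𝒱 : ZMod 2 → Submodule ℂ E}
  [DirectSum.Decomposition 𝒱]

/-- A decomposition of `V` into mutually orthogonal blocks on which every even self-adjoint
endomorphism is scalar. -/
structure BlockDecomposition (𝒱 : ZMod 2 → Submodule ℂ E) [DirectSum.Decomposition 𝒱]
    (B : LinearMap.BilinForm ℂ E) (n : ℕ) where
  /-- The projections onto the blocks. -/
  π : Fin n → EndL 𝒱
  adj : ∀ k, IsHomAdjoint 𝒱 B 0 (π k) (π k)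
  mul_self : ∀ k, π k * π k = π k
  mul_ne : ∀ k l, k ≠ l → π k * π l = 0
  sum_eq_one : ∑ k, π k = 1
  scalar : ∀ C : EndL 𝒱, IsHomAdjoint 𝒱 B 0 C C → ∀ k,
    ∃ c ∈ grassParity 0, π k * C * π k = leftEnd 𝒱 c * π k

/-- The blocks are the orbits of `τ`: a line for an even vector, a plane for an odd pair. On a line
the compression of an even endomorphism is a scalar anyway. On a symplectic plane a self-adjoint 2×2
matrix with commuting entries is scalar. -/
lemma exists_blockDecomposition [FiniteDimensional ℂ E] {B : LinearMap.BilinForm ℂ E}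
    (hB : IsOrthosymplectic 𝒱 B) : ∃ n, Nonempty (BlockDecomposition 𝒱 B n) := by
  classical
  obtain ⟨ι, _, F, hF⟩ := exists_spanning_osFamily hB
  let b : HomBasis 𝒱 ι :=
    ⟨Module.Basis.mk (F.linearIndependent hB) hF.ge, F.par, fun i => by simpa using F.mem i⟩
  have hb : ∀ i, b.basis i = F.x i := fun i => by simp [b]
  have hbp : ∀ i, b.par i = F.par i := fun i => rfl
  let e := Fintype.equivFin ι
  -- An orbit of `τ` is labelled by the smaller of the numbers of its elements.
  let κ : ι → Fin (Fintype.card ι) := fun i => min (e i) (e (F.τ i))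
  have hκ : ∀ i j, κ i = κ j ↔ j = i ∨ j = F.τ i := by
    intro i j
    constructor
    · intro h
      have h1 : κ i = e i ∨ κ i = e (F.τ i) := min_choice _ _
      have h2 : κ j = e j ∨ κ j = e (F.τ j) := min_choice _ _
      rcases h1 with h1 | h1 <;> rcases h2 with h2 | h2
      · left; exact e.injective (by rw [← h2, ← h, h1])
      · right
        have : i = F.τ j := e.injective (by rw [← h1, h, h2])
        rw [this, F.τ_τ hB]
      · right; exact e.injective (by rw [← h2, ← h, h1])
      · left
        have : F.τ i = F.τ j := e.injective (by rw [← h1, h, h2])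
        rw [← F.τ_τ hB j, ← this, F.τ_τ hB]
    · rintro (rfl | rfl)
      · rfl
      · simp only [κ, F.τ_τ hB, min_comm]
  let P : Fin (Fintype.card ι) → EndL 𝒱 := fun k =>
    ∑ i, if κ i = k then b.elem (i, i) else 0
  have hP : ∀ k i, P k (b.vec i) = if κ i = k then b.vec i else 0 := by
    intro k i
    simp only [P, LinearMap.sum_apply]
    rw [Finset.sum_eq_single i]
    · split_ifs <;> simp [b.elem_vec]
    · intro j _ hj
      split_ifs <;> simp [b.elem_vec, hj]
    · simp
  have hPpar : ∀ k, HasParity 𝒱 0 (P k) := fun k => by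
    refine HasParity.sum 𝒱 _ fun i _ => ?_
    split_ifs
    · have h := b.elem_hasParity (i, i)
      rwa [HomBasis.epar, CharTwo.add_self_eq_zero] at h
    · exact HasParity.zero 𝒱 0
  have hform : ∀ i j, superForm 𝒱 B (b.vec i) (b.vec j) = algebraMap ℂ Grass (B (F.x i) (F.x j)) := by
    intro i j
    rw [HomBasis.vec, HomBasis.vec, form_pure B (b.mem j), map_one, mul_one, hb, hb,
      Algebra.algebraMap_eq_smul_one]
  have hform0 : ∀ i j, j ≠ F.τ i → superForm 𝒱 B (b.vec i) (b.vec j) = 0 := by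
    intro i j h
    rw [hform, not_not.1 (mt (F.pairing i j).1 h), map_zero]
  have hadj : ∀ k, IsHomAdjoint 𝒱 B 0 (P k) (P k) := by
    intro k
    rw [isHomAdjoint_even_iff (hPpar k) (hPpar k)]
    have h1 : ∀ i j, superForm 𝒱 B (P k (b.vec i)) (b.vec j) =
        superForm 𝒱 B (b.vec i) (P k (b.vec j)) := by
      intro i j
      rw [hP, hP]
      by_cases h : j = F.τ i
      · have : κ i = κ j := (hκ i j).2 (Or.inr h)
        rw [this]
        split_ifs <;> simp
      · split_ifs <;> simp [hform0 i j h]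
    intro v w
    rw [← b.sum_vec v, ← b.sum_vec w]
    simp only [map_sum, LinearMap.sum_apply, LinearMap.map_smul, form_op_smul_left,
      form_op_smul_right]
    refine Finset.sum_congr rfl fun j _ => Finset.sum_congr rfl fun i _ => ?_
    rw [b.smul_vec, form_op_smul_right, h1, ← form_op_smul_right, ← LinearMap.map_smul,
      ← b.smul_vec, (hPpar k).map_smul, invPow_zero]
  refine ⟨Fintype.card ι, ⟨P, hadj, fun k => b.end_ext fun i => ?_,
    fun k l hkl => b.end_ext fun i => ?_, b.end_ext fun i => ?_, fun C hC k => ?_⟩⟩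
  · rw [Module.End.mul_apply, hP]
    split_ifs with h
    · rw [hP, if_pos h]
    · simp
  · rw [Module.End.mul_apply, hP]
    split_ifs with h
    · rw [hP, if_neg (fun h' => hkl (h'.symm.trans h)), LinearMap.zero_apply]
    · simp
  · simp [hP]
  · have hcoord : ∀ i j, superForm 𝒱 B (C (b.vec i)) (b.vec j) =
        B (F.x (F.τ j)) (F.x j) • invPow (b.par j) (b.vcoord (F.τ j) (C (b.vec i))) := by
      intro i j
      conv_lhs => rw [← b.sum_vec (C (b.vec i))]
      rw [map_sum, LinearMap.sum_apply, Finset.sum_eq_single (F.τ j)]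
      · rw [form_op_smul_left, b.smul_vec, form_op_smul_right, hform, Algebra.algebraMap_eq_smul_one,
          smul_mul_assoc, one_mul]
      · intro l _ hl
        rw [form_op_smul_left, b.smul_vec, form_op_smul_right, hform0, zero_mul]
        rintro rfl
        exact hl (F.τ_τ hB l).symm
      · simp
    have hcoord' : ∀ i j, superForm 𝒱 B (b.vec i) (C (b.vec j)) =
        B (F.x i) (F.x (F.τ i)) • b.vcoord (F.τ i) (C (b.vec j)) := by
      intro i j
      conv_lhs => rw [← b.sum_vec (C (b.vec j))]
      rw [map_sum, Finset.sum_eq_single (F.τ i)]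
      · rw [form_op_smul_right, hform, Algebra.algebraMap_eq_smul_one, smul_mul_assoc, one_mul]
      · intro l _ hl
        rw [form_op_smul_right, hform0 i l hl, zero_mul]
      · simp
    have hpar : ∀ i j, b.vcoord i (C (b.vec j)) ∈ grassParity (b.par i + b.par j) := by
      intro i j
      have := b.vcoord_mem i (hC.1 _ _ (b.vec_mem j))
      rwa [zero_add] at this
    have hpar0 : ∀ i, b.vcoord i (C (b.vec i)) ∈ grassParity 0 := fun i => by
      have := hpar i i
      rwa [CharTwo.add_self_eq_zero] at this
    have hparτ : ∀ i, b.vcoord (F.τ i) (C (b.vec i)) ∈ grassParity 0 := fun i => by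
      have := hpar (F.τ i) i
      rwa [hbp, hbp, F.par_τ hB, CharTwo.add_self_eq_zero] at this
    -- Self-adjointness tested on `x i` and its partner equates the two diagonal entries of the
    -- block.
    have hdiag : ∀ i, b.vcoord (F.τ i) (C (b.vec (F.τ i))) = b.vcoord i (C (b.vec i)) := by
      intro i
      have h := hC.even_form (b.vec i) (b.vec (F.τ i))
      rw [hcoord, hcoord', F.τ_τ hB, invPow_of_mem _ (hpar0 i), superSign_zero_right, one_smul] at h
      exact (smul_right_injective _ ((F.pairing i _).2 rfl) h).symm
    -- Self-adjointness tested on `x i` with itself, combined with antisymmetry of the form on odd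
    -- vectors, equates the off-diagonal entry with its negative.
    have hoff : ∀ i, F.τ i ≠ i → b.vcoord (F.τ i) (C (b.vec i)) = 0 := by
      intro i hi
      have hi1 : F.par i = 1 := (zmod_two_cases _).resolve_left fun h => hi (F.τ_even i h)
      have h := hC.even_form (b.vec i) (b.vec i)
      rw [hcoord, hcoord', invPow_of_mem _ (hparτ i), superSign_zero_right, one_smul] at h
      have h2 := hB.supersymmetric _ _ _ (F.mem (F.τ i)) _ (F.mem i)
      rw [F.par_τ hB, hi1, superSign_one_left, paritySign_one] at h2
      rw [h2, mul_smul, neg_one_smul] at h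
      have h3 : (2 : ℂ) • B (F.x i) (F.x (F.τ i)) • b.vcoord (F.τ i) (C (b.vec i)) = 0 := by
        rw [two_smul]
        nth_rewrite 1 [← h]
        rw [neg_add_cancel]
      have h4 := (smul_eq_zero.1 h3).resolve_left two_ne_zero
      exact (smul_eq_zero.1 h4).resolve_left ((F.pairing i _).2 rfl)
    by_cases hk : ∃ i, κ i = k
    · obtain ⟨i, rfl⟩ := hk
      refine ⟨b.vcoord i (C (b.vec i)), hpar0 i, b.end_ext fun j => ?_⟩
      rw [Module.End.mul_apply, Module.End.mul_apply, Module.End.mul_apply, hP]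
      split_ifs with hj
      · have hcj : b.vcoord j (C (b.vec j)) = b.vcoord i (C (b.vec i)) := by
          rcases (hκ i j).1 hj.symm with rfl | rfl
          · rfl
          · exact hdiag i
        rw [leftEnd_apply, even_smul 𝒱 (hpar0 i), ← hcj]
        conv_lhs => rw [← b.sum_vec (C (b.vec j))]
        rw [map_sum, Finset.sum_eq_single j]
        · rw [LinearMap.map_smul, hP, if_pos hj]
        · intro l _ hl
          rw [LinearMap.map_smul, hP]
          split_ifs with hlk
          · rcases (hκ j l).1 (hj.trans hlk.symm) with h | h
            · exact absurd h hl
            · subst h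
              rw [hoff j hl, MulOpposite.op_zero, zero_smul]
          · rw [smul_zero]
        · simp
      · simp
    -- A number that labels no orbit: the projection is zero, so any scalar serves.
    · refine ⟨0, Submodule.zero_mem _, b.end_ext fun j => ?_⟩
      rw [Module.End.mul_apply, hP, if_neg (fun h => hk ⟨j, h⟩)]
      simp

end Blocks

end OrthoSymp

end

open scoped TensorProduct MulOpposite

noncomputable section

set_option linter.unusedSectionVars false
set_option linter.unusedVariables false

namespace OrthoSymp

/-! ### Moving a factor inside an ordered product. -/

section Lists

variable {M : Type*} [Monoid M]

lemma prod_ofFn_update_move {d : ℕ} (x : Fin d → M) (i : Fin d) (hi : i.1 + 1 < d) (a : M) :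
    (List.ofFn (Function.update x i (x i * a))).prod =
      (List.ofFn (Function.update x ⟨i.1 + 1, hi⟩ (a * x ⟨i.1 + 1, hi⟩))).prod := by
  induction d with
  | zero => exact i.elim0
  | succ d ih =>
    rw [List.ofFn_succ, List.ofFn_succ, List.prod_cons, List.prod_cons]
    refine Fin.cases (fun hi => ?_) (fun i hi => ?_) i hi
    · obtain ⟨d, rfl⟩ : ∃ e, d = e + 1 := ⟨d - 1, by simp at hi; omega⟩
      rw [List.ofFn_succ, List.ofFn_succ, List.prod_cons, List.prod_cons]
      simp only [Fin.val_zero, Function.update_self]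
      have e1 : (⟨0 + 1, hi⟩ : Fin (d + 1 + 1)) = Fin.succ 0 := rfl
      rw [e1, Function.update_self, Function.update_of_ne (Fin.succ_ne_zero _),
        Function.update_of_ne (Fin.succ_ne_zero 0).symm]
      have e2 : ∀ j : Fin d, Function.update x 0 (x 0 * a) j.succ.succ = x j.succ.succ :=
        fun j => Function.update_of_ne (Fin.succ_ne_zero _) _ _
      have e3 : ∀ j : Fin d, Function.update x (Fin.succ 0) (a * x (Fin.succ 0)) j.succ.succ =
          x j.succ.succ :=
        fun j => Function.update_of_ne (fun h => Fin.succ_ne_zero _ (Fin.succ_injective _ h)) _ _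
      simp only [e2, e3, mul_assoc]
    · have hi' : i.1 + 1 < d := by simpa using hi
      have e : (⟨(i.succ : Fin (d + 1)).1 + 1, hi⟩ : Fin (d + 1)) = Fin.succ ⟨i.1 + 1, hi'⟩ := rfl
      rw [e, Function.update_of_ne (Fin.succ_ne_zero _).symm,
        Function.update_of_ne (Fin.succ_ne_zero _).symm]
      have h := ih (fun j => x j.succ) i hi'
      have e2 : ∀ (k : Fin d) (y : M), (fun j : Fin d => Function.update x k.succ y j.succ) =
          Function.update (fun j => x j.succ) k y := fun k y => by
        ext j
        by_cases hj : j = k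
        · subst hj; simp
        · rw [Function.update_of_ne hj, Function.update_of_ne (fun h => hj (Fin.succ_injective _ h))]
      rw [e2, e2, h]

lemma prod_ofFn_update_last {d : ℕ} (x : Fin d → M) (i : Fin d) (hi : i.1 + 1 = d) (a : M) :
    (List.ofFn (Function.update x i (x i * a))).prod = (List.ofFn x).prod * a := by
  obtain ⟨d, rfl⟩ : ∃ e, d = e + 1 := ⟨i.1, hi.symm⟩
  have e : i = Fin.last d := Fin.ext (by simpa using hi)
  subst e
  rw [List.ofFn_succ', List.ofFn_succ' x]
  simp only [List.concat_eq_append, List.prod_append, List.prod_singleton, Function.update_self]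
  have e2 : ∀ j : Fin d, Function.update x (Fin.last d) (x (Fin.last d) * a) j.castSucc =
      x j.castSucc := fun j => Function.update_of_ne (Fin.castSucc_lt_last j).ne _ _
  simp only [e2, mul_assoc]

end Lists

/-! ### Forms on tensor powers of V. -/

section TensorDual

variable {E : Type*} [AddCommGroup E] [Module ℂ E] {𝒱 : ZMod 2 → Submodule ℂ E}
  [DirectSum.Decomposition 𝒱]

/-- A scalar at the junction of arguments `m - 1` and `m` is twisted by `φ m`. Balancedness survives
when both neighbours twist it alike, and right linearity when the last argument does not twist it at
all. -/
lemma comp_mem_tensorDual {r : ℕ} {f : MultilinearMap ℂ (fun _ : Fin r => SuperMod 𝒱) Grass}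
    (hf : f ∈ tensorDual 𝒱 r) (T : Fin r → (SuperMod 𝒱 →ₗ[ℂ] SuperMod 𝒱))
    (φ : ℕ → Grass → Grass)
    (h1 : ∀ (i : Fin r), i.1 + 1 < r → ∀ (a : Grass) v,
      T i (MulOpposite.op a • v) = MulOpposite.op (φ (i.1 + 1) a) • T i v)
    (h2 : ∀ (i : Fin r), 0 < i.1 → ∀ (a : Grass) v, T i (a • v) = φ i.1 a • T i v)
    (h3 : ∀ (i : Fin r), i.1 + 1 = r → ∀ (a : Grass) v,
      T i (MulOpposite.op a • v) = MulOpposite.op a • T i v) :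
    f.compLinearMap T ∈ tensorDual 𝒱 r := by
  have hT : ∀ (v : Fin r → SuperMod 𝒱) i x, (fun j => T j (Function.update v i x j)) =
      Function.update (fun j => T j (v j)) i (T i x) := fun v i x => by
    ext j
    exact Function.apply_update (fun j => T j) v i x j
  refine ⟨fun v i hi a => ?_, fun v i hi a => ?_⟩
  · simp only [MultilinearMap.compLinearMap_apply, hT]
    rw [h1 i hi, h2 ⟨i.1 + 1, hi⟩ (Nat.succ_pos _)]
    exact hf.1 (fun j => T j (v j)) i hi _
  · simp only [MultilinearMap.compLinearMap_apply, hT]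
    rw [h3 i hi]
    exact hf.2 (fun j => T j (v j)) i hi _

lemma exists_op_smul {k : ZMod 2} {a : Grass} (ha : a ∈ grassParity k) {v : SuperMod 𝒱}
    (h : k = 0 ∨ ∃ q, v ∈ modParity 𝒱 q) :
    ∃ ε : ℂ, ε ≠ 0 ∧ (k = 0 → ε = 1) ∧ a • v = ε • (MulOpposite.op a • v) := by
  rcases zmod_two_cases k with rfl | rfl
  · exact ⟨1, one_ne_zero, fun _ => rfl, by rw [one_smul, even_smul 𝒱 ha]⟩
  · obtain ⟨q, hq⟩ := h.resolve_left one_ne_zero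
    refine ⟨paritySign q, ?_, fun h => absurd h one_ne_zero, ?_⟩
    · rcases zmod_two_cases q with rfl | rfl <;> simp
    · rw [odd_smul 𝒱 ha, parityInv_of_mem 𝒱 hq, smul_comm]

/-- The scalar travels through the later arguments to the right end and picks up a sign at each
homogeneous one. Later uses need only that the resulting factor is nonzero, and that it is 1 for
even scalars. -/
lemma tensorDual_smul {r : ℕ} {f : MultilinearMap ℂ (fun _ : Fin r => SuperMod 𝒱) Grass}
    (hf : f ∈ tensorDual 𝒱 r) {k : ZMod 2} {a : Grass} (ha : a ∈ grassParity k)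
    (v : Fin r → SuperMod 𝒱) (h : k = 0 ∨ ∀ j, ∃ q, v j ∈ modParity 𝒱 q) (i : Fin r) :
    ∃ ε : ℂ, ε ≠ 0 ∧ (k = 0 → ε = 1) ∧
      f (Function.update v i (a • v i)) = ε • (f v * a) := by
  obtain ⟨n, hn⟩ : ∃ n, i.1 + 1 + n = r := ⟨r - (i.1 + 1), by omega⟩
  induction n generalizing i with
  | zero =>
    obtain ⟨ε, h0, h1, h2⟩ := exists_op_smul ha (v := v i) (h.imp_right fun h => h i)
    exact ⟨ε, h0, h1, by rw [h2, MultilinearMap.map_update_smul, hf.2 v i (by omega)]⟩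
  | succ n ih =>
    obtain ⟨ε, h0, h1, h2⟩ := exists_op_smul ha (v := v i) (h.imp_right fun h => h i)
    obtain ⟨δ, k0, k1, k2⟩ := ih ⟨i.1 + 1, by omega⟩ (by simp; omega)
    refine ⟨ε * δ, mul_ne_zero h0 k0, fun h => by rw [h1 h, k1 h, one_mul], ?_⟩
    rw [h2, MultilinearMap.map_update_smul, hf.1 v i (by omega), k2, smul_smul]

lemma tensorDual_even_smul {r : ℕ} {f : MultilinearMap ℂ (fun _ : Fin r => SuperMod 𝒱) Grass}
    (hf : f ∈ tensorDual 𝒱 r) {a : Grass} (ha : a ∈ grassParity 0)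
    (v : Fin r → SuperMod 𝒱) (i : Fin r) :
    f (Function.update v i (a • v i)) = f v * a := by
  obtain ⟨ε, -, h1, h2⟩ := tensorDual_smul hf ha v (Or.inl rfl) i
  rw [h2, h1 rfl, one_smul]

lemma multilinear_ext_homogeneous {N : Type*} [AddCommGroup N] [Module ℂ N] {r : ℕ}
    {f : MultilinearMap ℂ (fun _ : Fin r => SuperMod 𝒱) N}
    (h : ∀ v, (∀ j, ∃ q, v j ∈ modParity 𝒱 q) → f v = 0) : f = 0 := by
  ext v
  choose x hx y hy hxy using fun j => exists_mem_add_mem 𝒱 (v j)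
  have e : v = x + y := funext fun j => (hxy j).symm
  rw [e, MultilinearMap.map_add_univ]
  refine Finset.sum_eq_zero fun s _ => h _ fun j => ?_
  by_cases hj : j ∈ s
  · exact ⟨0, by simpa [hj] using hx j⟩
  · exact ⟨1, by simpa [hj] using hy j⟩

/-- Right multiplication of a form on `T^r(V)`: `(f a)(v_1, …) = f(a v_1, …)`. -/
def frontMul {r : ℕ} (h0 : 0 < r) (f : MultilinearMap ℂ (fun _ : Fin r => SuperMod 𝒱) Grass) :
    Grass →ₗ[ℂ] MultilinearMap ℂ (fun _ : Fin r => SuperMod 𝒱) Grass where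
  toFun a := f.compLinearMap (Function.update (fun _ => LinearMap.id) ⟨0, h0⟩ (leftMul 𝒱 a))
  map_add' a a' := by
    ext v
    have e : ∀ a, (fun j => (Function.update (fun _ : Fin r => LinearMap.id) ⟨0, h0⟩ (leftMul 𝒱 a) :
        Fin r → (SuperMod 𝒱 →ₗ[ℂ] SuperMod 𝒱)) j (v j)) =
        Function.update v ⟨0, h0⟩ (a • v ⟨0, h0⟩) := fun a => by
      ext j
      by_cases hj : j = ⟨0, h0⟩
      · subst hj; simp [smul_eq_leftMul]
      · simp [hj]
    simp only [MultilinearMap.compLinearMap_apply, add_apply, e, add_smul,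
      MultilinearMap.map_update_add]
  map_smul' c a := by
    ext v
    have e : ∀ a, (fun j => (Function.update (fun _ : Fin r => LinearMap.id) ⟨0, h0⟩ (leftMul 𝒱 a) :
        Fin r → (SuperMod 𝒱 →ₗ[ℂ] SuperMod 𝒱)) j (v j)) =
        Function.update v ⟨0, h0⟩ (a • v ⟨0, h0⟩) := fun a => by
      ext j
      by_cases hj : j = ⟨0, h0⟩
      · subst hj; simp [smul_eq_leftMul]
      · simp [hj]
    simp only [MultilinearMap.compLinearMap_apply, smul_apply, e, smul_assoc,
      MultilinearMap.map_update_smul, RingHom.id_apply]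

lemma frontMul_apply {r : ℕ} (h0 : 0 < r)
    (f : MultilinearMap ℂ (fun _ : Fin r => SuperMod 𝒱) Grass) (a : Grass)
    (v : Fin r → SuperMod 𝒱) :
    frontMul h0 f a v = f (Function.update v ⟨0, h0⟩ (a • v ⟨0, h0⟩)) := by
  change f (fun j => _) = _
  congr 1
  ext j
  by_cases hj : j = ⟨0, h0⟩
  · subst hj; simp [smul_eq_leftMul]
  · simp [hj]

lemma frontMul_mem {r : ℕ} (h0 : 0 < r)
    {f : MultilinearMap ℂ (fun _ : Fin r => SuperMod 𝒱) Grass} (hf : f ∈ tensorDual 𝒱 r)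
    (a : Grass) : frontMul h0 f a ∈ tensorDual 𝒱 r := by
  have e : ∀ (i : Fin r) (c : Grass) (v : SuperMod 𝒱),
      (Function.update (fun _ : Fin r => LinearMap.id) ⟨0, h0⟩ (leftMul 𝒱 a) :
        Fin r → (SuperMod 𝒱 →ₗ[ℂ] SuperMod 𝒱)) i (MulOpposite.op c • v) = MulOpposite.op c •
      (Function.update (fun _ : Fin r => LinearMap.id) ⟨0, h0⟩ (leftMul 𝒱 a) :
        Fin r → (SuperMod 𝒱 →ₗ[ℂ] SuperMod 𝒱)) i v := fun i c v => by
    by_cases hi : i = ⟨0, h0⟩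
    · subst hi
      simp only [Function.update_self, ← smul_eq_leftMul]
      exact smul_comm _ _ _
    · simp [hi]
  refine comp_mem_tensorDual hf _ (fun _ => id) (fun i _ => e i) (fun i hi c v => ?_)
    (fun i _ => e i)
  have : i ≠ ⟨0, h0⟩ := fun h => by subst h; exact absurd hi (lt_irrefl 0)
  simp [this]

lemma frontMul_mul {r : ℕ} (h0 : 0 < r)
    (f : MultilinearMap ℂ (fun _ : Fin r => SuperMod 𝒱) Grass) (a c : Grass)
    (v : Fin r → SuperMod 𝒱) :
    frontMul h0 f (a * c) v = frontMul h0 f a (Function.update v ⟨0, h0⟩ (c • v ⟨0, h0⟩)) := by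
  rw [frontMul_apply, frontMul_apply, Function.update_self, Function.update_idem, mul_smul]

end TensorDual

/-! ### Forms on endomorphisms and vectors, by values on elementary endomorphisms. -/

section MixedDual

variable {E : Type*} [AddCommGroup E] [Module ℂ E] {𝒱 : ZMod 2 → Submodule ℂ E}
  [DirectSum.Decomposition 𝒱] {d : ℕ}

lemma exists_leftEnd_mul {k : ZMod 2} {a : Grass} (ha : a ∈ grassParity k) {A : EndL 𝒱}
    (h : k = 0 ∨ ∃ q, HasParity 𝒱 q A) :
    ∃ ε : ℂ, ε ≠ 0 ∧ (k = 0 → ε = 1) ∧ leftEnd 𝒱 a * A = ε • (A * leftEnd 𝒱 a) := by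
  rcases zmod_two_cases k with rfl | rfl
  · exact ⟨1, one_ne_zero, fun _ => rfl, by rw [one_smul, leftEnd_mul_comm 𝒱 ha]⟩
  · obtain ⟨q, hq⟩ := h.resolve_left one_ne_zero
    refine ⟨paritySign q, ?_, fun h => absurd h one_ne_zero, ?_⟩
    · rcases zmod_two_cases q with rfl | rfl <;> simp
    · rw [hq.mul_leftEnd_of_mem ha, smul_smul, superSign_one_right, paritySign_mul_self, one_smul]

lemma mixedDual_sub {K K' : MixedMultilinear 𝒱 d} (hK : K ∈ mixedDual 𝒱 d)
    (hK' : K' ∈ mixedDual 𝒱 d) : K - K' ∈ mixedDual 𝒱 d := by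
  have e : K - K' = K + (-1 : Grass) • K' := by
    ext A v
    change K A v - K' A v = K A v + (-1 : Grass) * K' A v
    rw [neg_one_mul, sub_eq_add_neg]
  rw [e]
  exact Submodule.add_mem _ hK (Submodule.smul_mem _ _ hK')

lemma mixedDual_move {K : MixedMultilinear 𝒱 d} (hK : K ∈ mixedDual 𝒱 d) (A : Fin d → EndL 𝒱)
    (i : Fin d) (hi : i.1 + 1 < d) (a : Grass) :
    K (Function.update A i (A i * leftEnd 𝒱 a)) =
      K (Function.update A ⟨i.1 + 1, hi⟩ (leftEnd 𝒱 a * A ⟨i.1 + 1, hi⟩)) :=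
  hK.2.1 A i hi a

lemma mixedDual_move_last {K : MixedMultilinear 𝒱 d} (hK : K ∈ mixedDual 𝒱 d)
    (A : Fin d → EndL 𝒱) (i : Fin d) (hi : i.1 + 1 = d) (h0 : 0 < 2 * d) (a : Grass)
    (v : Fin (2 * d) → SuperMod 𝒱) :
    K (Function.update A i (A i * leftEnd 𝒱 a)) v =
      K A (Function.update v ⟨0, h0⟩ (a • v ⟨0, h0⟩)) :=
  hK.2.2 A i hi h0 a v

lemma mixedDual_smul {K : MixedMultilinear 𝒱 d} (hK : K ∈ mixedDual 𝒱 d) {k : ZMod 2} {a : Grass}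
    (ha : a ∈ grassParity k) (A : Fin d → EndL 𝒱) (v : Fin (2 * d) → SuperMod 𝒱)
    (h : k = 0 ∨ (∀ j, ∃ q, HasParity 𝒱 q (A j)) ∧ ∀ j, ∃ q, v j ∈ modParity 𝒱 q) (i : Fin d) :
    ∃ ε : ℂ, ε ≠ 0 ∧ (k = 0 → ε = 1) ∧
      K (Function.update A i (A i * leftEnd 𝒱 a)) v = ε • (K A v * a) := by
  obtain ⟨n, hn⟩ : ∃ n, i.1 + 1 + n = d := ⟨d - (i.1 + 1), by omega⟩
  induction n generalizing i with
  | zero =>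
    have h0 : 0 < 2 * d := by omega
    rw [mixedDual_move_last hK A i (by omega) h0]
    exact tensorDual_smul (hK.1 A) ha v (h.imp_right fun h => h.2) _
  | succ n ih =>
    have hi : i.1 + 1 < d := by omega
    obtain ⟨ε, h0, h1, h2⟩ := exists_leftEnd_mul ha (A := A ⟨i.1 + 1, hi⟩)
      (h.imp_right fun h => h.1 _)
    obtain ⟨δ, k0, k1, k2⟩ := ih ⟨i.1 + 1, hi⟩ (by simp; omega)
    refine ⟨ε * δ, mul_ne_zero h0 k0, fun h => by rw [h1 h, k1 h, one_mul], ?_⟩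
    rw [mixedDual_move hK A i hi, h2, MultilinearMap.map_update_smul, smul_apply,
      k2, smul_smul]

lemma mixedDual_even_smul {K : MixedMultilinear 𝒱 d} (hK : K ∈ mixedDual 𝒱 d) {a : Grass}
    (ha : a ∈ grassParity 0) (A : Fin d → EndL 𝒱) (v : Fin (2 * d) → SuperMod 𝒱) (i : Fin d) :
    K (Function.update A i (leftEnd 𝒱 a * A i)) v = K A v * a := by
  obtain ⟨ε, -, h1, h2⟩ := mixedDual_smul hK ha A v (Or.inl rfl) i
  rw [leftEnd_mul_comm 𝒱 ha, h2, h1 rfl, one_smul]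

lemma apply_pow_of_update {M N : Type*} {r : ℕ} (f : (Fin r → M) → Grass) (s : M → M) (a : Grass)
    (h : ∀ v i, f (Function.update v i (s (v i))) = f v * a) (v : Fin r → M) :
    f (fun j => s (v j)) = f v * a ^ r := by
  have key : ∀ t : Finset (Fin r), f (t.piecewise (fun j => s (v j)) v) = f v * a ^ t.card := by
    intro t
    induction t using Finset.induction_on with
    | empty => simp
    | insert i t hi ih =>
      rw [Finset.card_insert_of_notMem hi, Finset.piecewise_insert, pow_succ, ← mul_assoc, ← ih, ← h,
        Finset.piecewise_eq_of_notMem _ _ _ hi]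
  simpa using key Finset.univ

lemma mixedDual_even_smul_all {K : MixedMultilinear 𝒱 d} (hK : K ∈ mixedDual 𝒱 d) {a : Grass}
    (ha : a ∈ grassParity 0) (A : Fin d → EndL 𝒱) (v : Fin (2 * d) → SuperMod 𝒱) :
    K (fun i => leftEnd 𝒱 a * A i) v = K A v * a ^ d :=
  apply_pow_of_update (N := Unit) (fun A => K A v) (fun X => leftEnd 𝒱 a * X) a
    (fun A i => mixedDual_even_smul hK ha A v i) A

lemma tensorDual_even_smul_all {r : ℕ}
    {f : MultilinearMap ℂ (fun _ : Fin r => SuperMod 𝒱) Grass}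
    (hf : f ∈ tensorDual 𝒱 r) {a : Grass} (ha : a ∈ grassParity 0) (v : Fin r → SuperMod 𝒱) :
    f (fun j => a • v j) = f v * a ^ r :=
  apply_pow_of_update (N := Unit) f (fun x => a • x) a
    (fun v i => tensorDual_even_smul hf ha v i) v

variable {ι : Type*} [Fintype ι] [DecidableEq ι] (b : HomBasis 𝒱 ι)

/-- A form is determined by its values on the elementary endomorphisms. -/
lemma mixedDual_eq_zero {K : MixedMultilinear 𝒱 d} (hK : K ∈ mixedDual 𝒱 d)
    (h : ∀ c : Fin d → ι × ι, K (fun i => b.elem (c i)) = 0) : K = 0 := by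
  -- Positions below `m` already hold elementary endomorphisms. Expanding position `m` leaves
  -- scalars on its right, which balancedness pushes into the next position or, after the last one,
  -- into the vectors.
  have key : ∀ (n m : ℕ), m + n = d → ∀ A : Fin d → EndL 𝒱,
      (∀ i : Fin d, i.1 < m → ∃ c, A i = b.elem c) → K A = 0 := by
    intro n
    induction n with
    | zero =>
      intro m hm A hA
      choose c hc using fun i : Fin d => hA i (by omega)
      rw [show A = fun i => b.elem (c i) from funext hc]
      exact h c
    | succ n ih =>
      intro m hm A hA
      have hmd : m < d := by omega
      have e : A = Function.update A ⟨m, hmd⟩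
          (∑ c, b.elem c * leftEnd 𝒱 (b.ecoord c (A ⟨m, hmd⟩))) := by
        rw [b.sum_elem, Function.update_eq_self]
      rw [e, MultilinearMap.map_update_sum]
      refine Finset.sum_eq_zero fun c _ => ?_
      set a := b.ecoord c (A ⟨m, hmd⟩)
      set A' := Function.update A ⟨m, hmd⟩ (b.elem c) with hA'
      have hA'm : ∀ i : Fin d, i.1 < m + 1 → ∃ c, A' i = b.elem c := by
        intro i hi
        by_cases him : i = ⟨m, hmd⟩
        · subst him; exact ⟨c, by simp [hA']⟩
        · rw [hA', Function.update_of_ne him]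
          exact hA i (lt_of_le_of_ne (by omega) fun h => him (Fin.ext h))
      have e1 : Function.update A ⟨m, hmd⟩ (b.elem c * leftEnd 𝒱 a) =
          Function.update A' ⟨m, hmd⟩ (A' ⟨m, hmd⟩ * leftEnd 𝒱 a) := by simp [hA']
      rw [e1]
      by_cases hm1 : m + 1 < d
      · rw [mixedDual_move hK A' ⟨m, hmd⟩ hm1]
        refine ih (m + 1) (by omega) _ fun i hi => ?_
        rw [Function.update_of_ne (fun h => by rw [h] at hi; simp at hi)]
        exact hA'm i hi
      · ext v
        have h0 : 0 < 2 * d := by omega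
        rw [mixedDual_move_last hK A' ⟨m, hmd⟩ (by simp; omega) h0, ih (m + 1) (by omega) A' hA'm]
        rfl
  ext1 A
  exact key d 0 (by omega) A fun i hi => absurd hi (Nat.not_lt_zero _)

/-- The total parity of the elementary endomorphisms behind position `i`. -/
def HomBasis.tailPar (c : Fin d → ι × ι) (i : Fin d) : ZMod 2 :=
  ∑ k ∈ Finset.Ioi i, b.epar (c k)

/-- The coefficient of the product of the elementary endomorphisms `c` in `A_1 ⊗ ⋯ ⊗ A_d` after
all the scalars have been moved to the right. -/
def HomBasis.tcoord (c : Fin d → ι × ι) : MultilinearMap ℂ (fun _ : Fin d => EndL 𝒱) Grass :=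
  (MultilinearMap.mkPiAlgebraFin ℂ d Grass).compLinearMap
    fun i => (invPow (b.tailPar c i)).toLinearMap ∘ₗ b.ecoord (c i)

lemma HomBasis.tcoord_apply (c : Fin d → ι × ι) (A : Fin d → EndL 𝒱) :
    b.tcoord c A = (List.ofFn fun i => invPow (b.tailPar c i) (b.ecoord (c i) (A i))).prod := by
  simp [tcoord]

/-- The form with prescribed values on the elementary endomorphisms. -/
def HomBasis.extend (hd : 0 < 2 * d)
    (f : (Fin d → ι × ι) → MultilinearMap ℂ (fun _ : Fin (2 * d) => SuperMod 𝒱) Grass) :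
    MixedMultilinear 𝒱 d :=
  ∑ c, (frontMul hd (f c)).compMultilinearMap (b.tcoord c)

lemma HomBasis.extend_apply (hd : 0 < 2 * d)
    (f : (Fin d → ι × ι) → MultilinearMap ℂ (fun _ : Fin (2 * d) => SuperMod 𝒱) Grass)
    (A : Fin d → EndL 𝒱) : b.extend hd f A = ∑ c, frontMul hd (f c) (b.tcoord c A) := by
  simp [extend]

lemma HomBasis.tailPar_eq (c : Fin d → ι × ι) (i : Fin d) (hi : i.1 + 1 < d) :
    b.tailPar c i = b.tailPar c ⟨i.1 + 1, hi⟩ + b.epar (c ⟨i.1 + 1, hi⟩) := by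
  rw [tailPar, tailPar, add_comm]
  have : Finset.Ioi i = insert ⟨i.1 + 1, hi⟩ (Finset.Ioi ⟨i.1 + 1, hi⟩) := by
    ext k
    simp only [Finset.mem_Ioi, Finset.mem_insert, Fin.lt_def, Fin.ext_iff]
    omega
  rw [this, Finset.sum_insert (by simp)]

lemma HomBasis.tailPar_last (c : Fin d → ι × ι) (i : Fin d) (hi : i.1 + 1 = d) :
    b.tailPar c i = 0 := by
  rw [tailPar]
  convert Finset.sum_empty
  ext k
  simp only [Finset.mem_Ioi, Fin.lt_def, Finset.notMem_empty, iff_false]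
  omega

/-- A coordinate moved to the far right passes the elementary endomorphisms behind its position, and
`tailPar` records the resulting twist. With it the product of coordinates is balanced; behind the
last position the twist is trivial. -/
lemma HomBasis.extend_mem (hd : 0 < 2 * d)
    {f : (Fin d → ι × ι) → MultilinearMap ℂ (fun _ : Fin (2 * d) => SuperMod 𝒱) Grass}
    (hf : ∀ c, f c ∈ tensorDual 𝒱 (2 * d)) : b.extend hd f ∈ mixedDual 𝒱 d := by
  have hu : ∀ (c : Fin d → ι × ι) (A : Fin d → EndL 𝒱) (i : Fin d) (X : EndL 𝒱),
      (fun j => invPow (b.tailPar c j) (b.ecoord (c j) (Function.update A i X j))) =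
        Function.update (fun j => invPow (b.tailPar c j) (b.ecoord (c j) (A j))) i
          (invPow (b.tailPar c i) (b.ecoord (c i) X)) := fun c A i X => by
    ext j
    exact Function.apply_update (fun j Y => invPow (b.tailPar c j) (b.ecoord (c j) Y)) A i X j
  refine ⟨fun A => ?_, fun A i hi a => ?_, fun A i hi h0 a v => ?_⟩
  · rw [extend_apply]
    exact Submodule.sum_mem _ fun c _ => frontMul_mem hd (hf c) _
  · rw [extend_apply, extend_apply]
    refine Finset.sum_congr rfl fun c _ => ?_
    congr 1
    rw [tcoord_apply, tcoord_apply, hu, hu, endRightMul_eq, smul_eq_leftEnd_mul, ecoord_mul_leftEnd,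
      ecoord_leftEnd_mul, map_mul, map_mul, ← invPow_add, ← b.tailPar_eq c i hi]
    exact prod_ofFn_update_move _ i hi _
  · rw [extend_apply, extend_apply, sum_apply, sum_apply]
    refine Finset.sum_congr rfl fun c _ => ?_
    rw [← frontMul_mul, tcoord_apply, tcoord_apply, hu, endRightMul_eq, ecoord_mul_leftEnd, map_mul,
      show invPow (b.tailPar c i) a = a by rw [b.tailPar_last c i hi, invPow_zero],
      prod_ofFn_update_last _ i hi]

lemma HomBasis.tcoord_elem (c c' : Fin d → ι × ι) :
    b.tcoord c (fun i => b.elem (c' i)) = if c = c' then 1 else 0 := by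
  rw [tcoord_apply]
  split_ifs with h
  · subst h
    simp [ecoord_elem]
  · obtain ⟨i, hi⟩ := Function.ne_iff.1 h
    refine List.prod_eq_zero ?_
    rw [List.mem_ofFn]
    exact ⟨i, by simp [ecoord_elem, hi]⟩

lemma HomBasis.extend_elem (hd : 0 < 2 * d)
    (f : (Fin d → ι × ι) → MultilinearMap ℂ (fun _ : Fin (2 * d) => SuperMod 𝒱) Grass)
    (c : Fin d → ι × ι) : b.extend hd f (fun i => b.elem (c i)) = f c := by
  rw [extend_apply, Finset.sum_eq_single c]
  · rw [tcoord_elem, if_pos rfl]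
    ext v
    rw [frontMul_apply, one_smul, Function.update_eq_self]
  · intro c' _ hc'
    rw [tcoord_elem, if_neg hc', map_zero]
  · simp

lemma HomBasis.eq_extend (hd : 0 < 2 * d) {K : MixedMultilinear 𝒱 d} (hK : K ∈ mixedDual 𝒱 d) :
    K = b.extend hd fun c => K fun i => b.elem (c i) := by
  rw [← sub_eq_zero]
  have h : K - b.extend hd (fun c => K fun i => b.elem (c i)) ∈ mixedDual 𝒱 d :=
    mixedDual_sub hK (b.extend_mem hd fun c => hK.1 _)
  refine mixedDual_eq_zero b h fun c => ?_
  rw [sub_apply, extend_elem, sub_self]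

end MixedDual

end OrthoSymp

end

open scoped TensorProduct MulOpposite

noncomputable section

set_option linter.unusedSectionVars false
set_option linter.unusedVariables false

namespace OrthoSymp

/-! ### Signs of permutations of homogeneous factors. -/

section Koszul

lemma swap_lt_swap_iff {d : ℕ} (i : Fin d) (hi : i.1 + 1 < d) {x y : Fin d}
    (h1 : ¬ (x = i ∧ y = ⟨i.1 + 1, hi⟩)) (h2 : ¬ (x = ⟨i.1 + 1, hi⟩ ∧ y = i)) :
    Equiv.swap i ⟨i.1 + 1, hi⟩ x < Equiv.swap i ⟨i.1 + 1, hi⟩ y ↔ x < y := by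
  simp only [Fin.ext_iff] at h1 h2
  have hs : ∀ z : Fin d, (Equiv.swap i ⟨i.1 + 1, hi⟩ z).1 =
      if z.1 = i.1 then i.1 + 1 else if z.1 = i.1 + 1 then i.1 else z.1 := by
    intro z
    rw [Equiv.swap_apply_def]
    simp only [Fin.ext_iff]
    split_ifs <;> rfl
  rw [Fin.lt_def, Fin.lt_def, hs, hs]
  split_ifs <;> omega

/-- The sign by which the permutation `σ` acts on a product of homogeneous elements of
parities `p`. -/
def koszulSign {d : ℕ} (σ : Equiv.Perm (Fin d)) (p : Fin d → ZMod 2) : ℂ :=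
  ∏ x : Fin d × Fin d, if x.1 < x.2 ∧ σ⁻¹ x.2 < σ⁻¹ x.1 then superSign (p x.1) (p x.2) else 1

lemma koszulSign_one {d : ℕ} (p : Fin d → ZMod 2) : koszulSign 1 p = 1 := by
  refine Finset.prod_eq_one fun x _ => if_neg ?_
  rintro ⟨h1, h2⟩
  exact lt_asymm h1 (by simpa using h2)

/-- After reindexing by the transposition, only the pair of swapped positions can change between
inversion and non-inversion. A direction in which the inversion disappears gives the same factor,
because the sign squares to 1. -/
lemma koszulSign_swap_mul {d : ℕ} (i : Fin d) (hi : i.1 + 1 < d) (τ : Equiv.Perm (Fin d))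
    (p : Fin d → ZMod 2) :
    koszulSign (Equiv.swap i ⟨i.1 + 1, hi⟩ * τ) p =
      superSign (p i) (p ⟨i.1 + 1, hi⟩) *
        koszulSign τ (fun k => p (Equiv.swap i ⟨i.1 + 1, hi⟩ k)) := by
  set j : Fin d := ⟨i.1 + 1, hi⟩ with hj
  have hij : i < j := Fin.lt_def.2 (Nat.lt_succ_self _)
  set s := Equiv.swap i j with hs
  have hss : ∀ x, s (s x) = x := Equiv.swap_apply_self i j
  have e1 : koszulSign (s * τ) p = ∏ y : Fin d × Fin d,
      if s y.1 < s y.2 ∧ τ⁻¹ y.2 < τ⁻¹ y.1 then superSign (p (s y.1)) (p (s y.2)) else 1 := by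
    rw [koszulSign]
    refine Fintype.prod_equiv (Equiv.prodCongr s s) _ _ fun x => ?_
    simp only [Equiv.prodCongr_apply, Prod.map_fst, Prod.map_snd, mul_inv_rev,
      Equiv.Perm.mul_apply, hs, Equiv.swap_inv, Equiv.swap_apply_self]
  have hne : ((i, j) : Fin d × Fin d) ≠ (j, i) := fun h => hij.ne (Prod.ext_iff.1 h).1
  rw [e1, koszulSign, ← Finset.prod_mul_prod_compl {(i, j), (j, i)}]
  conv_rhs => rw [← Finset.prod_mul_prod_compl {(i, j), (j, i)}]
  rw [Finset.prod_pair hne, Finset.prod_pair hne, ← mul_assoc]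
  congr 1
  · have si : s i = j := Equiv.swap_apply_left i j
    have sj : s j = i := Equiv.swap_apply_right i j
    simp only [si, sj, hij, not_lt_of_gt hij, false_and, true_and, if_false, one_mul, mul_one]
    rcases lt_trichotomy (τ⁻¹ i) (τ⁻¹ j) with h | h | h
    · rw [if_pos h, if_neg (not_lt_of_gt h), mul_one]
    · exact absurd (τ⁻¹.injective h) hij.ne
    · rw [if_neg (not_lt_of_gt h), if_pos h, superSign_comm (p j), superSign_mul_self]
  · refine Finset.prod_congr rfl fun y hy => ?_
    simp only [Finset.mem_compl, Finset.mem_insert, Finset.mem_singleton, not_or, Prod.ext_iff] at hy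
    simp only [hs, hj, swap_lt_swap_iff i hi hy.1 hy.2]

lemma prod_ofFn_of_adjacent {d : ℕ} {x y : Fin d → Grass} (i : Fin d) (hi : i.1 + 1 < d) (t : ℂ)
    (h : ∀ k, k ≠ i → k ≠ ⟨i.1 + 1, hi⟩ → y k = x k)
    (hxy : y i * y ⟨i.1 + 1, hi⟩ = t • (x i * x ⟨i.1 + 1, hi⟩)) :
    (List.ofFn y).prod = t • (List.ofFn x).prod := by
  induction d with
  | zero => exact i.elim0
  | succ d ih =>
    rw [List.ofFn_succ, List.ofFn_succ, List.prod_cons, List.prod_cons]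
    revert hi h hxy
    refine Fin.cases (fun hi h hxy => ?_) (fun i hi h hxy => ?_) i
    · obtain ⟨d, rfl⟩ : ∃ e, d = e + 1 := ⟨d - 1, by simp at hi; omega⟩
      have e1 : (⟨(0 : Fin (d + 1 + 1)).1 + 1, hi⟩ : Fin (d + 1 + 1)) = Fin.succ 0 := rfl
      rw [e1] at hxy
      rw [List.ofFn_succ, List.ofFn_succ, List.prod_cons, List.prod_cons, ← mul_assoc, hxy,
        ← mul_assoc, smul_mul_assoc]
      have e3 : ∀ j : Fin d, y j.succ.succ = x j.succ.succ := fun j =>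
        h _ (Fin.succ_ne_zero _) (fun h => Fin.succ_ne_zero _ (Fin.succ_injective _ h))
      simp only [e3]
    · have hi' : i.1 + 1 < d := by simpa using hi
      rw [ih (x := fun j => x j.succ) (y := fun j => y j.succ) i hi'
        (fun k h1 h2 => h _ (fun h => h1 (Fin.succ_injective _ h))
          (fun h => h2 (Fin.succ_injective _ h))) hxy,
        h 0 (Fin.succ_ne_zero _).symm (fun h => Fin.succ_ne_zero ⟨i.1 + 1, hi'⟩ h.symm),
        mul_smul_comm]

end Koszul

/-! ### Supersymmetrisation of the endomorphism slots. -/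

section Symmetrise

variable {E : Type*} [AddCommGroup E] [Module ℂ E] {𝒱 : ZMod 2 → Submodule ℂ E}
  [DirectSum.Decomposition 𝒱] {d : ℕ}

lemma tensorDual_complex_smul {r : ℕ}
    {f : MultilinearMap ℂ (fun _ : Fin r => SuperMod 𝒱) Grass} (hf : f ∈ tensorDual 𝒱 r) (c : ℂ) :
    c • f ∈ tensorDual 𝒱 r := by
  have e : c • f = (algebraMap ℂ Grass c) • f := by
    ext v
    change c • f v = algebraMap ℂ Grass c * f v
    rw [Algebra.smul_def]
  rw [e]
  exact Submodule.smul_mem _ _ hf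

lemma mixedDual_complex_smul {K : MixedMultilinear 𝒱 d} (hK : K ∈ mixedDual 𝒱 d) (c : ℂ) :
    c • K ∈ mixedDual 𝒱 d := by
  have e : c • K = (algebraMap ℂ Grass c) • K := by
    ext A v
    change c • K A v = algebraMap ℂ Grass c * K A v
    rw [Algebra.smul_def]
  rw [e]
  exact Submodule.smul_mem _ _ hK

variable {ι : Type*} [Fintype ι] [DecidableEq ι] (b : HomBasis 𝒱 ι)

lemma HomBasis.tailPar_swap (c : Fin d → ι × ι) (i : Fin d) (hi : i.1 + 1 < d) (k : Fin d)
    (hk : k ≠ i) :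
    b.tailPar (fun l => c (Equiv.swap i ⟨i.1 + 1, hi⟩ l)) k = b.tailPar c k := by
  rw [tailPar, tailPar]
  refine Finset.sum_equiv (Equiv.swap i ⟨i.1 + 1, hi⟩) (fun l => ?_) fun l _ => rfl
  rw [Finset.mem_Ioi, Finset.mem_Ioi, Equiv.swap_apply_def]
  have hk' : k.1 ≠ i.1 := fun h => hk (Fin.ext h)
  split_ifs with h1 h2
  · subst h1; simp only [Fin.lt_def]; omega
  · subst h2; simp only [Fin.lt_def]; omega
  · rfl

/-- The exchanged coordinates have parities e + p and e' + q, and the twist of each depends on what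
stands behind it. The sign of the exchange and the changes of the twists combine modulo 2 to ee' +
pq. -/
lemma HomBasis.tcoord_swap (c : Fin d → ι × ι) (A : Fin d → EndL 𝒱) (i : Fin d)
    (hi : i.1 + 1 < d) {p q : ZMod 2} (hp : HasParity 𝒱 p (A i))
    (hq : HasParity 𝒱 q (A ⟨i.1 + 1, hi⟩)) :
    b.tcoord (fun l => c (Equiv.swap i ⟨i.1 + 1, hi⟩ l)) (A ∘ Equiv.swap i ⟨i.1 + 1, hi⟩) =
      (superSign (b.epar (c i)) (b.epar (c ⟨i.1 + 1, hi⟩)) * superSign p q) • b.tcoord c A := by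
  rw [tcoord_apply, tcoord_apply]
  set j : Fin d := ⟨i.1 + 1, hi⟩ with hj
  have hij : i ≠ j := (Fin.lt_def.2 (Nat.lt_succ_self i.1) : i < j).ne
  set e := b.epar (c i) with he
  set e' := b.epar (c j) with he'
  have hxi : b.ecoord (c i) (A i) ∈ grassParity (e + p) := b.ecoord_mem _ hp
  have hxj : b.ecoord (c j) (A j) ∈ grassParity (e' + q) := b.ecoord_mem _ hq
  refine prod_ofFn_of_adjacent i hi _ (fun k h1 h2 => ?_) ?_
  · rw [b.tailPar_swap c i hi k h1, Function.comp_apply, Equiv.swap_apply_of_ne_of_ne h1 h2]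
  · have t1 := b.tailPar_eq (fun l => c (Equiv.swap i j l)) i hi
    have t2 := b.tailPar_eq c i hi
    rw [← hj] at t1 t2 ⊢
    rw [t1, t2, b.tailPar_swap c i hi j hij.symm]
    simp only [Function.comp_apply, Equiv.swap_apply_left, Equiv.swap_apply_right]
    rw [invPow_of_mem _ hxi, invPow_of_mem _ hxj, invPow_of_mem _ hxi, invPow_of_mem _ hxj]
    simp only [smul_mul_assoc, mul_smul_comm, smul_smul]
    rw [mul_comm_of_mem hxj hxi, smul_smul]
    congr 1
    simp only [← he, ← he', superSign_eq, ← paritySign_add]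
    congr 1
    -- The exponents agree up to a doubled term, which vanishes modulo 2.
    have h2 : ∀ x : ZMod 2, x + x = 0 := CharTwo.add_self_eq_zero
    ring_nf
    linear_combination h2 (q * e)

/-- How forms behave under an adjacent swap can be tested on elementary endomorphisms: the sign
there and the sign in `tcoord_swap` cancel except for the parities of the actual arguments. -/
lemma mixedDual_swap (hd : 0 < 2 * d) {K K' : MixedMultilinear 𝒱 d} (hK : K ∈ mixedDual 𝒱 d)
    (hK' : K' ∈ mixedDual 𝒱 d) (i : Fin d) (hi : i.1 + 1 < d)
    (h : ∀ c : Fin d → ι × ι, K' (fun l => b.elem (c l)) =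
      superSign (b.epar (c i)) (b.epar (c ⟨i.1 + 1, hi⟩)) •
        K (fun l => b.elem (c (Equiv.swap i ⟨i.1 + 1, hi⟩ l))))
    {A : Fin d → EndL 𝒱} {p q : ZMod 2} (hp : HasParity 𝒱 p (A i))
    (hq : HasParity 𝒱 q (A ⟨i.1 + 1, hi⟩)) :
    K' A = superSign p q • K (A ∘ Equiv.swap i ⟨i.1 + 1, hi⟩) := by
  rw [b.eq_extend hd hK', b.eq_extend hd hK, b.extend_apply, b.extend_apply, Finset.smul_sum]
  refine Fintype.sum_equiv (Equiv.arrowCongr (Equiv.swap i ⟨i.1 + 1, hi⟩) (Equiv.refl _)) _ _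
    fun c => ?_
  have e : (Equiv.arrowCongr (Equiv.swap i ⟨i.1 + 1, hi⟩) (Equiv.refl (ι × ι))) c =
      fun l => c (Equiv.swap i ⟨i.1 + 1, hi⟩ l) := by
    ext l <;> simp [Equiv.arrowCongr]
  rw [e, h c, b.tcoord_swap c A i hi hp hq, map_smul, smul_smul]
  ext v
  simp only [frontMul_apply, smul_apply]
  congr 1
  linear_combination (-superSign (b.epar (c i)) (b.epar (c ⟨i.1 + 1, hi⟩))) * superSign_mul_self p q

/-- The form obtained from `K` by a supersymmetric permutation of its `d` endomorphisms. -/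
def HomBasis.permute (hd : 0 < 2 * d) (K : MixedMultilinear 𝒱 d) (σ : Equiv.Perm (Fin d)) :
    MixedMultilinear 𝒱 d :=
  b.extend hd fun c => koszulSign σ (fun l => b.epar (c l)) • K fun l => b.elem (c (σ l))

lemma HomBasis.permute_mem (hd : 0 < 2 * d) {K : MixedMultilinear 𝒱 d} (hK : K ∈ mixedDual 𝒱 d)
    (σ : Equiv.Perm (Fin d)) : b.permute hd K σ ∈ mixedDual 𝒱 d :=
  b.extend_mem hd fun c => tensorDual_complex_smul (hK.1 _) _

lemma HomBasis.permute_elem_swap (hd : 0 < 2 * d) (K : MixedMultilinear 𝒱 d)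
    (τ : Equiv.Perm (Fin d)) (i : Fin d) (hi : i.1 + 1 < d) (c : Fin d → ι × ι) :
    b.permute hd K (Equiv.swap i ⟨i.1 + 1, hi⟩ * τ) (fun l => b.elem (c l)) =
      superSign (b.epar (c i)) (b.epar (c ⟨i.1 + 1, hi⟩)) •
        b.permute hd K τ (fun l => b.elem (c (Equiv.swap i ⟨i.1 + 1, hi⟩ l))) := by
  rw [permute, permute, extend_elem,
    b.extend_elem hd _ (fun l => c (Equiv.swap i ⟨i.1 + 1, hi⟩ l)), koszulSign_swap_mul, smul_smul]
  rfl

/-- Adjacent transpositions generate the permutations, and each of them exchanges two copies of the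
same even endomorphism, without sign. -/
lemma HomBasis.permute_diag (hd : 0 < 2 * d) {K : MixedMultilinear 𝒱 d} (hK : K ∈ mixedDual 𝒱 d)
    {A : EndL 𝒱} (hA : HasParity 𝒱 0 A) (σ : Equiv.Perm (Fin d)) :
    b.permute hd K σ (fun _ => A) = K fun _ => A := by
  obtain ⟨n, rfl⟩ : ∃ n, d = n + 1 := ⟨d - 1, by omega⟩
  have hσ : σ ∈ Submonoid.closure
      (Set.range fun i : Fin n => Equiv.swap i.castSucc i.succ) := by
    rw [Equiv.Perm.mclosure_swap_castSucc_succ]; trivial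
  induction hσ using Submonoid.closure_induction_left with
  | one =>
    have : b.permute hd K 1 = K := by
      conv_rhs => rw [b.eq_extend hd hK]
      rw [permute]
      congr 1
      ext1 c
      rw [koszulSign_one, one_smul]
      rfl
    rw [this]
  | mul_left x hx τ _ ih =>
    obtain ⟨i, rfl⟩ := hx
    have hi : i.castSucc.1 + 1 < n + 1 := by simp
    have e : i.succ = ⟨i.castSucc.1 + 1, hi⟩ := Fin.ext (by simp)
    simp only [e]
    rw [mixedDual_swap b hd (b.permute_mem hd hK τ) (b.permute_mem hd hK _) i.castSucc hi
      (fun c => b.permute_elem_swap hd K τ _ hi c) (A := fun _ => A) hA hA, superSign_zero_left,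
      one_smul]
    exact ih

/-- Average the signed permutations of `K`. An adjacent swap permutes the summands, and equal even
arguments do not notice the averaging. -/
lemma exists_supersymmetric [FiniteDimensional ℂ E] (hd : 0 < 2 * d) {K : MixedMultilinear 𝒱 d}
    (hK : K ∈ mixedDual 𝒱 d) :
    ∃ H ∈ mixedDual 𝒱 d, IsSupersymmetric 𝒱 H ∧
      ∀ A, HasParity 𝒱 0 A → H (fun _ => A) = K fun _ => A := by
  obtain ⟨n, ⟨b⟩⟩ := exists_homBasis 𝒱
  have hS : ∑ σ, b.permute hd K σ ∈ mixedDual 𝒱 d :=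
    Submodule.sum_mem _ fun σ _ => b.permute_mem hd hK σ
  have hH : ((d.factorial : ℂ)⁻¹ • ∑ σ, b.permute hd K σ) ∈ mixedDual 𝒱 d :=
    mixedDual_complex_smul hS _
  refine ⟨_, hH, fun i hi p q A hp hq => ?_, fun A hA => ?_⟩
  · have hsw := mixedDual_swap b hd hS hS i hi (fun c => ?_) hp hq
    · rw [smul_apply, smul_apply, hsw, smul_comm (superSign p q), smul_smul (superSign p q),
        superSign_mul_self, one_smul]
    · rw [sum_apply, sum_apply, Finset.smul_sum]
      refine (Fintype.sum_equiv (Equiv.mulLeft (Equiv.swap i ⟨i.1 + 1, hi⟩)) _ _ fun τ => ?_).symm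
      rw [Equiv.coe_mulLeft, b.permute_elem_swap]
  · rw [smul_apply, sum_apply]
    simp only [b.permute_diag hd hK hA]
    rw [Finset.sum_const, Finset.card_univ, Fintype.card_perm, Fintype.card_fin,
      ← Nat.cast_smul_eq_nsmul ℂ, smul_smul,
      inv_mul_cancel₀ (by exact_mod_cast d.factorial_ne_zero), one_smul]

end Symmetrise

end OrthoSymp

end

open scoped TensorProduct MulOpposite

noncomputable section

set_option linter.unusedSectionVars false
set_option linter.unusedVariables false

namespace OrthoSymp

/-! ### Forms in which powers of endomorphisms act on the arguments of L. -/

section Words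

variable {E : Type*} [AddCommGroup E] [Module ℂ E] (𝒱 : ZMod 2 → Submodule ℂ E)
  [DirectSum.Decomposition 𝒱]

/-- The `p`-th power of the parity involution. -/
def parityPow (p : ZMod 2) : SuperMod 𝒱 →ₗ[ℂ] SuperMod 𝒱 :=
  if p = 0 then LinearMap.id else parityInv 𝒱

@[simp] lemma parityPow_zero (v : SuperMod 𝒱) : parityPow 𝒱 0 v = v := by simp [parityPow]

@[simp] lemma parityPow_one (v : SuperMod 𝒱) : parityPow 𝒱 1 v = parityInv 𝒱 v := by
  simp [parityPow]

lemma parityPow_add (p q : ZMod 2) (v : SuperMod 𝒱) :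
    parityPow 𝒱 (p + q) v = parityPow 𝒱 p (parityPow 𝒱 q v) := by
  rcases zmod_two_cases p with rfl | rfl <;> rcases zmod_two_cases q with rfl | rfl <;>
    simp [show (1 : ZMod 2) + 1 = 0 from rfl]

lemma parityPow_op_smul (p : ZMod 2) (a : Grass) (v : SuperMod 𝒱) :
    parityPow 𝒱 p (MulOpposite.op a • v) = MulOpposite.op (invPow p a) • parityPow 𝒱 p v := by
  rcases zmod_two_cases p with rfl | rfl <;> simp [parityInv_op_smul]

lemma parityPow_smul (p : ZMod 2) (a : Grass) (v : SuperMod 𝒱) :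
    parityPow 𝒱 p (a • v) = invPow p a • parityPow 𝒱 p v := by
  rcases zmod_two_cases p with rfl | rfl <;> simp [parityInv_smul]

variable {𝒱}

lemma smul_eq_op_smul {k : ZMod 2} {a : Grass} (ha : a ∈ grassParity k) (v : SuperMod 𝒱) :
    a • v = MulOpposite.op a • parityPow 𝒱 k v := by
  rcases zmod_two_cases k with rfl | rfl
  · rw [parityPow_zero, even_smul 𝒱 ha]
  · rw [parityPow_one, odd_smul 𝒱 ha]

variable {r : ℕ}

/-- The maps acting on the arguments of a form when an endomorphism `A` of parity `p` is moved
from the front to the `j`-th argument. -/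
def slotMap (j : Fin r) (p : ZMod 2) (A : EndL 𝒱) (i : Fin r) : SuperMod 𝒱 →ₗ[ℂ] SuperMod 𝒱 :=
  if i < j then parityPow 𝒱 p else if i = j then A.restrictScalars ℂ else LinearMap.id

/-- The involution applied to the first `j` vectors. -/
def headInv (j : Fin r) (p : ZMod 2) (v : Fin r → SuperMod 𝒱) (i : Fin r) : SuperMod 𝒱 :=
  if i < j then parityPow 𝒱 p (v i) else v i

lemma slotMap_apply (j : Fin r) (p : ZMod 2) (A : EndL 𝒱) (v : Fin r → SuperMod 𝒱) :
    (fun i => slotMap j p A i (v i)) = Function.update (headInv j p v) j (A (v j)) := by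
  ext i
  rw [slotMap]
  rcases lt_trichotomy i j with h | h | h
  · rw [if_pos h, Function.update_of_ne h.ne, headInv, if_pos h]
  · subst h; rw [if_neg (lt_irrefl _), if_pos rfl, Function.update_self]; rfl
  · rw [if_neg (not_lt_of_gt h), if_neg h.ne', Function.update_of_ne h.ne', headInv,
      if_neg (not_lt_of_gt h)]; rfl

lemma headInv_zero (j : Fin r) (v : Fin r → SuperMod 𝒱) : headInv j 0 v = v := by
  ext i; simp [headInv]

lemma headInv_add (j : Fin r) (p q : ZMod 2) (v : Fin r → SuperMod 𝒱) :
    headInv j (p + q) v = headInv j p (headInv j q v) := by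
  ext i
  simp only [headInv]
  split_ifs
  · rw [parityPow_add]
  · rfl

lemma headInv_update (j : Fin r) (p : ZMod 2) (v : Fin r → SuperMod 𝒱) (x : SuperMod 𝒱) :
    headInv j p (Function.update v j x) = Function.update (headInv j p v) j x := by
  ext i
  rcases eq_or_ne i j with rfl | h
  · simp [headInv]
  · simp [headInv, h]

/-- The form `v ↦ f(v_1, …, A v_j, …)`, with the signs for an endomorphism `A` of parity `p`. -/
def slotOp (j : Fin r) (p : ZMod 2) : EndL 𝒱 →ₗ[ℂ]
    MultilinearMap ℂ (fun _ : Fin r => SuperMod 𝒱) Grass →ₗ[ℂ]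
      MultilinearMap ℂ (fun _ : Fin r => SuperMod 𝒱) Grass :=
  LinearMap.mk₂ ℂ (fun A f => f.compLinearMap (slotMap j p A))
    (fun A A' f => by
      ext v
      simp only [MultilinearMap.compLinearMap_apply, slotMap_apply, add_apply]
      rw [LinearMap.add_apply, MultilinearMap.map_update_add])
    (fun c A f => by
      ext v
      simp only [MultilinearMap.compLinearMap_apply, slotMap_apply, smul_apply]
      rw [LinearMap.smul_apply, MultilinearMap.map_update_smul])
    (fun A f g => rfl) (fun c A f => rfl)

lemma slotOp_apply (j : Fin r) (p : ZMod 2) (A : EndL 𝒱)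
    (f : MultilinearMap ℂ (fun _ : Fin r => SuperMod 𝒱) Grass) (v : Fin r → SuperMod 𝒱) :
    slotOp j p A f v = f (Function.update (headInv j p v) j (A (v j))) := by
  rw [← slotMap_apply]; rfl

lemma slotOp_mem (j : Fin r) {p : ZMod 2} {A : EndL 𝒱} (hA : HasParity 𝒱 p A)
    {f : MultilinearMap ℂ (fun _ : Fin r => SuperMod 𝒱) Grass} (hf : f ∈ tensorDual 𝒱 r) :
    slotOp j p A f ∈ tensorDual 𝒱 r := by
  refine comp_mem_tensorDual hf _ (fun i a => if i ≤ j.1 then invPow p a else a)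
    (fun i hi a v => ?_) (fun i hi a v => ?_) (fun i hi a v => ?_)
  · rcases lt_trichotomy i j with h | h | h
    · rw [slotMap, if_pos h, if_pos (by exact h), parityPow_op_smul]
    · subst h
      rw [slotMap, if_neg (lt_irrefl _), if_pos rfl, if_neg (by omega)]
      exact map_smul A _ _
    · rw [slotMap, if_neg (not_lt_of_gt h), if_neg h.ne', if_neg (by rw [Fin.lt_def] at h; omega)]
      rfl
  · rcases lt_trichotomy i j with h | h | h
    · rw [slotMap, if_pos h, if_pos (by rw [Fin.lt_def] at h; omega), parityPow_smul]
    · subst h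
      rw [slotMap, if_neg (lt_irrefl _), if_pos rfl, if_pos le_rfl]
      exact hA.map_smul 𝒱 a v
    · rw [slotMap, if_neg (not_lt_of_gt h), if_neg h.ne', if_neg (by rw [Fin.lt_def] at h; omega)]
      rfl
  · have h : ¬ i < j := by rw [Fin.lt_def]; omega
    rw [slotMap, if_neg h]
    split_ifs with h'
    · exact map_smul A _ _
    · rfl

/-- On its way from the front to argument `j` the scalar passes the vectors before `j`, and each of
them receives the parity involution to the power of its parity. -/
lemma tensorDual_move_front (h0 : 0 < r)
    {f : MultilinearMap ℂ (fun _ : Fin r => SuperMod 𝒱) Grass} (hf : f ∈ tensorDual 𝒱 r)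
    {k : ZMod 2} {a : Grass} (ha : a ∈ grassParity k) (v : Fin r → SuperMod 𝒱) (j : Fin r) :
    f (Function.update v ⟨0, h0⟩ (a • v ⟨0, h0⟩)) =
      f (Function.update (headInv j k v) j (a • v j)) := by
  obtain ⟨j, hj⟩ := j
  induction j with
  | zero =>
    congr 2
  | succ j ih =>
    have hj' : j < r := by omega
    rw [ih hj', smul_eq_op_smul ha]
    have e1 := hf.1 (Function.update (headInv ⟨j, hj'⟩ k v) ⟨j, hj'⟩ (parityPow 𝒱 k (v ⟨j, hj'⟩)))
      ⟨j, hj'⟩ hj a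
    rw [Function.update_self, Function.update_idem] at e1
    rw [e1]
    have e2 : Function.update (headInv ⟨j, hj'⟩ k v) ⟨j, hj'⟩ (parityPow 𝒱 k (v ⟨j, hj'⟩)) =
        headInv ⟨j + 1, hj⟩ k v := by
      ext i
      rcases eq_or_ne i ⟨j, hj'⟩ with rfl | h
      · simp [headInv, Fin.lt_def]
      · have h' : i.1 ≠ j := fun e => h (Fin.ext e)
        rw [Function.update_of_ne h]
        simp only [headInv, Fin.lt_def]
        have : i.1 < j ↔ i.1 < j + 1 := by omega
        simp only [this]
    rw [e2]
    simp [headInv]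

/-- Parities add in `A * leftEnd 𝒱 a`, so the involutions on the first vectors split into those for
`A` and those that carry `a` from the front to argument `j`. -/
lemma slotOp_mul_leftEnd (h0 : 0 < r) (j : Fin r) {p k : ZMod 2} {A : EndL 𝒱}
    (hA : HasParity 𝒱 p A) {a : Grass} (ha : a ∈ grassParity k)
    {f : MultilinearMap ℂ (fun _ : Fin r => SuperMod 𝒱) Grass} (hf : f ∈ tensorDual 𝒱 r) :
    slotOp j (p + k) (A * leftEnd 𝒱 a) f = frontMul h0 (slotOp j p A f) a := by
  ext v
  rw [frontMul_apply, tensorDual_move_front h0 (slotOp_mem j hA hf) ha v j, slotOp_apply,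
    slotOp_apply, headInv_update, Function.update_idem, Function.update_self, headInv_add]
  rfl

lemma slotOp_leftEnd_mul (h0 : 0 < r) (j : Fin r) {p k : ZMod 2} {A : EndL 𝒱}
    (hA : HasParity 𝒱 p A) {a : Grass} (ha : a ∈ grassParity k)
    {f : MultilinearMap ℂ (fun _ : Fin r => SuperMod 𝒱) Grass} (hf : f ∈ tensorDual 𝒱 r) :
    slotOp j (k + p) (leftEnd 𝒱 a * A) f = slotOp j p A (frontMul h0 f a) := by
  ext v
  rw [slotOp_apply, slotOp_apply, frontMul_apply, tensorDual_move_front h0 hf ha _ j,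
    headInv_update, Function.update_idem, Function.update_self, headInv_add]
  rfl

instance : IsScalarTower ℂ Grass (MultilinearMap ℂ (fun _ : Fin r => SuperMod 𝒱) Grass) where
  smul_assoc c a f := by
    ext v
    exact smul_assoc c a (f v)

variable (𝒱 r) in
/-- The complex vector space underlying `T^r(V)^*`. -/
abbrev tensorDualC : Submodule ℂ (MultilinearMap ℂ (fun _ : Fin r => SuperMod 𝒱) Grass) :=
  (tensorDual 𝒱 r).restrictScalars ℂ

/-- The action of an endomorphism on the `j`-th argument of a form. -/
def slotEnd (j : Fin r) : EndL 𝒱 →ₗ[ℂ] Module.End ℂ (tensorDualC 𝒱 r) where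
  toFun A := (slotOp j 0 (parityPart 𝒱 0 A) + slotOp j 1 (parityPart 𝒱 1 A)).restrict fun f hf =>
    Submodule.add_mem _ (slotOp_mem j (parityPart_hasParity 𝒱 0 A) hf)
      (slotOp_mem j (parityPart_hasParity 𝒱 1 A) hf)
  map_add' A A' := by
    ext1 f
    refine Subtype.ext ?_
    change (slotOp j 0 (parityPart 𝒱 0 (A + A')) + slotOp j 1 (parityPart 𝒱 1 (A + A'))) f.1 =
      (slotOp j 0 (parityPart 𝒱 0 A) + slotOp j 1 (parityPart 𝒱 1 A)) f.1 +
      (slotOp j 0 (parityPart 𝒱 0 A') + slotOp j 1 (parityPart 𝒱 1 A')) f.1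
    simp only [map_add, LinearMap.add_apply]
    abel
  map_smul' c A := by
    ext1 f
    refine Subtype.ext ?_
    change (slotOp j 0 (parityPart 𝒱 0 (c • A)) + slotOp j 1 (parityPart 𝒱 1 (c • A))) f.1 =
      c • (slotOp j 0 (parityPart 𝒱 0 A) + slotOp j 1 (parityPart 𝒱 1 A)) f.1
    simp only [map_smul, LinearMap.add_apply, LinearMap.smul_apply, smul_add]

lemma slotEnd_apply (j : Fin r) (A : EndL 𝒱) (f : tensorDualC 𝒱 r) :
    (slotEnd j A f).1 = slotOp j 0 (parityPart 𝒱 0 A) f.1 + slotOp j 1 (parityPart 𝒱 1 A) f.1 :=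
  rfl

lemma slotEnd_of_hasParity (j : Fin r) {p : ZMod 2} {A : EndL 𝒱} (hA : HasParity 𝒱 p A)
    (f : tensorDualC 𝒱 r) : (slotEnd j A f).1 = slotOp j p A f.1 := by
  rw [slotEnd_apply, parityPart_of_hasParity 𝒱 hA, parityPart_of_hasParity 𝒱 hA]
  rcases zmod_two_cases p with rfl | rfl
  · rw [if_pos rfl, if_neg zero_ne_one, map_zero, LinearMap.zero_apply, add_zero]
  · rw [if_pos rfl, if_neg one_ne_zero, map_zero, LinearMap.zero_apply, zero_add]

/-- The action of a scalar on the first argument of a form. -/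
def frontEnd (h0 : 0 < r) (a : Grass) : Module.End ℂ (tensorDualC 𝒱 r) where
  toFun f := ⟨frontMul h0 f.1 a, frontMul_mem h0 f.2 a⟩
  map_add' f g := Subtype.ext (by ext v; simp [frontMul_apply])
  map_smul' c f := Subtype.ext (by ext v; simp [frontMul_apply])

lemma frontEnd_add (h0 : 0 < r) (a c : Grass) :
    frontEnd (𝒱 := 𝒱) h0 (a + c) = frontEnd h0 a + frontEnd h0 c := by
  ext1 f
  exact Subtype.ext (map_add (frontMul h0 f.1) a c)

lemma slotEnd_mul_leftEnd (h0 : 0 < r) (j : Fin r) (A : EndL 𝒱) (a : Grass) :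
    slotEnd j (A * leftEnd 𝒱 a) = frontEnd h0 a * slotEnd j A := by
  have key : ∀ p k, ∀ A : EndL 𝒱, HasParity 𝒱 p A → ∀ a ∈ grassParity k,
      slotEnd j (A * leftEnd 𝒱 a) = frontEnd h0 a * slotEnd j A := fun p k A hA a ha => by
    ext1 f
    refine Subtype.ext ?_
    rw [slotEnd_of_hasParity j (hA.mul 𝒱 (HasParity.leftEnd 𝒱 ha)),
      slotOp_mul_leftEnd h0 j hA ha f.2, ← slotEnd_of_hasParity j hA]
    rfl
  obtain ⟨b, hb, c, hc, rfl⟩ := exists_even_add_odd a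
  rw [← parityPart_add 𝒱 A]
  have h0' := parityPart_hasParity 𝒱 0 A
  have h1' := parityPart_hasParity 𝒱 1 A
  simp only [map_add, add_mul, mul_add, frontEnd_add, key _ _ _ h0' _ hb, key _ _ _ h0' _ hc,
    key _ _ _ h1' _ hb, key _ _ _ h1' _ hc]
  abel

lemma slotEnd_leftEnd_mul (h0 : 0 < r) (j : Fin r) (A : EndL 𝒱) (a : Grass) :
    slotEnd j (leftEnd 𝒱 a * A) = slotEnd j A * frontEnd h0 a := by
  have key : ∀ p k, ∀ A : EndL 𝒱, HasParity 𝒱 p A → ∀ a ∈ grassParity k,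
      slotEnd j (leftEnd 𝒱 a * A) = slotEnd j A * frontEnd h0 a := fun p k A hA a ha => by
    ext1 f
    refine Subtype.ext ?_
    rw [slotEnd_of_hasParity j ((HasParity.leftEnd 𝒱 ha).mul 𝒱 hA),
      slotOp_leftEnd_mul h0 j hA ha f.2]
    exact (slotEnd_of_hasParity j hA (frontEnd h0 a f)).symm
  obtain ⟨b, hb, c, hc, rfl⟩ := exists_even_add_odd a
  rw [← parityPart_add 𝒱 A]
  have h0' := parityPart_hasParity 𝒱 0 A
  have h1' := parityPart_hasParity 𝒱 1 A
  simp only [map_add, add_mul, mul_add, frontEnd_add, key _ _ _ h0' _ hb, key _ _ _ h0' _ hc,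
    key _ _ _ h1' _ hb, key _ _ _ h1' _ hc]
  abel

variable {d : ℕ}

/-- The form `A_1 ⊗ ⋯ ⊗ A_d ⊗ v ↦ L(A v)` in which `A_i` acts on the argument `w i` of `L`. -/
def wordForm (L : tensorDualC 𝒱 (2 * d)) (w : Fin d → Fin (2 * d)) : MixedMultilinear 𝒱 d :=
  (((tensorDualC 𝒱 (2 * d)).subtype ∘ₗ LinearMap.applyₗ L) ∘ₗ
    (MulOpposite.opLinearEquiv ℂ).symm.toLinearMap).compMultilinearMap
    ((MultilinearMap.mkPiAlgebraFin ℂ d (Module.End ℂ (tensorDualC 𝒱 (2 * d)))ᵐᵒᵖ).compLinearMap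
      fun i => (MulOpposite.opLinearEquiv ℂ).toLinearMap ∘ₗ slotEnd (w i))

lemma wordForm_apply (L : tensorDualC 𝒱 (2 * d)) (w : Fin d → Fin (2 * d)) (A : Fin d → EndL 𝒱) :
    wordForm L w A =
      ((List.ofFn fun i => MulOpposite.op (slotEnd (w i) (A i))).prod.unop L).1 := by
  simp [wordForm]

/-- Substitutions in a form compose in reverse order, hence the opposite algebra in `wordForm`.
There a scalar between two neighbouring endomorphisms is one and the same factor `frontEnd`,
whichever of the two it is attached to. -/
lemma wordForm_mem (hd : 0 < 2 * d) (L : tensorDualC 𝒱 (2 * d)) (w : Fin d → Fin (2 * d)) :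
    wordForm L w ∈ mixedDual 𝒱 d := by
  have hu : ∀ (A : Fin d → EndL 𝒱) (i : Fin d) (X : EndL 𝒱),
      (fun j => MulOpposite.op (slotEnd (w j) (Function.update A i X j))) =
        Function.update (fun j => MulOpposite.op (slotEnd (w j) (A j))) i
          (MulOpposite.op (slotEnd (w i) X)) := fun A i X => by
    ext1 j
    exact Function.apply_update (fun j X => MulOpposite.op (slotEnd (w j) X)) A i X j
  refine ⟨fun A => ?_, fun A i hi a => ?_, fun A i hi h0 a v => ?_⟩
  · rw [wordForm_apply]
    exact Subtype.property _
  · rw [wordForm_apply, wordForm_apply, hu, hu, endRightMul_eq, smul_eq_leftEnd_mul,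
      slotEnd_mul_leftEnd hd, slotEnd_leftEnd_mul hd, MulOpposite.op_mul, MulOpposite.op_mul,
      prod_ofFn_update_move (fun j => MulOpposite.op (slotEnd (w j) (A j))) i hi]
  · rw [wordForm_apply, wordForm_apply, hu, endRightMul_eq, slotEnd_mul_leftEnd hd,
      MulOpposite.op_mul,
      prod_ofFn_update_last (fun j => MulOpposite.op (slotEnd (w j) (A j))) i hi,
      MulOpposite.unop_mul, MulOpposite.unop_op]
    exact frontMul_apply hd _ a v

lemma slotEnd_prod_even {A : EndL 𝒱} (hA : HasParity 𝒱 0 A) (l : List (Fin r))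
    (L : tensorDualC 𝒱 r) (v : Fin r → SuperMod 𝒱) :
    ((l.map fun j => MulOpposite.op (slotEnd j A)).prod.unop L).1 v =
      L.1 fun j => (A ^ l.count j) (v j) := by
  induction l generalizing L with
  | nil => simp
  | cons k l ih =>
    rw [List.map_cons, List.prod_cons, MulOpposite.unop_mul, Module.End.mul_apply, ih,
      MulOpposite.unop_op, slotEnd_of_hasParity k hA, slotOp_apply, headInv_zero]
    congr 1
    ext j
    rcases eq_or_ne j k with rfl | h
    · rw [Function.update_self, List.count_cons_self, pow_succ', Module.End.mul_apply]
    · rw [Function.update_of_ne h, List.count_cons_of_ne h.symm]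

lemma ofFn_get_cast {M : Type*} (l : List M) {n : ℕ} (h : l.length = n) :
    (List.ofFn fun i : Fin n => l.get (i.cast h.symm)) = l := by
  subst h
  exact List.ofFn_get l

lemma exists_wordForm (hd : 0 < 2 * d) {L : MultilinearMap ℂ (fun _ : Fin (2 * d) => SuperMod 𝒱) Grass}
    (hL : L ∈ tensorDual 𝒱 (2 * d)) (κ : Fin (2 * d) → ℕ) (hκ : ∑ j, κ j = d) :
    ∃ W ∈ mixedDual 𝒱 d, ∀ A, HasParity 𝒱 0 A → ∀ v,
      W (fun _ => A) v = L fun j => (A ^ κ j) (v j) := by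
  -- A word of length `d` in which the letter `j` occurs `κ j` times; for one even endomorphism the
  -- order of the letters is immaterial.
  set l := (∑ j, Multiset.replicate (κ j) j).toList with hl
  have hlen : l.length = d := by
    rw [hl, Multiset.length_toList, Multiset.card_sum]
    simpa using hκ
  have hcount : ∀ j, l.count j = κ j := fun j => by
    rw [← Multiset.coe_count, hl, Multiset.coe_toList, Multiset.count_sum']
    simp [Multiset.count_replicate]
  refine ⟨wordForm ⟨L, hL⟩ fun i => l.get (i.cast hlen.symm), wordForm_mem hd _ _,
    fun A hA v => ?_⟩
  have e : (List.ofFn fun i : Fin d => MulOpposite.op (slotEnd (l.get (i.cast hlen.symm)) A)) =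
      l.map fun j => MulOpposite.op (slotEnd j A) := by
    conv_rhs => rw [← ofFn_get_cast l hlen]
    rw [List.map_ofFn]
    rfl
  rw [wordForm_apply, e, slotEnd_prod_even hA]
  simp only [hcount]

/-- The coefficients of the binomial series of `(1 + t)^{1/2}`. -/
def sqrtCoeff (k : ℕ) : ℂ := Ring.choose (1 / 2 : ℂ) k

/-- The right-hand side is the coefficient of t^d in L((1+tA)^{1/2}v_1, …, (1+tA)^{1/2}v_{2d}). It
is the polynomial substitute for L evaluated with √A in every slot. -/
lemma exists_sqrtForm (hd : 0 < 2 * d)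
    {L : MultilinearMap ℂ (fun _ : Fin (2 * d) => SuperMod 𝒱) Grass}
    (hL : L ∈ tensorDual 𝒱 (2 * d)) :
    ∃ K ∈ mixedDual 𝒱 d, ∀ A, HasParity 𝒱 0 A → ∀ v, K (fun _ => A) v =
      ∑ κ ∈ Finset.piAntidiag Finset.univ d,
        (∏ j, sqrtCoeff (κ j)) • L fun j => (A ^ κ j) (v j) := by
  choose W hW1 hW2 using exists_wordForm hd hL
  have hsum : ∀ κ : Finset.piAntidiag (Finset.univ : Finset (Fin (2 * d))) d, ∑ j, κ.1 j = d :=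
    fun κ => (Finset.mem_piAntidiag.1 κ.2).1
  refine ⟨∑ κ ∈ (Finset.piAntidiag Finset.univ d).attach, (∏ j, sqrtCoeff (κ.1 j)) •
    W κ.1 (hsum κ), ?_, fun A hA v => ?_⟩
  · exact (mixedDual 𝒱 d).sum_mem fun κ _ => mixedDual_complex_smul (hW1 _ _) _
  · rw [sum_apply, sum_apply]
    conv_rhs => rw [← Finset.sum_attach]
    refine Finset.sum_congr rfl fun κ _ => ?_
    rw [smul_apply, smul_apply, hW2 _ _ A hA]

end Words

end OrthoSymp

end

open scoped TensorProduct MulOpposite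

noncomputable section

set_option linter.unusedSectionVars false
set_option linter.unusedVariables false

namespace OrthoSymp

/-! ### Vector-valued polynomial functions of a complex variable. -/

section PolynomialFunctions

variable {W : Type*} [AddCommGroup W] [Module ℂ W]

/-- The polynomial function with given coefficients. -/
def polyEval : (ℕ →₀ W) →ₗ[ℂ] (ℂ → W) :=
  Finsupp.lsum ℂ fun k => LinearMap.pi fun σ => σ ^ k • LinearMap.id

lemma polyEval_apply (w : ℕ →₀ W) (σ : ℂ) :
    polyEval w σ = ∑ k ∈ w.support, σ ^ k • w k := by
  simp [polyEval, Finsupp.sum]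

variable (W) in
/-- The polynomial functions of a complex variable with values in `W`. -/
def polyFun : Submodule ℂ (ℂ → W) := LinearMap.range (polyEval (W := W))

lemma monomial_mem_polyFun (k : ℕ) (w : W) : (fun σ : ℂ => σ ^ k • w) ∈ polyFun W :=
  ⟨Finsupp.single k w, by ext σ; simp [polyEval]⟩

lemma const_mem_polyFun (w : W) : (fun _ : ℂ => w) ∈ polyFun W := by
  simpa using monomial_mem_polyFun 0 w

lemma linear_mem_polyFun (w : W) : (fun σ : ℂ => σ • w) ∈ polyFun W := by
  simpa using monomial_mem_polyFun 1 w

lemma multilinear_mem_polyFun {ι : Type*} [Fintype ι] {M : ι → Type*} [∀ i, AddCommGroup (M i)]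
    [∀ i, Module ℂ (M i)] (F : MultilinearMap ℂ M W) {f : ∀ i, ℂ → M i}
    (hf : ∀ i, f i ∈ polyFun (M i)) : (fun σ => F fun i => f i σ) ∈ polyFun W := by
  classical
  choose w hw using hf
  have e : (fun σ => F fun i => f i σ) = ∑ r ∈ Fintype.piFinset fun i => (w i).support,
      fun σ : ℂ => σ ^ (∑ i, r i) • F fun i => w i (r i) := by
    ext1 σ
    rw [Finset.sum_apply]
    simp only [← hw, polyEval_apply]
    rw [MultilinearMap.map_sum_finset]
    refine Finset.sum_congr rfl fun r _ => ?_
    rw [MultilinearMap.map_smul_univ, Finset.prod_pow_eq_pow_sum]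
  rw [e]
  exact Submodule.sum_mem _ fun r _ => monomial_mem_polyFun _ _

lemma linearMap_mem_polyFun {M : Type*} [AddCommGroup M] [Module ℂ M] (F : M →ₗ[ℂ] W) {f : ℂ → M}
    (hf : f ∈ polyFun M) : (fun σ => F (f σ)) ∈ polyFun W := by
  obtain ⟨w, rfl⟩ := hf
  have e : (fun σ => F (polyEval w σ)) = ∑ k ∈ w.support, fun σ : ℂ => σ ^ k • F (w k) := by
    ext1 σ
    rw [Finset.sum_apply, polyEval_apply, map_sum]
    simp only [map_smul]
  rw [e]
  exact Submodule.sum_mem _ fun r _ => monomial_mem_polyFun _ _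

/-- Linear functionals separate points and reduce the claim to a scalar polynomial with infinitely
many roots. This replaces a limit σ → 0. -/
lemma polyFun_eq_zero {f : ℂ → W} (hf : f ∈ polyFun W) (h : ∀ σ, σ ≠ 0 → f σ = 0) : f 0 = 0 := by
  obtain ⟨w, rfl⟩ := hf
  rw [← Module.forall_dual_apply_eq_zero_iff ℂ]
  intro φ
  set p : Polynomial ℂ := ∑ k ∈ w.support, Polynomial.monomial k (φ (w k)) with hp
  have he : ∀ σ, φ (polyEval w σ) = p.eval σ := fun σ => by
    rw [polyEval_apply, map_sum, hp, Polynomial.eval_finsetSum]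
    refine Finset.sum_congr rfl fun k _ => ?_
    rw [map_smul, Polynomial.eval_monomial, smul_eq_mul, mul_comm]
  have h0 : p = 0 := by
    refine Polynomial.eq_zero_of_infinite_isRoot p
      (Set.Infinite.mono (s := {0}ᶜ) (fun σ hσ => ?_) (Set.finite_singleton 0).infinite_compl)
    change p.eval σ = 0
    rw [← he, h σ hσ, map_zero]
  rw [he, h0, Polynomial.eval_zero]

end PolynomialFunctions

/-! ### The binomial series of exponent 1/2. -/

section SquareRoot

/-- The power series of `(1 + t)^{1/2}`. -/
def sqrtSeries (R : Type*) [CommRing R] [Algebra ℂ R] : PowerSeries R :=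
  PowerSeries.binomialSeries R (1 / 2 : ℂ)

variable {R : Type*} [CommRing R] [Algebra ℂ R]

lemma sqrtSeries_coeff (k : ℕ) :
    PowerSeries.coeff k (sqrtSeries R) = algebraMap ℂ R (sqrtCoeff k) := by
  rw [sqrtSeries, PowerSeries.binomialSeries_coeff, Algebra.algebraMap_eq_smul_one, sqrtCoeff]

lemma sqrtSeries_mul_self : sqrtSeries R * sqrtSeries R = 1 + PowerSeries.X := by
  rw [sqrtSeries, ← PowerSeries.binomialSeries_add]
  norm_num
  simpa using PowerSeries.binomialSeries_nat (R := ℂ) (A := R) 1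

/-- The left side is the t^d coefficient of the product over j of (1 + x_{k_j}² t)^{1/2}. The value
l is taken 2e_l times, so the roots pair up to the polynomial ∏ (1 + x_l² t)^{e_l}, and ∑ e_l = d.
Its t^d coefficient is ∏ x_l^{2e_l}, the product on the right. -/
lemma sum_sqrtCoeff_mul {κ ι : Type*} [Fintype κ] [DecidableEq κ] [Fintype ι] [DecidableEq ι]
    (d : ℕ) (hd : Fintype.card κ = 2 * d) (k : κ → ι)
    (hk : ∀ l, Even (Finset.univ.filter fun j => k j = l).card) (x : ι → R) :
    ∑ m ∈ Finset.piAntidiag (Finset.univ : Finset κ) d,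
      algebraMap ℂ R (∏ j, sqrtCoeff (m j)) * ∏ j, (x (k j) * x (k j)) ^ m j =
        ∏ j, x (k j) := by
  choose e he using hk
  have hsum : ∑ l, e l = d := by
    have h1 : ∑ l, (Finset.univ.filter fun j => k j = l).card = Fintype.card κ := by
      rw [← Finset.card_univ]
      exact (Finset.card_eq_sum_card_fiberwise fun _ _ => Finset.mem_univ _).symm
    simp only [he, Finset.sum_add_distrib] at h1
    omega
  have key : ∏ j, PowerSeries.rescale (x (k j) * x (k j)) (sqrtSeries R) =
      ((∏ i : (Σ l : ι, Fin (e l)), (1 + Polynomial.C (x i.1 * x i.1) * Polynomial.X) :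
        Polynomial R) : PowerSeries R) := by
    rw [← Finset.prod_fiberwise (s := Finset.univ) (g := k)]
    rw [← Finset.univ_sigma_univ, Finset.prod_sigma, ← Polynomial.coeToPowerSeries.ringHom_apply,
      map_prod]
    refine Finset.prod_congr rfl fun l _ => ?_
    rw [Finset.prod_congr rfl (g := fun _ => PowerSeries.rescale (x l * x l) (sqrtSeries R))
      fun j hj => by rw [(Finset.mem_filter.1 hj).2], Finset.prod_const, he, pow_add, ← mul_pow,
      ← map_mul, sqrtSeries_mul_self]
    dsimp only
    rw [Finset.prod_const, Finset.card_univ, Fintype.card_fin, map_pow]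
    congr 1
    simp [PowerSeries.rescale_X]
  have h1 := congrArg (PowerSeries.coeff d) key
  rw [PowerSeries.coeff_prod, Polynomial.coeff_coe] at h1
  have hcard : Fintype.card (Σ l : ι, Fin (e l)) = d := by simp [hsum]
  -- There are exactly `d` factors of degree at most one, so the coefficient of degree `d` is the
  -- product of the linear coefficients.
  have h2 := Polynomial.coeff_prod_of_natDegree_le (s := Finset.univ)
    (fun i : (Σ l : ι, Fin (e l)) => 1 + Polynomial.C (x i.1 * x i.1) * Polynomial.X) 1
    (fun i _ => by compute_degree)
  rw [Finset.card_univ, hcard, mul_one] at h2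
  have e1 : (∑ m ∈ Finset.piAntidiag (Finset.univ : Finset κ) d,
      algebraMap ℂ R (∏ j, sqrtCoeff (m j)) * ∏ j, (x (k j) * x (k j)) ^ m j) =
      ∑ l ∈ Finset.finsuppAntidiag (Finset.univ : Finset κ) d,
        ∏ i, PowerSeries.coeff (l i) (PowerSeries.rescale (x (k i) * x (k i)) (sqrtSeries R)) := by
    refine Finset.sum_nbij' (fun m => Finsupp.equivFunOnFinite.symm m) (fun l => ⇑l)
      (fun m hm => ?_) (fun l hl => ?_) (fun m hm => ?_) (fun l hl => ?_) fun m hm => ?_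
    · simpa [Finset.mem_piAntidiag, Finset.mem_finsuppAntidiag] using hm
    · simpa [Finset.mem_piAntidiag, Finset.mem_finsuppAntidiag] using hl
    · rfl
    · ext; rfl
    · rw [map_prod, ← Finset.prod_mul_distrib]
      refine Finset.prod_congr rfl fun j _ => ?_
      rw [PowerSeries.coeff_rescale, sqrtSeries_coeff, mul_comm]
      rfl
  rw [e1, h1, h2]
  have e2 : ∀ i : (Σ l : ι, Fin (e l)),
      (1 + Polynomial.C (x i.1 * x i.1) * Polynomial.X : Polynomial R).coeff 1 =
        x i.1 * x i.1 := fun i => by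
    simp [Polynomial.coeff_one]
  simp only [e2]
  rw [← Finset.univ_sigma_univ, Finset.prod_sigma, ← Finset.prod_fiberwise (g := k)]
  refine Finset.prod_congr rfl fun l _ => ?_
  rw [Finset.prod_congr rfl (g := fun _ => x l) (s₁ := Finset.filter _ _)
    fun j hj => by rw [(Finset.mem_filter.1 hj).2], Finset.prod_const]
  dsimp only
  rw [Finset.prod_const, he, Finset.card_univ, Fintype.card_fin, mul_pow, pow_add]

variable {A : Type*} [Ring A] [Algebra R A] [StarRing A]

/-- Evaluate a truncation of the binomial series at `z`. A polynomial in a self-adjoint `z` with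
coefficients in `R` is self-adjoint, and its square agrees with `1 + z` modulo `z ^ N`. -/
lemma exists_sqrt_of_nilpotent (hs : ∀ (r : R) (a : A), star (r • a) = r • star a) {z : A}
    (hz : star z = z) {N : ℕ} (hN : z ^ N = 0) :
    ∃ Q : A, star Q = Q ∧ Q * Q = 1 + z ∧ IsUnit Q := by
  set p : Polynomial R := (sqrtSeries R).trunc (N + 2) with hp
  have hp2 : (Polynomial.X : Polynomial R) ^ N ∣ p * p - (1 + Polynomial.X) := by
    rw [Polynomial.X_pow_dvd_iff]
    intro m hm
    have h1 := congrArg (PowerSeries.coeff m) (sqrtSeries_mul_self (R := R))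
    rw [PowerSeries.coeff_mul_eq_coeff_trunc_mul_trunc (n := N + 2) _ _ (by omega)] at h1
    have h2 : PowerSeries.coeff m ((p * p : Polynomial R) : PowerSeries R) =
        PowerSeries.coeff m ((1 + Polynomial.X : Polynomial R) : PowerSeries R) := by
      rw [Polynomial.coe_mul, Polynomial.coe_add, Polynomial.coe_one, Polynomial.coe_X]
      exact h1
    rw [Polynomial.coeff_coe, Polynomial.coeff_coe] at h2
    rw [Polynomial.coeff_sub, h2, sub_self]
  obtain ⟨q, hq⟩ := hp2
  have hQ : Polynomial.aeval z p * Polynomial.aeval z p = 1 + z := by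
    have h := congrArg (Polynomial.aeval z) hq
    simp only [map_sub, map_mul, map_add, map_one, Polynomial.aeval_X, map_pow, hN, zero_mul] at h
    exact sub_eq_zero.1 h
  refine ⟨Polynomial.aeval z p, ?_, hQ, ?_⟩
  · rw [Polynomial.aeval_eq_sum_range, star_sum]
    simp only [hs, star_pow, hz]
  · have : IsUnit (Polynomial.aeval z p ^ 2) := by
      rw [pow_two, hQ]
      exact IsNilpotent.isUnit_one_add ⟨N, hN⟩
    exact (isUnit_pow_iff two_ne_zero).1 this

end SquareRoot

end OrthoSymp

end

open scoped TensorProduct MulOpposite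

noncomputable section

set_option linter.unusedSectionVars false
set_option linter.unusedVariables false

namespace OrthoSymp

/-! ### Diagonalising nilpotent perturbations by unitary conjugation. -/

section Diagonalisation

variable {R A : Type*} [CommRing R] [Algebra ℂ R] [Ring A] [Algebra R A] [StarRing A]

lemma smul_pow_eq_zero {u : R} {N : ℕ} (hu : u ^ N = 0) (Y : A) : (u • Y) ^ N = 0 := by
  rw [smul_pow, hu, zero_smul]

variable (hs : ∀ (r : R) (a : A), star (r • a) = r • star a)
include hs

/-- Conjugate by the Cayley transform g = (1+uY)(1-uY)⁻¹ with u = s^{m+1}, unitary because `Y` is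
skew. To first order it adds 2u(YD₀ - D₀Y), which the hypothesis makes cancel uC; everything left is
divisible by s^{m+2}. -/
lemma exists_unitary_conj {s : R} {N m : ℕ} (hN : s ^ N = 0) {D₀ D' C Y : A}
    (hD₀ : star D₀ = D₀) (hD' : star D' = D') (hC : star C = C) (hY : star Y = -Y)
    (h : C + (2 : R) • (Y * D₀ - D₀ * Y) = 0) :
    ∃ g ∈ unitary A, ∃ C', star C' = C' ∧
      g * (D₀ + s • D' + s ^ (m + 1) • C) * star g = D₀ + s • D' + s ^ (m + 2) • C' := by
  set u := s ^ (m + 1) with hu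
  have hu0 : u ^ N = 0 := by rw [hu, ← pow_mul, mul_comm, pow_mul, hN, zero_pow (by omega)]
  obtain ⟨p, hp⟩ : IsUnit (1 - u • Y) := IsNilpotent.isUnit_one_sub ⟨N, smul_pow_eq_zero hu0 Y⟩
  set q : Aˣ := star p with hq
  have hq1 : (q : A) = 1 + u • Y := by
    rw [hq, Units.coe_star, hp, star_sub, star_one, hs, hY, smul_neg, sub_neg_eq_add]
  have hpq : p * q = q * p := by
    refine Units.ext ?_
    rw [Units.val_mul, Units.val_mul, hp, hq1]
    simp only [mul_add, add_mul, mul_sub, sub_mul, smul_mul_assoc, mul_smul_comm, one_mul, mul_one]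
    module
  have hsq : star q = p := star_star p
  set D := D₀ + s • D' with hD
  have hDs : star D = D := by rw [hD, star_add, hs, hD₀, hD']
  set T := (2 : R) • (Y * D' - D' * Y) + s ^ m • (Y * C - C * Y) -
    (s ^ m * s ^ (m + 1)) • (Y * C * Y) with hT
  have key : (q : A) * (D + u • C) * p - p * D * q = s ^ (m + 2) • T := by
    rw [hp, hq1, hT, hD]
    simp only [mul_add, add_mul, mul_sub, sub_mul, smul_mul_assoc, mul_smul_comm, one_mul, mul_one,
      smul_add, smul_sub, smul_smul] at h ⊢
    simp only [hu, mul_assoc] at h ⊢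
    linear_combination (norm := module) s ^ (m + 1) • h
  have hg : star (q * p⁻¹) = q⁻¹ * p := by
    rw [star_mul, star_inv, hsq]
  have hg1 : star (q * p⁻¹) * (q * p⁻¹) = 1 := by
    rw [hg, mul_assoc, ← mul_assoc p, hpq]; group
  have hg2 : (q * p⁻¹) * star (q * p⁻¹) = 1 := mul_eq_one_comm.1 hg1
  have hqp : q * p⁻¹ = p⁻¹ * q := by
    rw [eq_inv_mul_iff_mul_eq, ← mul_assoc, hpq]; group
  have hqp' : q⁻¹ * p = p * q⁻¹ := by
    rw [inv_mul_eq_iff_eq_mul, ← mul_assoc, ← hpq]; group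
  have hdiff : ((q * p⁻¹ : Aˣ) : A) * (D + u • C) * star ((q * p⁻¹ : Aˣ) : A) - D =
      s ^ (m + 2) • ((p⁻¹ : Aˣ) * T * (q⁻¹ : Aˣ)) := by
    rw [← Units.coe_star, hg, hqp, hqp', Units.val_mul, Units.val_mul, ← smul_mul_assoc,
      ← mul_smul_comm, ← key]
    simp only [mul_sub, sub_mul, ← mul_assoc, Units.inv_mul, one_mul]
    simp only [mul_assoc, Units.mul_inv, mul_one]
  -- The remainder is s^{m+2} times an element that need not be self-adjoint, although the multiple
  -- is; averaging the element with its adjoint leaves the multiple unchanged.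
  refine ⟨(q * p⁻¹ : Aˣ), ?_, algebraMap ℂ R (1 / 2) •
    (((p⁻¹ : Aˣ) * T * (q⁻¹ : Aˣ)) + star ((p⁻¹ : Aˣ) * T * (q⁻¹ : Aˣ))), ?_, ?_⟩
  · rw [Unitary.mem_iff, ← Units.coe_star, ← Units.val_mul, ← Units.val_mul, hg1, hg2]
    exact ⟨rfl, rfl⟩
  · rw [hs, star_add, star_star, add_comm]
  · rw [← sub_eq_iff_eq_add', smul_comm, smul_add, ← hs, ← hdiff, star_sub, star_mul, star_mul,
      star_star, star_add, hs, hC, hDs, mul_assoc _ (D + u • C), ← two_smul R, smul_smul]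
    rw [show algebraMap ℂ R (1 / 2) * 2 = 1 by
      rw [← map_ofNat (algebraMap ℂ R) 2, ← map_mul]; norm_num, one_smul]

variable {n : ℕ} {π : Fin n → A} (hπs : ∀ k, star (π k) = π k) (hπ : ∀ k, π k * π k = π k)
  (hπ' : ∀ k l, k ≠ l → π k * π l = 0) (hπ1 : ∑ k, π k = 1)
  (hscalar : ∀ C, star C = C → ∀ k, ∃ c : R, π k * C * π k = c • π k)
include hπs hπ hπ' hπ1 hscalar

/-- Order by order in `s`: the diagonal blocks of the error are scalar and join the diagonal part,
and the off-diagonal ones are removed by a conjugation, as the leading eigenvalues are distinct.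
Nilpotency of `s` ends the process at a diagonal element. -/
lemma induction_on_conj {Good : A → Prop} (hdiag : ∀ x : Fin n → R, Good (∑ k, x k • π k))
    (hconj : ∀ g ∈ unitary A, ∀ X, Good (g * X * star g) → Good X)
    {d : Fin n → ℂ} (hd : Function.Injective d) {s : R} {N : ℕ} (hN : s ^ (N + 1) = 0) (j m : ℕ)
    (hj : m + j = N) (y : Fin n → R) (C : A) (hC : star C = C) :
    Good (∑ k, algebraMap ℂ R (d k) • π k + s • ∑ k, y k • π k + s ^ (m + 1) • C) := by
  induction j generalizing m y C with
  | zero =>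
    -- Here `m = N`, so the power of `s` in front of the error vanishes.
    rw [← hj] at hN
    rw [show m + 1 = m + 0 + 1 by omega, hN, zero_smul, add_zero]
    have e : ∑ k, algebraMap ℂ R (d k) • π k + s • ∑ k, y k • π k =
        ∑ k, (algebraMap ℂ R (d k) + s * y k) • π k := by
      rw [Finset.smul_sum, ← Finset.sum_add_distrib]
      exact Finset.sum_congr rfl fun k _ => by rw [add_smul, mul_smul]
    rw [e]
    exact hdiag _
  | succ j ih =>
    choose c hc using hscalar C hC
    have hr : ∀ (x : Fin n → R) k, π k * ∑ l, x l • π l = x k • π k := fun x k => by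
      rw [Finset.mul_sum, Finset.sum_eq_single k]
      · rw [mul_smul_comm, hπ]
      · intro l _ hl
        rw [mul_smul_comm, hπ' k l hl.symm, smul_zero]
      · simp
    have hl : ∀ (x : Fin n → R) k, (∑ l, x l • π l) * π k = x k • π k := fun x k => by
      rw [Finset.sum_mul, Finset.sum_eq_single k]
      · rw [smul_mul_assoc, hπ]
      · intro l _ hl
        rw [smul_mul_assoc, hπ' l k hl, smul_zero]
      · simp
    have hsd : ∀ x : Fin n → R, star (∑ k, x k • π k) = ∑ k, x k • π k := fun x => by
      rw [star_sum]
      exact Finset.sum_congr rfl fun k _ => by rw [hs, hπs]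
    have hCsum : C = ∑ k, ∑ l, π k * C * π l := by
      conv_lhs => rw [← one_mul C, ← mul_one (1 * C), ← hπ1]
      rw [Finset.sum_mul, Finset.sum_mul_sum]
    -- These coefficients solve 2(YD₀ - D₀Y) = -C off the diagonal, and their antisymmetry makes `Y`
    -- skew.
    set e : Fin n → Fin n → ℂ := fun k l => if k = l then 0 else 1 / (2 * (d k - d l)) with he
    have he' : ∀ k l, e l k = -e k l := fun k l => by
      simp only [he]
      by_cases h : k = l
      · rw [if_pos h, if_pos h.symm, neg_zero]
      · rw [if_neg h, if_neg (Ne.symm h), ← neg_sub (d k), mul_neg, div_neg]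
    have he2 : ∀ k l, e k l * (d l - d k) * 2 = if k = l then 0 else -1 := fun k l => by
      simp only [he]
      split_ifs with h
      · simp
      · have : d k - d l ≠ 0 := sub_ne_zero.2 fun h' => h (hd h')
        field_simp
        ring
    set Y : A := ∑ k, ∑ l, algebraMap ℂ R (e k l) • (π k * C * π l) with hY
    have hYs : star Y = -Y := by
      rw [hY, ← Finset.sum_neg_distrib]
      simp only [star_sum]
      rw [Finset.sum_comm]
      refine Finset.sum_congr rfl fun k _ => ?_
      rw [← Finset.sum_neg_distrib]
      refine Finset.sum_congr rfl fun l _ => ?_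
      rw [hs, star_mul, star_mul, hπs, hπs, hC, he' k l, map_neg, neg_smul, mul_assoc]
    have hoff : (C - ∑ k, c k • π k) + (2 : R) • (Y * (∑ k, algebraMap ℂ R (d k) • π k) -
        (∑ k, algebraMap ℂ R (d k) • π k) * Y) = 0 := by
      have e1 : (2 : R) • (Y * (∑ k, algebraMap ℂ R (d k) • π k) -
        (∑ k, algebraMap ℂ R (d k) • π k) * Y) =
          ∑ k, ∑ l, algebraMap ℂ R (if k = l then 0 else -1) • (π k * C * π l) := by
        rw [hY, Finset.sum_mul, Finset.mul_sum, ← Finset.sum_sub_distrib, Finset.smul_sum]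
        refine Finset.sum_congr rfl fun k _ => ?_
        rw [Finset.sum_mul, Finset.mul_sum, ← Finset.sum_sub_distrib, Finset.smul_sum]
        refine Finset.sum_congr rfl fun l _ => ?_
        rw [smul_mul_assoc, mul_assoc _ (π l), hr, mul_smul_comm, mul_smul_comm,
          ← mul_assoc _ (π k * C), ← mul_assoc _ (π k), hl, ← he2]
        simp only [smul_mul_assoc, map_mul, map_sub, map_ofNat]
        module
      rw [e1, hCsum, ← Finset.sum_sub_distrib, ← Finset.sum_add_distrib]
      refine Finset.sum_eq_zero fun k _ => ?_
      rw [← hCsum, ← hc k, ← Finset.sum_erase_add _ _ (Finset.mem_univ k), add_sub_cancel_right,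
        ← Finset.sum_erase_add _ _ (Finset.mem_univ k), if_pos rfl, map_zero, zero_smul, add_zero,
        ← Finset.sum_add_distrib]
      refine Finset.sum_eq_zero fun l hl => ?_
      rw [if_neg (Finset.ne_of_mem_erase hl).symm, map_neg, map_one, neg_one_smul, add_neg_cancel]
    obtain ⟨g, hg, C', hC', hgC⟩ := exists_unitary_conj hs (m := m) hN
      (hsd fun k => algebraMap ℂ R (d k)) (hsd fun k => y k + s ^ m * c k)
      (by rw [star_sub, hC, hsd]) hYs hoff
    -- The scalar diagonal blocks of `C`, of order s^{m+1}, are absorbed into the coefficients of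
    -- `s`.
    have hX : ∑ k, algebraMap ℂ R (d k) • π k + s • ∑ k, y k • π k + s ^ (m + 1) • C =
        ∑ k, algebraMap ℂ R (d k) • π k + s • ∑ k, (y k + s ^ m * c k) • π k +
          s ^ (m + 1) • (C - ∑ k, c k • π k) := by
      simp only [add_smul, mul_smul, Finset.sum_add_distrib, ← Finset.smul_sum]
      module
    refine hconj g hg _ ?_
    rw [hX, hgC]
    exact ih (m + 1) (by omega) _ C' hC'

end Diagonalisation

/-! ### Polar decomposition near a scalar. -/

section Polar

variable {R A : Type*} [CommRing R] [Algebra ℂ R] [Ring A] [Algebra R A] [StarRing A]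

/-- The polar decomposition of `σ + sY` for nilpotent `s`. -/
lemma exists_polar (hs : ∀ (r : R) (a : A), star (r • a) = r • star a) {s : R} {N : ℕ}
    (hN : s ^ N = 0) (Y : A) {σ : ℂ} (hσ : σ ≠ 0) :
    ∃ P, star P = P ∧ ∃ g ∈ unitary A, algebraMap ℂ R σ • (1 : A) + s • Y = g * P := by
  set τ := algebraMap ℂ R σ with hτ
  have hτ' : τ * algebraMap ℂ R σ⁻¹ = 1 := by rw [hτ, ← map_mul, mul_inv_cancel₀ hσ, map_one]
  set t := s * algebraMap ℂ R σ⁻¹ with ht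
  have htN : t ^ N = 0 := by rw [ht, mul_pow, hN, zero_mul]
  have hX : τ • (1 : A) + s • Y = τ • (1 + t • Y) := by
    rw [smul_add, smul_smul, ht]
    congr 2
    linear_combination (-s) * hτ'
  -- With X = τ(1 + tY) one has X†X = τ²(1 + tZ). Since tZ is nilpotent and self-adjoint, 1 + tZ has
  -- a self-adjoint root Q, and g = (1 + tY)Q⁻¹ is unitary.
  set Z := Y + star Y + t • (star Y * Y) with hZ
  have hZs : star (t • Z) = t • Z := by
    rw [hs, hZ, star_add, star_add, hs, star_mul, star_star, add_comm (star Y)]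
  obtain ⟨Q, hQs, hQ, q, rfl⟩ := exists_sqrt_of_nilpotent hs hZs (smul_pow_eq_zero htN Z)
  obtain ⟨x, hx⟩ : IsUnit (1 + t • Y) := IsNilpotent.isUnit_one_add ⟨N, smul_pow_eq_zero htN Y⟩
  have hq : star q = q := Units.ext hQs
  have hxq : star x * x = q * q := by
    refine Units.ext ?_
    rw [Units.val_mul, Units.val_mul, Units.coe_star, hx, hQ, hZ, star_add, star_one, hs]
    simp only [mul_add, add_mul, smul_mul_assoc, mul_smul_comm, one_mul, mul_one, smul_add,
      smul_smul]
    abel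
  have hg : star (x * q⁻¹) * (x * q⁻¹) = 1 := by
    rw [star_mul, star_inv, hq, mul_assoc, ← mul_assoc (star x), hxq]; group
  refine ⟨τ • (q : A), by rw [hs, hQs], (x * q⁻¹ : Aˣ), ?_, ?_⟩
  · rw [Unitary.mem_iff, ← Units.coe_star, ← Units.val_mul, ← Units.val_mul, hg,
      mul_eq_one_comm.1 hg]
    exact ⟨rfl, rfl⟩
  · rw [hX, mul_smul_comm, ← Units.val_mul, inv_mul_cancel_right, hx]

end Polar

end OrthoSymp

end

open scoped TensorProduct MulOpposite

noncomputable section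

set_option linter.unusedSectionVars false
set_option linter.unusedVariables false

namespace OrthoSymp

/-! ### Even endomorphisms as an algebra with involution. -/

/-- The even part of the Grassmann algebra. -/
def evenGrass : Subalgebra ℂ Grass :=
  (grassParity 0).toSubalgebra one_mem_grassParity fun _ _ ha hb => by
    simpa using grassParity_mul ha hb

instance : CommRing evenGrass :=
  { (inferInstance : Ring evenGrass) with
    mul_comm := fun a b => Subtype.ext (even_mul_comm a.2 b.1) }

section EvenEndomorphisms

variable {E : Type*} [AddCommGroup E] [Module ℂ E] {𝒱 : ZMod 2 → Submodule ℂ E}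
  [DirectSum.Decomposition 𝒱]

instance : Algebra evenGrass (evenEnd 𝒱) :=
  RingHom.toAlgebra'
    { toFun := fun a => ⟨leftEnd 𝒱 a.1, HasParity.leftEnd 𝒱 a.2⟩
      map_one' := Subtype.ext (map_one (leftEnd 𝒱))
      map_mul' := fun a c => Subtype.ext (map_mul (leftEnd 𝒱) a.1 c.1)
      map_zero' := Subtype.ext (map_zero (leftEnd 𝒱))
      map_add' := fun a c => Subtype.ext (map_add (leftEnd 𝒱) a.1 c.1) }
    fun a A => Subtype.ext (leftEnd_mul_comm 𝒱 a.2 A.1)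

lemma coe_even_smul (a : evenGrass) (A : evenEnd 𝒱) :
    ((a • A : evenEnd 𝒱) : EndL 𝒱) = leftEnd 𝒱 a.1 * A.1 := rfl

lemma coe_algebraMap_smul (c : ℂ) (A : evenEnd 𝒱) :
    ((algebraMap ℂ evenGrass c • A : evenEnd 𝒱) : EndL 𝒱) = c • A.1 := by
  rw [coe_even_smul]
  have e : (algebraMap ℂ evenGrass c).1 = c • (1 : Grass) := Algebra.algebraMap_eq_smul_one c
  rw [e, leftEnd_smul, map_one, smul_mul_assoc, one_mul]

variable [FiniteDimensional ℂ E] {B : LinearMap.BilinForm ℂ E} (hB : IsOrthosymplectic 𝒱 B)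

/-- The superadjoint as an involution of the even endomorphisms. -/
abbrev evenStar : StarRing (evenEnd 𝒱) where
  star A := ⟨dagger hB A.1, (dagger_hom hB A.2).2.1⟩
  star_involutive A := Subtype.ext (dagger_dagger hB A.1)
  star_mul A C := Subtype.ext
    (((dagger_hom hB A.2).mul_even (dagger_hom hB C.2)).eq_dagger hB).symm
  star_add A C := Subtype.ext (map_add (dagger hB) A.1 C.1)

lemma evenStar_smul (a : evenGrass) (A : evenEnd 𝒱) :
    (evenStar hB).star (a • A) = a • (evenStar hB).star A :=
  Subtype.ext (dagger_leftEnd_mul hB A.1 a.1)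

lemma exists_osp_of_unitary {g : evenEnd 𝒱}
    (h1 : (evenStar hB).star g * g = 1) (h2 : g * (evenStar hB).star g = 1) :
    ∃ γ ∈ OSp 𝒱 B, GLSuper.toEnd γ = g.1 := by
  refine ⟨⟨g, (evenStar hB).star g, h2, h1⟩, fun v w => ?_, rfl⟩
  change superForm 𝒱 B (g.1 v) (g.1 w) = _
  rw [(dagger_hom hB g.2).even_form]
  exact congrArg _ (LinearMap.congr_fun (congrArg Subtype.val h1) w)

end EvenEndomorphisms

/-! ### The values of the square root form at X†X. -/

section Lift

variable {E : Type*} [AddCommGroup E] [Module ℂ E] {𝒱 : ZMod 2 → Submodule ℂ E}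
  [DirectSum.Decomposition 𝒱]

lemma tensorDual_even_smul_prod {r : ℕ}
    {f : MultilinearMap ℂ (fun _ : Fin r => SuperMod 𝒱) Grass} (hf : f ∈ tensorDual 𝒱 r)
    (a : Fin r → evenGrass) (v : Fin r → SuperMod 𝒱) :
    f (fun j => (a j).1 • v j) = f v * (∏ j, a j).1 := by
  have key : ∀ t : Finset (Fin r),
      f (t.piecewise (fun j => (a j).1 • v j) v) = f v * (∏ j ∈ t, a j).1 := by
    intro t
    induction t using Finset.induction_on with
    | empty => simp
    | insert i t hi ih =>
      have e : (insert i t).piecewise (fun j => (a j).1 • v j) v =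
          Function.update (t.piecewise (fun j => (a j).1 • v j) v) i
            ((a i).1 • t.piecewise (fun j => (a j).1 • v j) v i) := by
        rw [Finset.piecewise_insert, Finset.piecewise_eq_of_notMem _ _ _ hi]
      rw [e, tensorDual_even_smul hf (a i).2, ih, Finset.prod_insert hi, mul_assoc, mul_comm (a i)]
      rfl
  simpa using key Finset.univ

variable {d : ℕ} {K : MixedMultilinear 𝒱 d}
  {L : MultilinearMap ℂ (fun _ : Fin (2 * d) => SuperMod 𝒱) Grass}

/-- Both sides of the hypothesis are polynomial in σ, so the equality extends to σ = 0. There the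
endomorphism slots contribute (s²)^d and the vectors s^{2d}, a common factor. -/
lemma polynomial_degeneration (hK : K ∈ mixedDual 𝒱 d) (hL : L ∈ tensorDual 𝒱 (2 * d)) {s : Grass}
    (hs : s ∈ grassParity 0) (U U' T T' : EndL 𝒱) (v : Fin (2 * d) → SuperMod 𝒱)
    (h : ∀ σ : ℂ, σ ≠ 0 → K (fun _ => (σ • U' + leftEnd 𝒱 s * T') * (σ • U + leftEnd 𝒱 s * T)) v =
      L fun j => (σ • U + leftEnd 𝒱 s * T) (v j)) :
    (K (fun _ => T' * T) v - L fun j => T (v j)) * s ^ (2 * d) = 0 := by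
  have hX : (fun σ : ℂ => (σ • U' + leftEnd 𝒱 s * T') * (σ • U + leftEnd 𝒱 s * T)) ∈
      polyFun (EndL 𝒱) := by
    have e : (fun σ : ℂ => (σ • U' + leftEnd 𝒱 s * T') * (σ • U + leftEnd 𝒱 s * T)) =
        (fun σ => σ ^ 2 • (U' * U)) + (fun σ => σ • (U' * (leftEnd 𝒱 s * T) +
          leftEnd 𝒱 s * T' * U)) + fun _ => (leftEnd 𝒱 s * T') * (leftEnd 𝒱 s * T) := by
      ext1 σ
      simp only [Pi.add_apply, mul_add, add_mul, smul_mul_assoc, mul_smul_comm]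
      module
    rw [e]
    exact Submodule.add_mem _ (Submodule.add_mem _ (monomial_mem_polyFun _ _)
      (linear_mem_polyFun _)) (const_mem_polyFun _)
  have h1 := linearMap_mem_polyFun
    ({ toFun := fun f => f v, map_add' := fun _ _ => rfl, map_smul' := fun _ _ => rfl } :
      MultilinearMap ℂ (fun _ : Fin (2 * d) => SuperMod 𝒱) Grass →ₗ[ℂ] Grass)
    (multilinear_mem_polyFun K fun _ => hX)
  have h2 := multilinear_mem_polyFun L (f := fun j σ => (σ • U + leftEnd 𝒱 s * T) (v j)) fun j =>
    Submodule.add_mem _ (linear_mem_polyFun (U (v j))) (const_mem_polyFun _)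
  have h3 := polyFun_eq_zero (Submodule.sub_mem _ h1 h2) fun σ hσ => sub_eq_zero.2 (h σ hσ)
  have e1 : (leftEnd 𝒱 s * T') * (leftEnd 𝒱 s * T) = leftEnd 𝒱 (s * s) * (T' * T) := by
    rw [map_mul, mul_assoc, ← mul_assoc T', ← leftEnd_mul_comm 𝒱 hs T']
    simp only [mul_assoc]
  have h4 : K (fun _ => (leftEnd 𝒱 s * T') * (leftEnd 𝒱 s * T)) v -
      L (fun j => s • T (v j)) = 0 := by
    simpa using h3
  have hss : s * s ∈ grassParity 0 := by simpa using grassParity_mul hs hs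
  rw [e1, mixedDual_even_smul_all hK hss (fun _ => T' * T),
    tensorDual_even_smul_all hL hs (fun j => T (v j)), ← pow_two, ← pow_mul, ← sub_mul] at h4
  exact h4

variable [FiniteDimensional ℂ E] {B : LinearMap.BilinForm ℂ E} (hB : IsOrthosymplectic 𝒱 B)
  (hK : K ∈ mixedDual 𝒱 d) (hL : L ∈ ospInvariants 𝒱 B (2 * d))
  (hKL : ∀ A, HasParity 𝒱 0 A → ∀ v, K (fun _ => A) v =
    ∑ κ ∈ Finset.piAntidiag Finset.univ d,
      (∏ j, sqrtCoeff (κ j)) • L fun j => (A ^ κ j) (v j))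

include hL in
lemma osp_invariant_unitary {g : evenEnd 𝒱}
    (h1 : (evenStar hB).star g * g = 1) (h2 : g * (evenStar hB).star g = 1)
    (v : Fin (2 * d) → SuperMod 𝒱) : L (fun j => g.1 (v j)) = L v := by
  obtain ⟨γ, hγ, e⟩ := exists_osp_of_unitary hB h1 h2
  rw [← e]
  exact hL.2 γ hγ v

include hB hL in
-- The reflection `1 - 2 * P.π l` is a self-adjoint involution, hence in OSp(V). It negates each
-- argument lying in block `l`, so an odd number of such arguments equates the value of L with its
-- negative.
lemma block_odd_eq_zero {n : ℕ} (P : BlockDecomposition 𝒱 B n) (k : Fin (2 * d) → Fin n) (l : Fin n)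
    (hodd : ¬ Even (Finset.univ.filter fun j => k j = l).card) (w : Fin (2 * d) → SuperMod 𝒱) :
    L (fun j => P.π (k j) (w j)) = 0 := by
  have hπ0 : HasParity 𝒱 0 (P.π l) := (P.adj l).1
  set g : evenEnd 𝒱 := 1 - 2 * ⟨P.π l, hπ0⟩ with hg
  have hg' : g.1 = 1 - 2 * P.π l := rfl
  have hgs : (evenStar hB).star g = g := by
    refine Subtype.ext ?_
    change dagger hB (1 - 2 * P.π l) = 1 - 2 * P.π l
    rw [map_sub, two_mul, map_add, ← (P.adj l).eq_dagger hB, ← (IsHomAdjoint.one).eq_dagger hB]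
  have hgg : g * g = 1 := by
    refine Subtype.ext ?_
    change (1 - 2 * P.π l) * (1 - 2 * P.π l) = 1
    have := P.mul_self l
    have e : (1 - 2 * P.π l) * (1 - 2 * P.π l) = 1 - 4 * P.π l + 4 * (P.π l * P.π l) := by
      noncomm_ring
    rw [e, this, sub_add_cancel]
  have hinv := osp_invariant_unitary hB hL (g := g) (by rw [hgs, hgg]) (by rw [hgs, hgg])
    (fun j => P.π (k j) (w j))
  have he : (fun j => g.1 (P.π (k j) (w j))) =
      fun j => (if k j = l then (-1 : ℂ) else 1) • P.π (k j) (w j) := by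
    ext1 j
    rw [hg', two_mul]
    change P.π (k j) (w j) - (P.π l (P.π (k j) (w j)) + P.π l (P.π (k j) (w j))) = _
    rw [← Module.End.mul_apply]
    split_ifs with h
    · rw [h, P.mul_self]
      module
    · rw [P.mul_ne _ _ (Ne.symm h), LinearMap.zero_apply]
      module
  rw [he, MultilinearMap.map_smul_univ, Finset.prod_ite, Finset.prod_const, Finset.prod_const_one,
    mul_one, Odd.neg_one_pow (Nat.not_even_iff_odd.1 hodd), neg_one_smul] at hinv
  have h2 : (2 : ℂ) • L (fun j => P.π (k j) (w j)) = 0 := by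
    rw [two_smul]
    nth_rewrite 1 [← hinv]
    exact neg_add_cancel _
  exact (smul_eq_zero.1 h2).resolve_left two_ne_zero

include hB hL hKL in
-- Expand each vector into blocks, where `X` acts by the scalars `x`. Components with an odd block
-- multiplicity vanish on both sides; for the others the identity is `sum_sqrtCoeff_mul`.
lemma lift_diagonal {n : ℕ} (P : BlockDecomposition 𝒱 B n) (x : Fin n → evenGrass)
    {X : EndL 𝒱} (hX0 : HasParity 𝒱 0 X) (hX : ∀ k, X * P.π k = leftEnd 𝒱 (x k).1 * P.π k)
    (v : Fin (2 * d) → SuperMod 𝒱) :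
    K (fun _ => X * X) v = L fun j => X (v j) := by
  have hX2 : HasParity 𝒱 0 (X * X) := by simpa using hX0.mul 𝒱 hX0
  have hv : v = fun j => ∑ k, P.π k (v j) := by
    ext1 j
    rw [← LinearMap.sum_apply, P.sum_eq_one]
    rfl
  have hL' : L (fun j => X (v j)) = L.compLinearMap (fun _ => X.restrictScalars ℂ) v := rfl
  rw [hL', hv, MultilinearMap.map_sum, MultilinearMap.map_sum]
  refine Finset.sum_congr rfl fun k _ => ?_
  rw [hKL _ hX2]
  change _ = L fun j => X (P.π (k j) (v j))
  have e1 : ∀ j, X (P.π (k j) (v j)) = (x (k j)).1 • P.π (k j) (v j) := fun j =>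
    LinearMap.congr_fun (hX (k j)) (v j)
  have e2 : ∀ (m : ℕ) j, ((X * X) ^ m) (P.π (k j) (v j)) =
      ((x (k j) * x (k j)) ^ m).1 • P.π (k j) (v j) := fun m j => by
    have key : ∀ a : evenGrass, ∀ y : SuperMod 𝒱, X (a.1 • y) = a.1 • X y := fun a y =>
      (LinearMap.congr_fun (leftEnd_mul_comm 𝒱 a.2 X) y).symm
    induction m with
    | zero => rw [pow_zero, pow_zero]; exact (one_smul _ _).symm
    | succ m ih =>
      rw [pow_succ', Module.End.mul_apply, ih, Module.End.mul_apply, key, key, e1, key, e1,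
        smul_smul, smul_smul, pow_succ]
      rw [← mul_assoc]
      rfl
  simp only [e1, e2]
  rw [tensorDual_even_smul_prod hL.1 (fun j => x (k j)) (fun j => P.π (k j) (v j))]
  simp only [fun κ : Fin (2 * d) → ℕ => tensorDual_even_smul_prod hL.1
    (fun j => (x (k j) * x (k j)) ^ κ j) (fun j => P.π (k j) (v j))]
  by_cases hev : ∀ l, Even (Finset.univ.filter fun j => k j = l).card
  · rw [← sum_sqrtCoeff_mul d (by simp) k hev x]
    rw [AddSubmonoidClass.coe_finsetSum, Finset.mul_sum]
    refine Finset.sum_congr rfl fun κ _ => ?_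
    rw [← Algebra.smul_def, ← mul_smul_comm]
    rfl
  · push Not at hev
    obtain ⟨l, hl⟩ := hev
    rw [block_odd_eq_zero hB hL P k l (by simpa using hl)]
    simp

include hL hKL in
-- Since (gAg†)^m g = gA^m, the element g comes out of every term in front of all arguments, where
-- the invariance of L removes it.
lemma lift_conj {g : evenEnd 𝒱}
    (h1 : (evenStar hB).star g * g = 1) (h2 : g * (evenStar hB).star g = 1) {A : EndL 𝒱}
    (hA : HasParity 𝒱 0 A) (v : Fin (2 * d) → SuperMod 𝒱) :
    K (fun _ => g.1 * A * ((evenStar hB).star g).1) (fun j => g.1 (v j)) = K (fun _ => A) v := by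
  set g' := (evenStar hB).star g with hg'
  have h1' : g'.1 * g.1 = 1 := congrArg Subtype.val h1
  have hgA : HasParity 𝒱 0 (g.1 * A * g'.1) := by
    simpa using (HasParity.mul 𝒱 (HasParity.mul 𝒱 g.2 hA) g'.2)
  rw [hKL _ hgA, hKL _ hA]
  refine Finset.sum_congr rfl fun κ _ => ?_
  have e : ∀ m : ℕ, (g.1 * A * g'.1) ^ m * g.1 = g.1 * A ^ m := fun m => by
    induction m with
    | zero => simp
    | succ m ih => rw [pow_succ', mul_assoc, ih, mul_assoc, ← mul_assoc g'.1, h1', one_mul,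
        mul_assoc, pow_succ']
  have e' : (fun j => ((g.1 * A * g'.1) ^ κ j) (g.1 (v j))) = fun j => g.1 ((A ^ κ j) (v j)) := by
    ext1 j
    exact LinearMap.congr_fun (e (κ j)) (v j)
  rw [e', osp_invariant_unitary hB hL h1 h2]

include hB hK hL hKL in
-- Replace `C` by σD + sC with `D` equal to the constant k on block k. This perturbation is
-- unitarily diagonalisable for σ ≠ 0, so `lift_diagonal` applies to it, and degeneration to σ = 0
-- recovers `C`.
lemma lift_selfadjoint {C : EndL 𝒱} (hC : IsHomAdjoint 𝒱 B 0 C C) (v : Fin (2 * d) → SuperMod 𝒱) :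
    K (fun _ => C * C) v = L fun j => C (v j) := by
  obtain ⟨n, ⟨P⟩⟩ := exists_blockDecomposition hB
  obtain ⟨s, hs, hs0, hreg⟩ := exists_even_nilpotent_regular (2 * d)
    (K (fun _ => C * C) v - L fun j => C (v j))
  let _ := evenStar hB
  set D : EndL 𝒱 := ∑ k, (k.1 : ℂ) • P.π k with hD
  refine sub_eq_zero.1 (hreg (polynomial_degeneration hK hL.1 hs D D C C v fun σ hσ => ?_))
  set π : Fin n → evenEnd 𝒱 := fun k => ⟨P.π k, (P.adj k).1⟩ with hπ
  have hπs : ∀ k, star (π k) = π k := fun k => Subtype.ext ((P.adj k).eq_dagger hB).symm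
  have hsum : ∑ k, π k = 1 := by
    refine Subtype.ext ?_
    rw [AddSubmonoidClass.coe_finsetSum]
    exact P.sum_eq_one
  have hsc : ∀ C : evenEnd 𝒱, star C = C → ∀ k, ∃ c : evenGrass, π k * C * π k = c • π k := by
    intro C hC k
    obtain ⟨c, hc, h⟩ := P.scalar C.1
      ((dagger_isHomAdjoint_self_iff hB C.2).2 (congrArg Subtype.val hC)) k
    exact ⟨⟨c, hc⟩, Subtype.ext h⟩
  have hdinj : Function.Injective fun k : Fin n => σ * (k.1 : ℂ) := fun k l h =>
    Fin.ext (by exact_mod_cast mul_left_cancel₀ hσ h)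
  -- The property carried along, for all vectors at once, is the identity at self-adjoint arguments;
  -- quantifying over the vectors is needed since conjugation moves them.
  have key := induction_on_conj (evenStar_smul hB) hπs
    (fun k => Subtype.ext (P.mul_self k)) (fun k l h => Subtype.ext (P.mul_ne k l h)) hsum hsc
    (Good := fun X : evenEnd 𝒱 => ∀ v, K (fun _ => X.1 * X.1) v = L fun j => X.1 (v j))
    (fun x v => ?_) (fun g hg X h v => ?_) hdinj (s := (⟨s, hs⟩ : evenGrass))
    (N := 2 * d) (Subtype.ext hs0) (2 * d) 0 (zero_add _) 0 ⟨C, hC.1⟩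
    (Subtype.ext (hC.eq_dagger hB).symm) v
  · have e : (∑ k, algebraMap ℂ evenGrass (σ * (k.1 : ℂ)) • π k +
        (⟨s, hs⟩ : evenGrass) • ∑ k, (0 : Fin n → evenGrass) k • π k +
        (⟨s, hs⟩ : evenGrass) ^ (0 + 1) • (⟨C, hC.1⟩ : evenEnd 𝒱)).1 =
        σ • D + leftEnd 𝒱 s * C := by
      have z : ∑ k, (0 : Fin n → evenGrass) k • π k = 0 :=
        Finset.sum_eq_zero fun k _ => zero_smul _ _
      rw [z, smul_zero, add_zero, zero_add, pow_one]
      change (∑ k, algebraMap ℂ evenGrass (σ * (k.1 : ℂ)) • π k).1 + leftEnd 𝒱 s * C = _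
      rw [AddSubmonoidClass.coe_finsetSum, hD, Finset.smul_sum]
      congr 1
      refine Finset.sum_congr rfl fun k _ => ?_
      rw [coe_algebraMap_smul, mul_smul]
    rw [e] at key
    exact key
  · refine lift_diagonal hB hL hKL P x (∑ k, x k • π k).2 (fun k => ?_) v
    have : (∑ l, x l • π l) * π k = x k • π k := by
      rw [Finset.sum_mul, Finset.sum_eq_single k]
      · rw [smul_mul_assoc]
        exact congrArg _ (Subtype.ext (P.mul_self k))
      · intro l _ hl
        rw [smul_mul_assoc, show π l * π k = 0 from Subtype.ext (P.mul_ne l k hl), smul_zero]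
      · exact fun h => absurd (Finset.mem_univ k) h
    exact congrArg Subtype.val this
  · have hg1 := (Unitary.mem_iff.1 hg).1
    have hg2 := (Unitary.mem_iff.1 hg).2
    have hXX : HasParity 𝒱 0 (X.1 * X.1) := (X * X).2
    have e1 : (g * X * star g) * (g * X * star g) = g * (X * X) * star g := by
      rw [mul_assoc, ← mul_assoc (star g), ← mul_assoc (star g), hg1, one_mul]
      simp only [mul_assoc]
    have e2 : (g * X * star g) * g = g * X := by rw [mul_assoc, hg1, mul_one]
    have h' := h fun j => g.1 (v j)
    have e1' : (g * X * star g).1 * (g * X * star g).1 = g.1 * (X.1 * X.1) * (star g).1 :=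
      congrArg Subtype.val e1
    have e2' : (fun j => (g * X * star g).1 (g.1 (v j))) = fun j => g.1 (X.1 (v j)) := by
      ext1 j
      exact LinearMap.congr_fun (congrArg Subtype.val e2) (v j)
    rw [e1', e2', osp_invariant_unitary hB hL hg1 hg2] at h'
    rw [← h']
    exact (lift_conj hB hL hKL hg1 hg2 hXX v).symm

include hB hK hL hKL in
-- Write σ + sY = gP with g unitary and P self-adjoint. Then ω(gP) = P², while L(gPv) = L(Pv) by
-- invariance, so the self-adjoint case applies; degenerate to σ = 0.
lemma lift_omega {Y Y' : EndL 𝒱} (hY : IsHomAdjoint 𝒱 B 0 Y Y') (v : Fin (2 * d) → SuperMod 𝒱) :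
    K (fun _ => Y' * Y) v = L fun j => Y (v j) := by
  obtain ⟨s, hs, hs0, hreg⟩ := exists_even_nilpotent_regular (2 * d)
    (K (fun _ => Y' * Y) v - L fun j => Y (v j))
  let _ := evenStar hB
  refine sub_eq_zero.1 (hreg (polynomial_degeneration hK hL.1 hs 1 1 Y Y' v fun σ hσ => ?_))
  obtain ⟨P, hP, g, hg, hX⟩ := exists_polar (evenStar_smul hB) (s := (⟨s, hs⟩ : evenGrass))
    (N := 2 * d + 1) (Subtype.ext hs0) (⟨Y, hY.1⟩ : evenEnd 𝒱) hσ
  have hg1 := (Unitary.mem_iff.1 hg).1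
  have hg2 := (Unitary.mem_iff.1 hg).2
  have hX1 : σ • (1 : EndL 𝒱) + leftEnd 𝒱 s * Y = g.1 * P.1 := by
    rw [← show _ = g.1 * P.1 from congrArg Subtype.val hX]
    change _ = (algebraMap ℂ evenGrass σ • (1 : evenEnd 𝒱) : evenEnd 𝒱).1 + leftEnd 𝒱 s * Y
    rw [coe_algebraMap_smul]
    rfl
  have hX2 : σ • (1 : EndL 𝒱) + leftEnd 𝒱 s * Y' = P.1 * (star g).1 := by
    have h : star (g * P) = P * star g := by rw [star_mul, hP]
    have h' : dagger hB (g.1 * P.1) = P.1 * (star g).1 := congrArg Subtype.val h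
    rw [← h', ← hX1, map_add, map_smul, dagger_leftEnd_mul, ← hY.eq_dagger hB,
      ← (IsHomAdjoint.one).eq_dagger hB]
  have e : P.1 * (star g).1 * (g.1 * P.1) = P.1 * P.1 := by
    have : P * star g * (g * P) = P * P := by
      rw [mul_assoc, ← mul_assoc (star g), hg1, one_mul]
    exact congrArg Subtype.val this
  have hPs : IsHomAdjoint 𝒱 B 0 P.1 P.1 :=
    (dagger_isHomAdjoint_self_iff hB P.2).2 (congrArg Subtype.val hP)
  rw [hX1, hX2, e, lift_selfadjoint hB hK hL hKL hPs]
  exact (osp_invariant_unitary hB hL hg1 hg2 fun j => P.1 (v j)).symm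

end Lift

end OrthoSymp

end

open scoped TensorProduct MulOpposite

noncomputable section

set_option linter.unusedSectionVars false
set_option linter.unusedVariables false

namespace OrthoSymp

/-! ### Polarisation of multilinear maps. -/

section Polarisation

variable {M N : Type*} [AddCommGroup M] [Module ℂ M] [AddCommGroup N] [Module ℂ N] {d : ℕ}

/-- A symmetric multilinear map that vanishes on the diagonal of a subspace vanishes on it. -/
lemma multilinear_eq_zero_of_diag (f : MultilinearMap ℂ (fun _ : Fin d => M) N) (S : Submodule ℂ M)
    (hdiag : ∀ x ∈ S, f (fun _ => x) = 0)
    (hsymm : ∀ A : Fin d → M, (∀ i, A i ∈ S) → ∀ σ : Equiv.Perm (Fin d), f (A ∘ σ) = f A)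
    (A : Fin d → M) (hA : ∀ i, A i ∈ S) : f A = 0 := by
  -- The alternating sum of f over the diagonal points ∑ ε_i A_i with ε_i ∈ {0, 1}: `val` is the
  -- coefficient and `sg` the sign.
  set sg : Bool → ℂ := fun b => if b then 1 else -1 with hsg
  set val : Bool → ℂ := fun b => if b then 1 else 0 with hval
  -- The sum over ε factors over the indices i. The factor of an index missed by `r` is 1 - 1 = 0,
  -- and the factor of an index that is hit is 1.
  have hcoef : ∀ r : Fin d → Fin d, ∑ ε : Fin d → Bool, (∏ i, sg (ε i)) * ∏ j, val (ε (r j)) =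
      if Function.Bijective r then 1 else 0 := fun r => by
    have e1 : ∀ ε : Fin d → Bool, (∏ i, sg (ε i)) * ∏ j, val (ε (r j)) =
        ∏ i, sg (ε i) * ∏ j ∈ Finset.univ.filter (fun j => r j = i), val (ε i) := fun ε => by
      rw [Finset.prod_mul_distrib]
      congr 1
      rw [← Finset.prod_fiberwise (g := r) (f := fun j => val (ε (r j)))]
      refine Finset.prod_congr rfl fun i _ => Finset.prod_congr rfl fun j hj => ?_
      rw [(Finset.mem_filter.1 hj).2]
    simp only [e1]
    have e2 := Finset.prod_univ_sum (fun _ : Fin d => (Finset.univ : Finset Bool))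
      fun i b => sg b * ∏ j ∈ Finset.univ.filter (fun j => r j = i), val b
    rw [Fintype.piFinset_univ] at e2
    rw [← e2]
    split_ifs with hr
    · refine Finset.prod_eq_one fun i _ => ?_
      obtain ⟨j, hj⟩ := hr.2 i
      rw [Fintype.sum_bool, Finset.prod_eq_zero (i := j) (f := fun _ => val false)
        (Finset.mem_filter.2 ⟨Finset.mem_univ _, hj⟩) (by simp [hval])]
      simp [hsg, hval]
    · have hr' : ¬ Function.Surjective r := fun h => hr (Finite.surjective_iff_bijective.1 h)
      simp only [Function.Surjective, not_forall, not_exists] at hr'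
      obtain ⟨x, hx⟩ := hr'
      refine Finset.prod_eq_zero (Finset.mem_univ x) ?_
      have : Finset.univ.filter (fun j => r j = x) = ∅ := by
        ext j; simp [hx j]
      simp [this, hsg]
  have h0 : ∑ ε : Fin d → Bool, (∏ i, sg (ε i)) • f (fun _ => ∑ i, val (ε i) • A i) = 0 :=
    Finset.sum_eq_zero fun ε _ => by
      rw [hdiag _ (Submodule.sum_mem _ fun i _ => Submodule.smul_mem _ _ (hA i)), smul_zero]
  have h1 : ∀ ε : Fin d → Bool, f (fun _ => ∑ i, val (ε i) • A i) =
      ∑ r : Fin d → Fin d, (∏ j, val (ε (r j))) • f fun j => A (r j) := fun ε => by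
    rw [MultilinearMap.map_sum]
    refine Finset.sum_congr rfl fun r _ => ?_
    rw [← MultilinearMap.map_smul_univ]
  simp only [h1, Finset.smul_sum, smul_smul] at h0
  rw [Finset.sum_comm] at h0
  simp only [← Finset.sum_smul, hcoef] at h0
  have h2 : ∀ r : Fin d → Fin d, (if Function.Bijective r then (1 : ℂ) else 0) • f (fun j => A (r j)) =
      (if Function.Bijective r then (1 : ℂ) else 0) • f A := fun r => by
    split_ifs with hr
    · rw [← hsymm A hA (Equiv.ofBijective r hr)]
      rfl
    · rw [zero_smul, zero_smul]
  simp only [h2] at h0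
  rw [← Finset.sum_smul, Finset.sum_boole] at h0
  refine (smul_eq_zero.1 h0).resolve_left ?_
  rw [← ne_eq, Nat.cast_ne_zero, Finset.card_ne_zero]
  exact ⟨id, Finset.mem_filter.2 ⟨Finset.mem_univ _, Function.bijective_id⟩⟩

/-- A device for enlarging the class of arguments on which a map is known to vanish, from `Q` to
`P`, by treating the slots one at a time. -/
lemma multilinear_eq_zero_of_slots (f : MultilinearMap ℂ (fun _ : Fin d => M) N) {P Q : M → Prop}
    (hQP : ∀ x, Q x → P x) (h : ∀ A, (∀ i, Q (A i)) → f A = 0)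
    (hstep : ∀ A, (∀ i, P (A i)) → ∀ i, (∀ x, Q x → f (Function.update A i x) = 0) → f A = 0)
    (A : Fin d → M) (hA : ∀ i, P (A i)) : f A = 0 := by
  have key : ∀ (t : Finset (Fin d)) (A : Fin d → M), (∀ i, P (A i)) → (∀ i, i ∉ t → Q (A i)) →
      f A = 0 := by
    intro t
    induction t using Finset.induction_on with
    | empty => exact fun A _ hA => h A fun i => hA i (Finset.notMem_empty i)
    | insert i t hi ih =>
      intro A hA hA'
      refine hstep A hA i fun x hx => ih _ (fun j => ?_) fun j hj => ?_
      · rcases eq_or_ne j i with rfl | hji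
        · rw [Function.update_self]; exact hQP x hx
        · rw [Function.update_of_ne hji]; exact hA j
      · rcases eq_or_ne j i with rfl | hji
        · rw [Function.update_self]; exact hx
        · rw [Function.update_of_ne hji]
          exact hA' j fun hm => (Finset.mem_insert.1 hm).elim hji hj
  exact key Finset.univ A hA fun i hi => absurd (Finset.mem_univ i) hi

end Polarisation

/-! ### A form is determined by its values at X†X. -/

section Uniqueness

variable {E : Type*} [AddCommGroup E] [Module ℂ E] {𝒱 : ZMod 2 → Submodule ℂ E}
  [DirectSum.Decomposition 𝒱] {d : ℕ} {K : MixedMultilinear 𝒱 d}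

lemma IsSupersymmetric.perm (hK : IsSupersymmetric 𝒱 K) {A : Fin d → EndL 𝒱}
    (hA : ∀ i, HasParity 𝒱 0 (A i)) (σ : Equiv.Perm (Fin d)) : K (A ∘ σ) = K A := by
  cases d with
  | zero => rw [Subsingleton.elim (A ∘ σ) A]
  | succ n =>
    have hσ : σ ∈ Submonoid.closure
        (Set.range fun i : Fin n => Equiv.swap i.castSucc i.succ) := by
      rw [Equiv.Perm.mclosure_swap_castSucc_succ]; trivial
    induction hσ using Submonoid.closure_induction_left generalizing A with
    | one => rfl
    | mul_left x hx τ _ ih =>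
      obtain ⟨i, rfl⟩ := hx
      have hi : i.castSucc.1 + 1 < n + 1 := by simp
      have e : i.succ = ⟨i.castSucc.1 + 1, hi⟩ := Fin.ext (by simp)
      have h := hK i.castSucc hi 0 0 A (hA _) (hA _)
      rw [superSign_zero_left, one_smul, ← e] at h
      rw [← h, ← ih (A := A ∘ Equiv.swap i.castSucc i.succ) fun j => hA _]
      rfl

variable [FiniteDimensional ℂ E] {B : LinearMap.BilinForm ℂ E} (hB : IsOrthosymplectic 𝒱 B)
  (hK : K ∈ mixedDual 𝒱 d)

include hB hK in
-- For σ ≠ 0 the element σ² + sC is ω(σQ), where Q is the self-adjoint square root of 1 + σ⁻²sC. So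
-- the polynomial K(σ² + sC, …) vanishes for σ ≠ 0, hence at σ = 0, where it is s^d times the value
-- at `C`.
lemma eq_zero_selfadjoint_diag (h : ∀ A X, IsOmega 𝒱 B A X → K (fun _ => A) = 0) {C : EndL 𝒱}
    (hC : IsHomAdjoint 𝒱 B 0 C C) : K (fun _ => C) = 0 := by
  ext v
  obtain ⟨s, hs, hs0, hreg⟩ := exists_even_nilpotent_regular d (K (fun _ => C) v)
  refine hreg ?_
  rw [← mixedDual_even_smul_all hK hs (fun _ => C)]
  let _ := evenStar hB
  have hX : (fun σ : ℂ => σ ^ 2 • (1 : EndL 𝒱) + leftEnd 𝒱 s * C) ∈ polyFun (EndL 𝒱) :=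
    Submodule.add_mem _ (monomial_mem_polyFun _ _) (const_mem_polyFun _)
  have h1 := linearMap_mem_polyFun
    ({ toFun := fun f => f v, map_add' := fun _ _ => rfl, map_smul' := fun _ _ => rfl } :
      MultilinearMap ℂ (fun _ : Fin (2 * d) => SuperMod 𝒱) Grass →ₗ[ℂ] Grass)
    (multilinear_mem_polyFun K fun _ => hX)
  have h2 := polyFun_eq_zero h1 fun σ hσ => ?_
  · simpa using h2
  · set z : evenEnd 𝒱 := ((⟨s, hs⟩ : evenGrass) * algebraMap ℂ evenGrass (σ ^ 2)⁻¹) • ⟨C, hC.1⟩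
      with hz
    have hzs : star z = z := by
      rw [hz, evenStar_smul]
      congr 1
      exact Subtype.ext (hC.eq_dagger hB).symm
    have hzN : z ^ (d + 1) = 0 := by
      rw [hz]
      refine smul_pow_eq_zero ?_ _
      rw [mul_pow, show (⟨s, hs⟩ : evenGrass) ^ (d + 1) = 0 from Subtype.ext hs0, zero_mul]
    obtain ⟨Q, hQ, hQQ, -⟩ := exists_sqrt_of_nilpotent (evenStar_smul hB) hzs hzN
    have hQs : IsHomAdjoint 𝒱 B 0 Q.1 Q.1 :=
      (dagger_isHomAdjoint_self_iff hB Q.2).2 (congrArg Subtype.val hQ)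
    have hz1 : z.1 = (σ ^ 2)⁻¹ • (leftEnd 𝒱 s * C) := by
      rw [hz, mul_comm, mul_smul, coe_algebraMap_smul]
      rfl
    have hom : IsOmega 𝒱 B (σ ^ 2 • (1 : EndL 𝒱) + leftEnd 𝒱 s * C) (σ • Q.1) := by
      refine ⟨hQs.1.smul 𝒱 σ, σ • Q.1, IsSuperadjoint.of_hom (hQs.smul σ), ?_⟩
      have e : Q.1 * Q.1 = 1 + z.1 := congrArg Subtype.val hQQ
      rw [smul_mul_smul_comm, e, hz1, smul_add, smul_smul, ← pow_two,
        mul_inv_cancel₀ (pow_ne_zero 2 hσ), one_smul]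
    change K (fun _ => σ ^ 2 • (1 : EndL 𝒱) + leftEnd 𝒱 s * C) v = 0
    rw [h _ _ hom]
    rfl

include hB hK in
/-- A form that factors through the symmetrisation is determined by its values at `X^† X`. -/
lemma eq_zero_of_omega (hsym : FactorsThroughSym 𝒱 B K)
    (h : ∀ A X, IsOmega 𝒱 B A X → K (fun _ => A) = 0) : K = 0 := by
  have h1 : ∀ A : Fin d → EndL 𝒱, (∀ i, IsHomAdjoint 𝒱 B 0 (A i) (A i)) → K A = 0 := fun A hA =>
    multilinear_eq_zero_of_diag K
      { carrier := {C | IsHomAdjoint 𝒱 B 0 C C}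
        add_mem' := fun hC hD => hC.add hD
        zero_mem' := IsHomAdjoint.zero 0
        smul_mem' := fun c _ hC => hC.smul c }
      (fun C hC => eq_zero_selfadjoint_diag hB hK h hC)
      (fun A hA σ => hsym.2.perm (fun i => (hA i).1) σ) A hA
  -- An odd self-adjoint slot becomes even self-adjoint after right multiplication by an odd ξ. The
  -- ξ moves out to the right up to a nonzero factor, and it is chosen so that it can be cancelled.
  have h2 : ∀ A : Fin d → EndL 𝒱, (∀ i, ∃ p, IsHomAdjoint 𝒱 B p (A i) (A i)) → K A = 0 := by
    refine multilinear_eq_zero_of_slots K (P := fun x => ∃ p, IsHomAdjoint 𝒱 B p x x)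
      (Q := fun x => IsHomAdjoint 𝒱 B 0 x x) (fun x hx => ⟨0, hx⟩) h1 fun A hA i hi => ?_
    obtain ⟨p, hp⟩ := hA i
    rcases zmod_two_cases p with rfl | rfl
    · rw [← Function.update_eq_self i A]
      exact hi _ hp
    · refine multilinear_ext_homogeneous fun v hv => ?_
      obtain ⟨ξ, hξ, hreg⟩ := exists_odd_regular (K A v)
      refine hreg ?_
      obtain ⟨ε, hε, -, e⟩ := mixedDual_smul hK hξ A v
        (Or.inr ⟨fun j => (hA j).imp fun q hq => hq.1, hv⟩) i
      have hAξ : IsHomAdjoint 𝒱 B 0 (A i * leftEnd 𝒱 ξ) (A i * leftEnd 𝒱 ξ) := by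
        have h11 := hp.mul_leftEnd hξ
        rwa [show (1 : ZMod 2) + 1 = 0 from rfl] at h11
      rw [hi _ hAξ, zero_apply] at e
      exact (smul_eq_zero.1 e.symm).resolve_left hε
  -- Split a homogeneous slot into its symmetric and antisymmetric parts under †; the form kills the
  -- latter.
  have h3 : ∀ A : Fin d → EndL 𝒱, (∀ i, ∃ p, HasParity 𝒱 p (A i)) → K A = 0 := by
    refine multilinear_eq_zero_of_slots K (P := fun x => ∃ p, HasParity 𝒱 p x)
      (Q := fun x => ∃ p, IsHomAdjoint 𝒱 B p x x) (fun x hx => hx.imp fun p hp => hp.1) h2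
      fun A hA i hi => ?_
    obtain ⟨p, hp⟩ := hA i
    have hd := dagger_hom hB hp
    have e : A i = (1 / 2 : ℂ) • (A i + dagger hB (A i)) + (1 / 2 : ℂ) • (A i - dagger hB (A i)) := by
      module
    rw [← Function.update_eq_self i A]
    conv_lhs => rw [e]
    rw [MultilinearMap.map_update_add, hi _ ⟨p, ?_⟩, zero_add]
    · refine hsym.1 _ i ?_
      rw [Function.update_self]
      have := IsSuperadjoint.of_hom ((hd.sub (hd.symm hB)).smul (1 / 2 : ℂ))
      rwa [← neg_sub (A i), smul_neg] at this
    · have := (hd.add (hd.symm hB)).smul (1 / 2 : ℂ)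
      rwa [add_comm (dagger hB (A i))] at this
  ext1 A
  refine multilinear_eq_zero_of_slots K (P := fun _ => True)
    (Q := fun x => ∃ p, HasParity 𝒱 p x) (fun _ _ => trivial) h3
    (fun A _ i hi => ?_) A fun _ => trivial
  rw [← Function.update_eq_self i A, ← parityPart_add 𝒱 (A i), MultilinearMap.map_update_add,
    hi _ ⟨0, parityPart_hasParity 𝒱 0 _⟩, hi _ ⟨1, parityPart_hasParity 𝒱 1 _⟩, add_zero]

end Uniqueness

end OrthoSymp

end

open scoped TensorProduct MulOpposite

noncomputable section

set_option linter.unusedSectionVars false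
set_option linter.unusedVariables false

namespace OrthoSymp

/-! ### Construction of the lift. -/

section Omega

variable {E : Type*} [AddCommGroup E] [Module ℂ E] {𝒱 : ZMod 2 → Submodule ℂ E}
  [DirectSum.Decomposition 𝒱] {B : LinearMap.BilinForm ℂ E} {d : ℕ}

lemma FactorsThroughSym.add {H K : MixedMultilinear 𝒱 d} (hH : FactorsThroughSym 𝒱 B H)
    (hK : FactorsThroughSym 𝒱 B K) : FactorsThroughSym 𝒱 B (H + K) :=
  ⟨fun A i hA => by rw [add_apply, hH.1 A i hA, hK.1 A i hA, add_zero],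
    fun i hi p q A hp hq => by
      rw [add_apply, add_apply, hH.2 i hi p q A hp hq, hK.2 i hi p q A hp hq, smul_add]⟩

lemma FactorsThroughSym.sub {H K : MixedMultilinear 𝒱 d} (hH : FactorsThroughSym 𝒱 B H)
    (hK : FactorsThroughSym 𝒱 B K) : FactorsThroughSym 𝒱 B (H - K) :=
  ⟨fun A i hA => by rw [sub_apply, hH.1 A i hA, hK.1 A i hA, sub_zero],
    fun i hi p q A hp hq => by
      rw [sub_apply, sub_apply, hH.2 i hi p q A hp hq, hK.2 i hi p q A hp hq, smul_sub]⟩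

lemma FactorsThroughSym.smul {H : MixedMultilinear 𝒱 d} (hH : FactorsThroughSym 𝒱 B H)
    (a : Grass) : FactorsThroughSym 𝒱 B (a • H) :=
  ⟨fun A i hA => by rw [smul_apply, hH.1 A i hA, smul_zero],
    fun i hi p q A hp hq => by
      rw [smul_apply, smul_apply, hH.2 i hi p q A hp hq, smul_comm]⟩

lemma IsOmega.one : IsOmega 𝒱 B 1 1 :=
  ⟨HasParity.one 𝒱, 1, IsSuperadjoint.of_hom IsHomAdjoint.one, (mul_one 1).symm⟩

variable [FiniteDimensional ℂ E] (hB : IsOrthosymplectic 𝒱 B)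
include hB

lemma IsOmega.selfadjoint {A X : EndL 𝒱} (h : IsOmega 𝒱 B A X) : IsHomAdjoint 𝒱 B 0 A A := by
  obtain ⟨hX, X', hX', rfl⟩ := h
  have h := hX'.hom hB hX
  exact (h.symm hB).mul_even h

lemma eq_of_omega {H K : MixedMultilinear 𝒱 d} (hH : H ∈ mixedDual 𝒱 d) (hK : K ∈ mixedDual 𝒱 d)
    (hH' : FactorsThroughSym 𝒱 B H) (hK' : FactorsThroughSym 𝒱 B K)
    (h : ∀ A X, IsOmega 𝒱 B A X → ∀ v, H (fun _ => A) v = K (fun _ => A) v) : H = K :=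
  sub_eq_zero.1 <| eq_zero_of_omega hB (mixedDual_sub hH hK) (hH'.sub hK') fun A X hAX => by
    ext v
    rw [sub_apply, sub_apply, h A X hAX v, sub_self]
    rfl

/-- The projection onto the endomorphisms that are symmetric under the superadjoint. -/
def symPart : EndL 𝒱 →ₗ[ℂ] EndL 𝒱 := (1 / 2 : ℂ) • (LinearMap.id + dagger hB)

lemma symPart_apply (A : EndL 𝒱) : symPart hB A = (1 / 2 : ℂ) • (A + dagger hB A) := rfl

lemma symPart_mul_leftEnd (A : EndL 𝒱) (a : Grass) :
    symPart hB (A * leftEnd 𝒱 a) = symPart hB A * leftEnd 𝒱 a := by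
  rw [symPart_apply, symPart_apply, dagger_mul_leftEnd, ← add_mul, smul_mul_assoc]

lemma symPart_leftEnd_mul (A : EndL 𝒱) (a : Grass) :
    symPart hB (leftEnd 𝒱 a * A) = leftEnd 𝒱 a * symPart hB A := by
  rw [symPart_apply, symPart_apply, dagger_leftEnd_mul, ← mul_add, mul_smul_comm]

lemma symPart_hasParity {p : ZMod 2} {A : EndL 𝒱} (hA : HasParity 𝒱 p A) :
    HasParity 𝒱 p (symPart hB A) :=
  (hA.add 𝒱 (dagger_hom hB hA).2.1).smul 𝒱 _

lemma symPart_of_selfadjoint {A : EndL 𝒱} (hA : IsHomAdjoint 𝒱 B 0 A A) : symPart hB A = A := by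
  rw [symPart_apply, ← hA.eq_dagger hB]
  module

lemma symPart_of_antisymmetric {A : EndL 𝒱} (hA : IsSuperadjoint 𝒱 B A (-A)) :
    symPart hB A = 0 := by
  rw [symPart_apply, ← hA.eq_dagger hB, add_neg_cancel, smul_zero]

/-- Precompose every slot with the projection `symPart`. It is linear over Λ on both sides and
preserves parity, so balancedness and supersymmetry survive, and it fixes self-adjoint arguments. -/
lemma exists_symmetrised {K : MixedMultilinear 𝒱 d} (hK : K ∈ mixedDual 𝒱 d)
    (hsym : IsSupersymmetric 𝒱 K) :
    ∃ H ∈ mixedDual 𝒱 d, FactorsThroughSym 𝒱 B H ∧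
      ∀ A, IsHomAdjoint 𝒱 B 0 A A → H (fun _ => A) = K fun _ => A := by
  have hu : ∀ (A : Fin d → EndL 𝒱) (i : Fin d) (X : EndL 𝒱),
      (fun j => symPart hB (Function.update A i X j)) =
        Function.update (fun j => symPart hB (A j)) i (symPart hB X) := fun A i X => by
    ext1 j
    exact Function.apply_update (fun _ X => symPart hB X) A i X j
  refine ⟨K.compLinearMap fun _ => symPart hB, ⟨fun A => hK.1 _, fun A i hi a => ?_,
    fun A i hi h0 a v => ?_⟩, ⟨fun A i hA => ?_, fun i hi p q A hp hq => ?_⟩, fun A hA => ?_⟩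
  · simp only [MultilinearMap.compLinearMap_apply, hu]
    rw [endRightMul_eq, smul_eq_leftEnd_mul, symPart_mul_leftEnd, symPart_leftEnd_mul]
    exact mixedDual_move hK (fun j => symPart hB (A j)) i hi a
  · simp only [MultilinearMap.compLinearMap_apply, hu]
    rw [endRightMul_eq, symPart_mul_leftEnd]
    exact mixedDual_move_last hK (fun j => symPart hB (A j)) i hi h0 a v
  · rw [MultilinearMap.compLinearMap_apply]
    exact MultilinearMap.map_coord_zero K i (symPart_of_antisymmetric hB hA)
  · exact hsym i hi p q (fun j => symPart hB (A j)) (symPart_hasParity hB hp)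
      (symPart_hasParity hB hq)
  · rw [MultilinearMap.compLinearMap_apply, symPart_of_selfadjoint hB hA]

lemma exists_lift {L : MultilinearMap ℂ (fun _ : Fin (2 * d) => SuperMod 𝒱) Grass}
    (hL : L ∈ ospInvariants 𝒱 B (2 * d)) :
    ∃ H ∈ mixedDual 𝒱 d, FactorsThroughSym 𝒱 B H ∧
      ∀ A X, IsOmega 𝒱 B A X → ∀ v, H (fun _ => A) v = L fun j => X (v j) := by
  rcases Nat.eq_zero_or_pos d with rfl | hd
  -- For `d = 0` there is neither an endomorphism nor a vector, and L itself is the form. The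
  -- general construction needs a first vector on which scalars can act.
  · refine ⟨MultilinearMap.constOfIsEmpty ℂ _ L, ⟨fun A => hL.1, fun A i => i.elim0,
      fun A i => i.elim0⟩, ⟨fun A i => i.elim0, fun i => i.elim0⟩, fun A X _ v => ?_⟩
    change L v = _
    congr 1
    exact funext fun i => Fin.elim0 i
  · obtain ⟨K, hK, hKL⟩ := exists_sqrtForm (by omega : 0 < 2 * d) hL.1
    obtain ⟨K', hK', hsym, hKK'⟩ := exists_supersymmetric (by omega : 0 < 2 * d) hK
    obtain ⟨H, hH, hH', hHK⟩ := exists_symmetrised hB hK' hsym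
    refine ⟨H, hH, hH', fun A X hAX v => ?_⟩
    have hA := hAX.selfadjoint hB
    rw [hHK A hA, hKK' A hA.1]
    obtain ⟨hX, X', hX', rfl⟩ := hAX
    exact lift_omega hB hK hL hKL (hX'.hom hB hX) v

end Omega

/-! ### Invariance under GL(V). -/

section GeneralLinear

variable {E : Type*} [AddCommGroup E] [Module ℂ E] {𝒱 : ZMod 2 → Submodule ℂ E}
  [DirectSum.Decomposition 𝒱] {B : LinearMap.BilinForm ℂ E} {d : ℕ} {H : MixedMultilinear 𝒱 d}

/-- The action of a pair of even endomorphisms on forms. -/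
def conjForm (H : MixedMultilinear 𝒱 d) (P Q g : EndL 𝒱) : MixedMultilinear 𝒱 d :=
  (MultilinearMap.compLinearMapₗ (R := ℂ) fun _ : Fin (2 * d) => g.restrictScalars ℂ).compMultilinearMap
    (H.compLinearMap fun _ => LinearMap.mulLeft ℂ P ∘ₗ LinearMap.mulRight ℂ Q)

lemma conjForm_apply (P Q g : EndL 𝒱) (A : Fin d → EndL 𝒱) (v : Fin (2 * d) → SuperMod 𝒱) :
    conjForm H P Q g A v = H (fun i => P * A i * Q) fun j => g (v j) := by
  simp only [mul_assoc]
  rfl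

variable {P Q g : EndL 𝒱} (hP : HasParity 𝒱 0 P) (hQ : HasParity 𝒱 0 Q) (hg : HasParity 𝒱 0 g)
include hP hQ hg

lemma conjForm_mem (hH : H ∈ mixedDual 𝒱 d) : conjForm H P Q g ∈ mixedDual 𝒱 d := by
  have hu : ∀ (A : Fin d → EndL 𝒱) (i : Fin d) (X : EndL 𝒱),
      (fun j => P * Function.update A i X j * Q) =
        Function.update (fun j => P * A j * Q) i (P * X * Q) := fun A i X => by
    ext1 j
    exact Function.apply_update (fun _ X => P * X * Q) A i X j
  have hr : ∀ (A : EndL 𝒱) a, P * (A * leftEnd 𝒱 a) * Q = P * A * Q * leftEnd 𝒱 a := fun A a => by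
    have := hQ.mul_leftEnd 𝒱 a
    rw [invPow_zero] at this
    rw [mul_assoc (P * A), this]
    simp only [mul_assoc]
  have hl : ∀ (A : EndL 𝒱) a, P * (leftEnd 𝒱 a * A) * Q = leftEnd 𝒱 a * (P * A * Q) := fun A a => by
    have := hP.mul_leftEnd 𝒱 a
    rw [invPow_zero] at this
    rw [← mul_assoc P, this]
    simp only [mul_assoc]
  refine ⟨fun A => ?_, fun A i hi a => ?_, fun A i hi h0 a v => ?_⟩
  · refine comp_mem_tensorDual (hH.1 fun i => P * A i * Q) (fun _ => g.restrictScalars ℂ)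
      (fun _ a => a) (fun i _ a v => map_smul g _ _) (fun i _ a v => ?_)
      fun i _ a v => map_smul g _ _
    have := hg.map_smul 𝒱 a v
    rwa [invPow_zero] at this
  · ext v
    rw [conjForm_apply, conjForm_apply, hu, hu, endRightMul_eq, smul_eq_leftEnd_mul, hr, hl]
    exact congrArg (fun f : MultilinearMap ℂ _ _ => f _)
      (mixedDual_move hH (fun j => P * A j * Q) i hi a)
  · rw [conjForm_apply, conjForm_apply, hu, endRightMul_eq, hr]
    refine (mixedDual_move_last hH (fun j => P * A j * Q) i hi h0 a _).trans ?_
    congr 1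
    ext1 j
    have := hg.map_smul 𝒱 a (v ⟨0, h0⟩)
    rw [invPow_zero] at this
    rcases eq_or_ne j ⟨0, h0⟩ with rfl | hj
    · rw [Function.update_self, Function.update_self, this]
    · rw [Function.update_of_ne hj, Function.update_of_ne hj]

lemma conjForm_factorsThroughSym (hB : IsOrthosymplectic 𝒱 B) [FiniteDimensional ℂ E]
    (hPQ : IsHomAdjoint 𝒱 B 0 Q P) (hH : FactorsThroughSym 𝒱 B H) :
    FactorsThroughSym 𝒱 B (conjForm H P Q g) := by
  have hhom : ∀ {i A A'}, IsHomAdjoint 𝒱 B i A A' →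
      IsHomAdjoint 𝒱 B i (P * A * Q) (P * A' * Q) := fun {i A A'} hA => by
    have h := ((hPQ.symm hB).mul hA).mul hPQ
    simpa [mul_assoc] using h
  refine ⟨fun A i hA => ?_, fun i hi p q A hp hq => ?_⟩
  · ext v
    rw [conjForm_apply, hH.1 _ i]
    · rfl
    · obtain ⟨A₀, A₁, A₀', A₁', e, e', h0, h1⟩ := hA
      have := (IsSuperadjoint.of_hom (hhom h0)).add (IsSuperadjoint.of_hom (hhom h1))
      rw [← add_mul, ← add_mul, ← mul_add, ← mul_add, ← e, ← e', mul_neg, neg_mul] at this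
      exact this
  · ext v
    rw [smul_apply, conjForm_apply, conjForm_apply]
    have hpar : ∀ {i A}, HasParity 𝒱 i A → HasParity 𝒱 i (P * A * Q) := fun {i A} hA => by
      simpa using (hP.mul 𝒱 hA).mul 𝒱 hQ
    exact congrArg (fun f : MultilinearMap ℂ _ _ => f _)
      (hH.2 i hi p q (fun j => P * A j * Q) (hpar hp) (hpar hq))

omit hP hQ hg

/-- The transformed form has the same values at every X†X: the action carries ω(X) to ω(Xg⁻¹) and v
to gv, and L((Xg⁻¹)(gv)) = L(Xv). Uniqueness then identifies the two forms. -/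
lemma glInvariant_of_omega [FiniteDimensional ℂ E] (hB : IsOrthosymplectic 𝒱 B)
    {L : MultilinearMap ℂ (fun _ : Fin (2 * d) => SuperMod 𝒱) Grass}
    (hH : H ∈ mixedDual 𝒱 d) (hH' : FactorsThroughSym 𝒱 B H)
    (hHL : ∀ A X, IsOmega 𝒱 B A X → ∀ v, H (fun _ => A) v = L fun j => X (v j)) :
    H ∈ glInvariants 𝒱 B d := by
  refine ⟨hH, fun g ghat hg A v => ?_⟩
  have hgi : g.toEnd * (g⁻¹ : GLSuper 𝒱).toEnd = 1 := congrArg Subtype.val (g.mul_inv)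
  have hgi' : (g⁻¹ : GLSuper 𝒱).toEnd * g.toEnd = 1 := congrArg Subtype.val (g.inv_mul)
  have hki : (ghat⁻¹ : GLSuper 𝒱).toEnd * ghat.toEnd = 1 := congrArg Subtype.val (ghat.inv_mul)
  have pg : HasParity 𝒱 0 g.toEnd := g.val.2
  have pgi : HasParity 𝒱 0 (g⁻¹ : GLSuper 𝒱).toEnd := (g⁻¹).val.2
  have pk : HasParity 𝒱 0 ghat.toEnd := ghat.val.2
  -- From g† = ĝ⁻¹, taking adjoints of g g⁻¹ = 1 shows that (g⁻¹)† is inverse to ĝ⁻¹.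
  have hadj : IsHomAdjoint 𝒱 B 0 (g⁻¹ : GLSuper 𝒱).toEnd ghat.toEnd := by
    have h1 := dagger_hom hB pgi
    have h2 := (hg.hom hB pg).mul_even h1
    rw [hgi] at h2
    have h3 : dagger hB (g⁻¹ : GLSuper 𝒱).toEnd * (ghat⁻¹ : GLSuper 𝒱).toEnd = 1 :=
      h2.unique hB IsHomAdjoint.one
    have h4 : dagger hB (g⁻¹ : GLSuper 𝒱).toEnd = ghat.toEnd := by
      rw [← mul_one (dagger hB _), ← hki, ← mul_assoc, h3, one_mul]
    rwa [h4] at h1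
  have key : conjForm H ghat.toEnd (g⁻¹ : GLSuper 𝒱).toEnd g.toEnd = H := by
    refine eq_of_omega hB (conjForm_mem pk pgi pg hH) hH
      (conjForm_factorsThroughSym pk pgi pg hB hadj hH') hH' fun A X hAX v => ?_
    have hom : IsOmega 𝒱 B (ghat.toEnd * A * (g⁻¹ : GLSuper 𝒱).toEnd)
        (X * (g⁻¹ : GLSuper 𝒱).toEnd) := by
      obtain ⟨hX, X', hX', rfl⟩ := hAX
      refine ⟨by simpa using hX.mul 𝒱 pgi, ghat.toEnd * X',
        IsSuperadjoint.of_hom ((hX'.hom hB hX).mul_even hadj), ?_⟩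
      simp only [mul_assoc]
    rw [conjForm_apply, hHL _ _ hom, hHL _ _ hAX]
    congr 1
    ext1 j
    rw [← Module.End.mul_apply, mul_assoc, hgi', mul_one]
  rw [← conjForm_apply, key]

end GeneralLinear

/-! ### Uniqueness of the polynomial form. -/

section PolyLift

variable {E : Type*} [AddCommGroup E] [Module ℂ E] {𝒱 : ZMod 2 → Submodule ℂ E}
  [DirectSum.Decomposition 𝒱] {B : LinearMap.BilinForm ℂ E} {d : ℕ} {H : MixedMultilinear 𝒱 d}

/-- The difference of the form representing `F` and `H` vanishes at all X†X, hence on the diagonal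
of even self-adjoint endomorphisms. Only diagonal values matter, so no symmetry of the representing
form is needed. -/
lemma IsPolyLift.eq_diag [FiniteDimensional ℂ E] (hB : IsOrthosymplectic 𝒱 B)
    {L : MultilinearMap ℂ (fun _ : Fin (2 * d) => SuperMod 𝒱) Grass}
    (hH : H ∈ mixedDual 𝒱 d)
    (hHL : ∀ A X, IsOmega 𝒱 B A X → ∀ v, H (fun _ => A) v = L fun j => X (v j))
    {F : EvenSym 𝒱 B → (Fin (2 * d) → SuperMod 𝒱) → Grass} (hF : IsPolyLift 𝒱 B d L F) :
    F = fun A v => H (fun _ => A.1) v := by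
  obtain ⟨⟨K, hK, hFK⟩, hFL⟩ := hF
  ext1 A
  ext1 v
  have h := eq_zero_selfadjoint_diag hB (mixedDual_sub hK hH) (fun C X hCX => ?_)
    (A.2.2.hom hB A.2.1)
  · rw [hFK, ← sub_eq_zero]
    exact congrArg (fun f : MultilinearMap ℂ _ _ => f v) h
  · ext w
    have hC := hCX.selfadjoint hB
    rw [sub_apply, sub_apply, hHL C X hCX w,
      ← hFK ⟨C, hC.1, IsSuperadjoint.of_hom hC⟩, hFL ⟨C, hC.1, IsSuperadjoint.of_hom hC⟩ X hCX,
      sub_self]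
    rfl

end PolyLift

end OrthoSymp

end

/-! ### The main theorem. -/

theorem mainTheorem4 {E : Type*} [AddCommGroup E] [Module ℂ E] [FiniteDimensional ℂ E]
    (𝒱 : ZMod 2 → Submodule ℂ E) [DirectSum.Decomposition 𝒱]
    (B : LinearMap.BilinForm ℂ E) (hB : OrthoSymp.IsOrthosymplectic 𝒱 B) (d : ℕ) :
    ∃ h : OrthoSymp.ospInvariants 𝒱 B (2 * d) →ₗ[OrthoSymp.Grass] OrthoSymp.glInvariants 𝒱 B d,
      Function.Injective h ∧
      ∀ L : OrthoSymp.ospInvariants 𝒱 B (2 * d),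
        -- the polynomial form `F_L` exists and is unique
        (∃! F, OrthoSymp.IsPolyLift 𝒱 B d L.1 F) ∧
        -- `H_L` is the pullback of `F_L` along the canonical surjection
        OrthoSymp.FactorsThroughSym 𝒱 B (h L).1 ∧
        (∀ F, OrthoSymp.IsPolyLift 𝒱 B d L.1 F →
          ∀ (A : OrthoSymp.EvenSym 𝒱 B) (v : Fin (2 * d) → OrthoSymp.SuperMod 𝒱),
            (h L).1 (fun _ => A.1) v = F A v) ∧
        -- and `H_L` is the only form with these properties
        (∀ H ∈ OrthoSymp.mixedDual 𝒱 d, OrthoSymp.FactorsThroughSym 𝒱 B H →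
          (∀ A X : OrthoSymp.EndL 𝒱, OrthoSymp.IsOmega 𝒱 B A X →
            ∀ v : Fin (2 * d) → OrthoSymp.SuperMod 𝒱,
              H (fun _ => A) v = L.1 (fun j => X (v j))) →
          H = (h L).1) ∧
        (∀ v : Fin (2 * d) → OrthoSymp.SuperMod 𝒱, (h L).1 (fun _ => 1) v = L.1 v) ∧
        (∀ A X : OrthoSymp.EndL 𝒱, OrthoSymp.IsOmega 𝒱 B A X →
          ∀ v : Fin (2 * d) → OrthoSymp.SuperMod 𝒱,
            (h L).1 (fun _ => A) v = L.1 (fun j => X (v j))) ∧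
        OrthoSymp.KillsAntisymmetric 𝒱 B (h L).1 := by
  -- The lifts are chosen separately for each L; uniqueness through `eq_of_omega` makes the choice
  -- additive and Λ-linear.
  choose T hT hT' hTL using fun L : OrthoSymp.ospInvariants 𝒱 B (2 * d) =>
    OrthoSymp.exists_lift hB L.2
  refine ⟨{ toFun := fun L => ⟨T L, OrthoSymp.glInvariant_of_omega hB (hT L) (hT' L) (hTL L)⟩
            map_add' := fun L M => Subtype.ext ?_
            map_smul' := fun c L => Subtype.ext ?_ }, fun L M h => ?_, fun L => ⟨?_, hT' L, ?_, ?_,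
      ?_, hTL L, (hT' L).1⟩⟩
  · refine OrthoSymp.eq_of_omega hB (hT _) (Submodule.add_mem _ (hT L) (hT M)) (hT' _)
      ((hT' L).add (hT' M)) fun A X hAX v => ?_
    change T (L + M) (fun _ => A) v = T L (fun _ => A) v + T M (fun _ => A) v
    rw [hTL _ A X hAX, hTL L A X hAX, hTL M A X hAX]
    rfl
  · refine OrthoSymp.eq_of_omega hB (hT _) (Submodule.smul_mem _ c (hT L)) (hT' _)
      ((hT' L).smul c) fun A X hAX v => ?_
    change T (c • L) (fun _ => A) v = c • T L (fun _ => A) v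
    rw [hTL _ A X hAX, hTL L A X hAX]
    rfl
  -- Evaluation at X = 1 recovers L from its lift.
  · refine Subtype.ext (MultilinearMap.ext fun v => ?_)
    have e : T L = T M := congrArg Subtype.val h
    exact (hTL L 1 1 OrthoSymp.IsOmega.one v).symm.trans
      ((congrArg (fun K : OrthoSymp.MixedMultilinear 𝒱 d => K (fun _ => 1) v) e).trans
        (hTL M 1 1 OrthoSymp.IsOmega.one v))
  · exact ⟨fun A v => T L (fun _ => A.1) v, ⟨⟨T L, hT L, fun _ _ => rfl⟩,
      fun A X hAX v => hTL L A.1 X hAX v⟩, fun F hF => hF.eq_diag hB (hT L) (hTL L)⟩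
  · intro F hF A v
    rw [hF.eq_diag hB (hT L) (hTL L)]
    rfl
  · exact fun H hH hH' hHL => OrthoSymp.eq_of_omega hB hH (hT L) hH' (hT' L) fun A X hAX v =>
      (hHL A X hAX v).trans (hTL L A X hAX v).symm
  · exact hTL L 1 1 OrthoSymp.IsOmega.one
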